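/- **Setting.** Let $(X,d)$ be a nonempty metric space that is geometrically doubling: there is $N\in\mathbb N$ such that every open ball $B(x,r)$ is covered by at most $N$ balls of radius $r/2$. A ball $B$ means an open ball with a given centre $x_B$ and radius $r_B>0$; $\rho B$ is the ball $B(x_B,\rho r_B)$; inclusions between balls are inclusions of sets. Let $\mu$ be a Borel measure on $X$ with a dominating function $\lambda:X\times(0,\infty)\to(0,\infty)$, that is: $r\mapsto\lambda(x,r)$ is nondecreasing for each $x$; there is $C_\lambda>0$ with $\lambda(x,2r)\le C_\lambda\lambda(x,r)$ for all $x,r$; $\mu(B(x,r))\le\lambda(x,r)$ for all $x,r$; and there is $C>0$ with $\lambda(x,r)\le C\lambda(y,r)$ whenever $d(x,y)\le r$. For balls $B\subset Q$ put $$K_{B,Q}=1+\int_{r_B\le d(x,x_B)\le r_Q}\frac{d\mu(x)}{\lambda(x_B,d(x,x_B))}.$$ All functions are real valued; functions equal $\mu$-a.e. are identified. **RBMO.** Fix $\sigma>1$. A function $g$ that is integrable on every ball belongs to $\mathrm{RBMO}(\mu)$ if there are $C\ge 0$ and numbers $g_B$, one for each ball $B$, with $$\int_B|g-g_B|\,d\mu\le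 C\mu(\sigma B)\ \text{ for every ball } B,\qquad |g_B-g_{B_1}|\le C K_{B,B_1}\ \text{ for all balls } B\subset B_1 .$$ $\|g\|_{\mathrm{RBMO}(\mu)}$ is the infimum of all such $C$. **Atomic Hardy spaces.** Let $1<q\le\infty$ and fix $\rho>1$. A $q$-atomic block is a function $b\in L^1(\mu)$ that vanishes outside some ball $B$, has $\int b\,d\mu=0$, and is of the form $b=\sum_{j=1}^\infty c_ja_j$ with convergence in $L^1(\mu)$, where $c_j\in\mathbb R$ and $a_j$ vanishes outside a ball $B_j\subset B$ and satisfies $\|a_j\|_{L^q(\mu)}\le\mu(\rho B_j)^{1/q-1}K_{B_j,B}^{-1}$ (with $1/q=0$ if $q=\infty$, and $a_j=0$ if $\mu(\rho B_j)=0$). The space $H^{1,q}_{at}(\mu)$ consists of the $f=\sum_{i=1}^\infty b_i$ in $L^1(\mu)$ with $q$-atomic blocks $b_i=\sum_jc_{ij}a_{ij}$ as above and $\sum_{i,j}|c_{ij}|<\infty$; $\|f\|_{H^{1,q}_{at}(\mu)}$ is the infimum of $\sum_{i,j}|c_{ij}|$ over all such representations. **Theorem.** Let $1<p<\infty$. The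 parameters ($\rho$ for $H^{1,p}_{at}(\mu)$, $\rho'$ for $H^{1,\infty}_{at}(\mu)$, $\sigma$ for $\mathrm{RBMO}(\mu)$) may be any numbers greater than $1$. 1. $H^{1,p}_{at}(\mu)=H^{1,\infty}_{at}(\mu)$, with equivalent norms. 2. $H^{1,p}_{at}(\mu)^*=H^{1,\infty}_{at}(\mu)^*=\mathrm{RBMO}(\mu)$. That is, for $q=p$ and for $q=\infty$: for every $g\in\mathrm{RBMO}(\mu)$ there is exactly one bounded linear functional $L_g$ on $H^{1,q}_{at}(\mu)$ such that $L_g(f)=\int_Xfg\,d\mu$ for every $f\in H^{1,q}_{at}(\mu)$ for which $fg$ is integrable; the map $g\mapsto L_g$ is linear from $\mathrm{RBMO}(\mu)$ onto $H^{1,q}_{at}(\mu)^*$; $L_g=0$ if and only if $g$ is $\mu$-a.e. constant; and there is $C$ with $C^{-1}\|g\|_{\mathrm{RBMO}(\mu)}\le\|L_g\|_{H^{1,q}_{at}(\mu)^*}\le C\|g\|_{\mathrm{RBMO}(\mu)}$ for all $g\in\mathrm{RBMO}(\mu)$. -/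

import Mathlib

open MeasureTheory Metric
open scoped ENNReal NNReal

noncomputable section

namespace NonHom

/-- Geometrically doubling metric space: there is `N` such that every open ball of radius `r` is
covered by at most `N` open balls of radius `r / 2`. -/
def GeometricallyDoubling (X : Type*) [MetricSpace X] : Prop :=
  ∃ N : ℕ, ∀ (x : X) (r : ℝ), 0 < r →
    ∃ s : Finset X, s.card ≤ N ∧ ball x r ⊆ ⋃ y ∈ s, ball y (r / 2)

variable {X : Type*} [MetricSpace X] [MeasurableSpace X]

/-- `lam` is a dominating function for `μ`; only its values at radii `r > 0` matter. A measure is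
upper doubling if it has a dominating function. -/
structure IsDominating (μ : Measure X) (lam : X → ℝ → ℝ) : Prop where
  pos : ∀ x r, 0 < r → 0 < lam x r
  mono : ∀ x r s, 0 < r → r ≤ s → lam x r ≤ lam x s
  doubling : ∃ C : ℝ, 0 < C ∧ ∀ x r, 0 < r → lam x (2 * r) ≤ C * lam x r
  measure_le : ∀ x r, 0 < r → μ (ball x r) ≤ ENNReal.ofReal (lam x r)
  comparable : ∃ C : ℝ, 0 < C ∧ ∀ x y r, 0 < r → dist x y ≤ r → lam x r ≤ C * lam y r

/-- The coefficient `K_{B,Q}` for balls `B = B(x, r)` and `Q` of radius `s`; the centre of `Q` does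
not enter. A ball is understood throughout as a centre together with a radius. -/
def kCoeff (μ : Measure X) (lam : X → ℝ → ℝ) (x : X) (r s : ℝ) : ℝ :=
  1 + ∫ y in {y | r ≤ dist y x ∧ dist y x ≤ s}, (lam x (dist y x))⁻¹ ∂μ

/-! ### The space RBMO -/

/-- The constant `C` is admissible for `g` in the definition of `RBMO(μ)`; the number `m x r` is
the one attached to the ball `B(x, r)`. -/
def RBMOBound (μ : Measure X) (lam : X → ℝ → ℝ) (ρ : ℝ) (g : X → ℝ) (C : ℝ≥0) : Prop :=
  ∃ m : X → ℝ → ℝ,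
    (∀ x r, 0 < r →
      ∫⁻ y in ball x r, ‖g y - m x r‖ₑ ∂μ ≤ C * μ (ball x (ρ * r))) ∧
    (∀ x y r s, 0 < r → 0 < s → ball x r ⊆ ball y s →
      |m x r - m y s| ≤ C * kCoeff μ lam x r s)

/-- The `RBMO(μ)` norm (a seminorm on functions, which vanishes on constants). -/
def rbmoNorm (μ : Measure X) (lam : X → ℝ → ℝ) (ρ : ℝ) (g : X → ℝ) : ℝ≥0∞ :=
  ⨅ (C : ℝ≥0) (_ : RBMOBound μ lam ρ g C), (C : ℝ≥0∞)

/-- The space `RBMO(μ)`. Local integrability means integrability on every ball. -/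
def rbmo (μ : Measure X) (lam : X → ℝ → ℝ) (ρ : ℝ) : Submodule ℝ (X → ℝ) where
  carrier := {g | (∀ x r, IntegrableOn g (ball x r) μ) ∧ ∃ C, RBMOBound μ lam ρ g C}
  zero_mem' := by
    refine ⟨fun x r => integrableOn_zero, 0, fun _ _ => 0, ?_, ?_⟩ <;> simp
  add_mem' := by
    rintro g h ⟨hg, C, m, hm₁, hm₂⟩ ⟨hh, D, n, hn₁, hn₂⟩
    refine ⟨fun x r => (hg x r).add (hh x r), C + D, fun x r => m x r + n x r, ?_, ?_⟩
    · intro x r hr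
      calc ∫⁻ y in ball x r, ‖(g + h) y - (m x r + n x r)‖ₑ ∂μ
          ≤ ∫⁻ y in ball x r, (‖g y - m x r‖ₑ + ‖h y - n x r‖ₑ) ∂μ := by
            refine lintegral_mono fun y => ?_
            have : (g + h) y - (m x r + n x r) = (g y - m x r) + (h y - n x r) := by
              simp only [Pi.add_apply]; ring
            rw [this]
            exact enorm_add_le _ _
        _ = ∫⁻ y in ball x r, ‖g y - m x r‖ₑ ∂μ + ∫⁻ y in ball x r, ‖h y - n x r‖ₑ ∂μ := by
            refine lintegral_add_left' ?_ _
            exact ((hg x r).aestronglyMeasurable.sub aestronglyMeasurable_const).enorm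
        _ ≤ C * μ (ball x (ρ * r)) + D * μ (ball x (ρ * r)) :=
            add_le_add (hm₁ x r hr) (hn₁ x r hr)
        _ = _ := by push_cast; ring
    · intro x y r s hr hs hsub
      have h1 := hm₂ x y r s hr hs hsub
      have h2 := hn₂ x y r s hr hs hsub
      have h3 := abs_add_le (m x r - m y s) (n x r - n y s)
      have h4 : m x r + n x r - (m y s + n y s) = (m x r - m y s) + (n x r - n y s) := by ring
      rw [h4]
      push_cast
      linarith
  smul_mem' := by
    rintro t g ⟨hg, C, m, hm₁, hm₂⟩
    refine ⟨fun x r => (hg x r).smul t, ‖t‖₊ * C, fun x r => t * m x r, ?_, ?_⟩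
    · intro x r hr
      have h0 : ∀ y, ‖(t • g) y - t * m x r‖ₑ = ‖t‖ₑ * ‖g y - m x r‖ₑ := by
        intro y
        rw [← enorm_mul]
        congr 1
        simp only [Pi.smul_apply, smul_eq_mul]; ring
      simp_rw [h0]
      rw [lintegral_const_mul' _ _ enorm_ne_top]
      push_cast
      rw [mul_assoc]
      exact mul_le_mul_right (hm₁ x r hr) _
    · intro x y r s hr hs hsub
      rw [← mul_sub, abs_mul]
      push_cast
      rw [mul_assoc]
      exact mul_le_mul_of_nonneg_left (hm₂ x y r s hr hs hsub) (abs_nonneg t)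

/-! ### Atomic Hardy spaces -/

/-- `f` vanishes almost everywhere outside `s`. -/
def SupportedIn {μ : Measure X} (f : Lp ℝ 1 μ) (s : Set X) : Prop :=
  ∀ᵐ y ∂μ, y ∉ s → f y = 0

/-- `b` is a `q`-atomic block (`1 < q ≤ ∞`) with coefficients `c`: it is supported in a ball `B`,
has integral zero, and is the `L¹` sum of `c j • a j`, with `a j` supported in a ball `B_j ⊆ B` and
`‖a j‖_q ≤ μ(ρ B_j)^{1/q - 1} K_{B_j,B}⁻¹`. For `q = ∞` the exponent is `-1`. -/
def IsAtomicBlock (μ : Measure X) (lam : X → ℝ → ℝ) (ρ : ℝ) (q : ℝ≥0∞)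
    (b : Lp ℝ 1 μ) (c : ℕ → ℝ) : Prop :=
  ∃ (x : X) (r : ℝ), 0 < r ∧ SupportedIn b (ball x r) ∧ ∫ y, b y ∂μ = 0 ∧
    ∃ (a : ℕ → Lp ℝ 1 μ) (z : ℕ → X) (s : ℕ → ℝ),
      (∀ j, 0 < s j ∧ ball (z j) (s j) ⊆ ball x r ∧ SupportedIn (a j) (ball (z j) (s j)) ∧
        eLpNorm (a j) q μ ≤ μ (ball (z j) (ρ * s j)) ^ ((q⁻¹).toReal - 1) *
          (ENNReal.ofReal (kCoeff μ lam (z j) (s j) r))⁻¹) ∧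
      HasSum (fun j => c j • a j) b

/-- `f = ∑ b_i` with `q`-atomic blocks `b_i`, the `i`-th one with coefficients `c i`. -/
def IsDecomposition (μ : Measure X) (lam : X → ℝ → ℝ) (ρ : ℝ) (q : ℝ≥0∞)
    (f : Lp ℝ 1 μ) (c : ℕ → ℕ → ℝ) : Prop :=
  ∃ b : ℕ → Lp ℝ 1 μ, (∀ i, IsAtomicBlock μ lam ρ q (b i) (c i)) ∧ HasSum b f

/-- The norm of `H^{1,q}_{at}(μ)` (equal to `∞` outside the space). -/
def hardyNorm (μ : Measure X) (lam : X → ℝ → ℝ) (ρ : ℝ) (q : ℝ≥0∞) (f : Lp ℝ 1 μ) : ℝ≥0∞ :=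
  ⨅ (c : ℕ → ℕ → ℝ) (_ : IsDecomposition μ lam ρ q f c), ∑' i, ∑' j, ‖c i j‖ₑ

/-- The atomic Hardy space `H^{1,q}_{at}(μ)`. -/
def hardySpace [Nonempty X] (μ : Measure X) (lam : X → ℝ → ℝ) (ρ : ℝ) (q : ℝ≥0∞) :
    Submodule ℝ (Lp ℝ 1 μ) where
  carrier := {f | ∃ c, IsDecomposition μ lam ρ q f c ∧ ∑' i, ∑' j, ‖c i j‖ₑ < ∞}
  zero_mem' := by
    have h0 : ∀ s : Set X, SupportedIn (0 : Lp ℝ 1 μ) s := fun s => by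
      filter_upwards [Lp.coeFn_zero ℝ 1 μ] with y hy _
      simpa using hy
    refine ⟨fun _ _ => 0, ⟨fun _ => 0, fun _ => ?_, hasSum_zero⟩, by simp⟩
    refine ⟨Classical.arbitrary X, 1, one_pos, h0 _, ?_, fun _ => 0,
      fun _ => Classical.arbitrary X, fun _ => 1, fun j => ?_, by simp⟩
    · rw [integral_congr_ae (Lp.coeFn_zero ℝ 1 μ)]; simp
    · refine ⟨one_pos, subset_rfl, h0 _, ?_⟩
      rw [eLpNorm_congr_ae (Lp.coeFn_zero ℝ 1 μ)]; simp
  add_mem' := by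
    rintro f g ⟨c, ⟨b, hb, hbs⟩, hc⟩ ⟨d, ⟨e, he, hes⟩, hd⟩
    let E : ℕ ≃ ℕ ⊕ ℕ := Equiv.natSumNatEquivNat.symm
    refine ⟨fun i => Sum.elim c d (E i), ⟨fun i => Sum.elim b e (E i), fun i => ?_, ?_⟩, ?_⟩
    · rcases h : E i with j | j
      · simpa [h] using hb j
      · simpa [h] using he j
    · have : HasSum (Sum.elim b e) (f + g) :=
        HasSum.sum (f := Sum.elim b e) (by simpa using hbs) (by simpa using hes)
      exact E.hasSum_iff.mpr this
    · have h1 := E.tsum_eq (fun k => ∑' j, ‖(Sum.elim c d k) j‖ₑ)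
      have h2 : ∑' k, ∑' j, ‖(Sum.elim c d k) j‖ₑ
          = (∑' i, ∑' j, ‖c i j‖ₑ) + ∑' i, ∑' j, ‖d i j‖ₑ := by
        rw [Summable.tsum_sum ENNReal.summable ENNReal.summable]
        simp
      rw [h1, h2]
      exact ENNReal.add_lt_top.mpr ⟨hc, hd⟩
  smul_mem' := by
    rintro t f ⟨c, ⟨b, hb, hbs⟩, hc⟩
    refine ⟨fun i j => t * c i j, ⟨fun i => t • b i, fun i => ?_, hbs.const_smul t⟩, ?_⟩
    · obtain ⟨x, r, hr, hsupp, hint, a, z, s, ha, hs⟩ := hb i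
      refine ⟨x, r, hr, ?_, ?_, a, z, s, ha, ?_⟩
      · filter_upwards [hsupp, Lp.coeFn_smul t (b i)] with y hy hy' hyn
        rw [hy', Pi.smul_apply, hy hyn, smul_zero]
      · rw [integral_congr_ae (Lp.coeFn_smul t (b i))]
        simp only [Pi.smul_apply]
        rw [integral_smul, hint, smul_zero]
      · simpa only [smul_smul] using hs.const_smul t
    · simp only [enorm_mul, ENNReal.tsum_mul_left]
      exact ENNReal.mul_lt_top enorm_lt_top hc

/-- The dual norm of a linear functional on `H^{1,q}_{at}(μ)` (equal to `∞` if it is not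
bounded). -/
def dualNorm [Nonempty X] {μ : Measure X} {lam : X → ℝ → ℝ} {ρ : ℝ} {q : ℝ≥0∞}
    (L : hardySpace μ lam ρ q →ₗ[ℝ] ℝ) : ℝ≥0∞ :=
  ⨆ (f : hardySpace μ lam ρ q) (_ : hardyNorm μ lam ρ q (f : Lp ℝ 1 μ) ≤ 1), ‖L f‖ₑ

/-- The dual space of `H^{1,q}_{at}(μ)`: the bounded linear functionals. -/
def hardyDual [Nonempty X] (μ : Measure X) (lam : X → ℝ → ℝ) (ρ : ℝ) (q : ℝ≥0∞) :
    Submodule ℝ (hardySpace μ lam ρ q →ₗ[ℝ] ℝ) where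
  carrier := {L | dualNorm L < ∞}
  zero_mem' := by simp [dualNorm]
  add_mem' := by
    intro L M hL hM
    refine lt_of_le_of_lt ?_ (ENNReal.add_lt_top.mpr ⟨hL, hM⟩)
    refine iSup₂_le fun f hf => ?_
    rw [LinearMap.add_apply]
    exact (enorm_add_le _ _).trans (add_le_add
      (le_iSup₂ (f := fun f _ => ‖L f‖ₑ) f hf) (le_iSup₂ (f := fun f _ => ‖M f‖ₑ) f hf))
  smul_mem' := by
    intro t L hL
    refine lt_of_le_of_lt ?_ (ENNReal.mul_lt_top (enorm_lt_top (x := t)) hL)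
    refine iSup₂_le fun f hf => ?_
    rw [LinearMap.smul_apply, smul_eq_mul, enorm_mul]
    exact mul_le_mul_right (le_iSup₂ (f := fun f _ => ‖L f‖ₑ) f hf) _

/-- The functional `L` is given by integration against `g`: `L f = ∫ f g dμ` for every `f` in
`H^{1,q}_{at}(μ)` for which `f g` is integrable. (This includes every bounded `f` of bounded
support in the space if `g` is locally integrable.) -/
def IsIntegrationAgainst [Nonempty X] {μ : Measure X} {lam : X → ℝ → ℝ} {ρ : ℝ} {q : ℝ≥0∞}
    (g : X → ℝ) (L : hardySpace μ lam ρ q →ₗ[ℝ] ℝ) : Prop :=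
  ∀ f : hardySpace μ lam ρ q, Integrable (fun y => (f : Lp ℝ 1 μ) y * g y) μ →
    L f = ∫ y, (f : Lp ℝ 1 μ) y * g y ∂μ

/-- `H^{1,q}_{at}(μ)^* = RBMO(μ)`: the map `g ↦ L_g`, where `L_g` is the unique bounded functional
given by integration against `g`, is well defined and linear on `RBMO(μ)`, maps onto the dual, has
the constants as its kernel, and `‖L_g‖ ≈ ‖g‖_{RBMO(μ)}`. The parameter `ρ` is that of the Hardy
space and `σ` that of `RBMO(μ)`. -/
def DualIsRBMO [Nonempty X] (μ : Measure X) (lam : X → ℝ → ℝ) (ρ σ : ℝ) (q : ℝ≥0∞) : Prop :=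
  ∃ Φ : rbmo μ lam σ →ₗ[ℝ] hardyDual μ lam ρ q,
    (∀ (g : rbmo μ lam σ) (L : hardyDual μ lam ρ q),
      IsIntegrationAgainst (g : X → ℝ) (L : hardySpace μ lam ρ q →ₗ[ℝ] ℝ) ↔ L = Φ g) ∧
    Function.Surjective Φ ∧
    (∀ g : rbmo μ lam σ, Φ g = 0 ↔ ∃ c : ℝ, ∀ᵐ y ∂μ, (g : X → ℝ) y = c) ∧
    ∃ C : ℝ≥0, ∀ g : rbmo μ lam σ,
      dualNorm (Φ g : hardySpace μ lam ρ q →ₗ[ℝ] ℝ) ≤ C * rbmoNorm μ lam σ (g : X → ℝ) ∧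
      rbmoNorm μ lam σ (g : X → ℝ) ≤ C * dualNorm (Φ g : hardySpace μ lam ρ q →ₗ[ℝ] ℝ)

end NonHom

end

namespace NonHom

open Filter Topology

/-! ### Coverings in geometrically doubling spaces -/

section Covering

variable {X : Type*} [MetricSpace X]

/-! Everything rests on pairing an atomic block b with a function g of RBMO. Since ∫ b = 0, the
number g_B may be subtracted from g. On an atom a_j the difference g - g_B is split into g -
g_{B_j}, handled by Hölder's inequality and the L^{p'} form of the John-Nirenberg inequality, and
g_{B_j} - g_B, which is at most C K_{B_j,B} and is absorbed by the factor K⁻¹ in the normalization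
of the atom. Hence g acts boundedly on H^{1,p} for finite p (`IsDominating.exists_block_pairing`,
`IsDominating.exists_functional`). The product fg need not be integrable for every f, so the
functional is the limit of the pairings with truncations of g.

Since μ need not be doubling, John-Nirenberg (`IsDominating.john_nirenberg`) works with doubling
balls. The growth bound given by `lam` provides them at large scales, geometric doubling of X
provides them at small scales about almost every point, chains of non-doubling balls cost only a
bounded K, and Lebesgue differentiation holds along doubling balls.

Conversely, a bounded functional on H^{1,p} with 1 < p ≤ 2 induces bounded functionals on L² of
bounded sets, and the Riesz theorem gives a locally integrable g
(`IsDominating.exists_representation`). Testing g on sign(g - a) 1_B, corrected by a multiple of 1_Q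
with Q doubling, shows that g lies in RBMO (`IsDominating.exists_oscBound_of_pairingBound`). The
test functions are bounded, so only the size Λ of the functional on H^{1,∞} enters. By the direct
pairing its norm on H^{1,p} is then at most a constant times Λ
(`IsDominating.exists_rbmo_representation`).

Hahn-Banach turns this comparison of dual norms into one of norms: an element of H^{1,p} is
approximated by elements of H^{1,∞} of controlled norm (`exists_approx_of_dual_bound`), and
iterating on the remainder sums it in H^{1,∞} (`IsDominating.exists_hardyNorm_top_le`). With the
elementary inclusions all these Hardy norms are equivalent, and the duality proved for exponent 2
passes to every exponent, `∞` included. -/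

theorem GeometricallyDoubling.exists_cover (hX : GeometricallyDoubling X) :
    ∃ N : ℕ, ∀ (k : ℕ) (x : X) (r : ℝ), 0 < r →
      ∃ s : Finset X, s.card ≤ N ^ k ∧ ball x r ⊆ ⋃ y ∈ s, ball y (r / 2 ^ k) := by
  classical
  obtain ⟨N, hN⟩ := hX
  refine ⟨N, fun k => ?_⟩
  induction k with
  | zero => intro x r _; exact ⟨{x}, by simp, by simp⟩
  | succ k ih =>
    intro x r hr
    obtain ⟨s, hs, hc⟩ := ih x r hr
    choose! t ht1 ht2 using fun y => hN y (r / 2 ^ k) (by positivity)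
    refine ⟨s.biUnion t, ?_, ?_⟩
    · calc (s.biUnion t).card ≤ ∑ y ∈ s, (t y).card := Finset.card_biUnion_le
        _ ≤ ∑ _y ∈ s, N := Finset.sum_le_sum fun y _ => ht1 y
        _ = s.card * N := by simp
        _ ≤ N ^ (k + 1) := by rw [pow_succ]; exact Nat.mul_le_mul_right _ hs
    · intro w hw
      obtain ⟨y, hy, hwy⟩ := Set.mem_iUnion₂.1 (hc hw)
      obtain ⟨z, hz, hwz⟩ := Set.mem_iUnion₂.1 (ht2 y hwy)
      refine Set.mem_iUnion₂.2 ⟨z, Finset.mem_biUnion.2 ⟨y, hy, hz⟩, ?_⟩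
      rwa [pow_succ, ← div_div]

/-- A set inside a ball is covered by a controlled number of balls centred at its points. -/
theorem GeometricallyDoubling.exists_cover_subset (hX : GeometricallyDoubling X) :
    ∃ N : ℕ, 1 ≤ N ∧ ∀ (k : ℕ) (x : X) (r : ℝ) (E : Set X), 0 < r → E ⊆ ball x r →
      ∃ s : Finset X, (s : Set X) ⊆ E ∧ s.card ≤ N ^ k ∧
        E ⊆ ⋃ y ∈ s, ball y (2 * (r / 2 ^ k)) := by
  classical
  obtain ⟨N, hN⟩ := hX.exists_cover
  refine ⟨max N 1, le_max_right _ _, fun k x r E hr hE => ?_⟩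
  obtain ⟨s, hs, hc⟩ := hN k x r hr
  have hδ : 0 < r / 2 ^ k := by positivity
  -- Balls that meet `E` are recentred at a point of `E`; doubling the radius pays for the shift.
  let s' := s.filter fun y => (E ∩ ball y (r / 2 ^ k)).Nonempty
  have hs' : ∀ y ∈ s', (E ∩ ball y (r / 2 ^ k)).Nonempty := fun y hy => (Finset.mem_filter.1 hy).2
  choose! c hcE using hs'
  refine ⟨s'.image c, ?_, ?_, ?_⟩
  · intro z hz
    obtain ⟨y, hy, rfl⟩ := Finset.mem_image.1 (Finset.mem_coe.1 hz)
    exact (hcE y hy).1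
  · exact Finset.card_image_le.trans ((Finset.card_filter_le _ _).trans
      (hs.trans (Nat.pow_le_pow_left (le_max_left _ _) k)))
  · intro w hw
    obtain ⟨y, hy, hwy⟩ := Set.mem_iUnion₂.1 (hc (hE hw))
    have hy' : y ∈ s' := Finset.mem_filter.2 ⟨hy, w, hw, hwy⟩
    refine Set.mem_iUnion₂.2 ⟨c y, Finset.mem_image_of_mem _ hy', ?_⟩
    have h1 := (hcE y hy').2
    rw [mem_ball] at hwy h1 ⊢
    have := dist_triangle_right w (c y) y
    linarith

/-- Needed for the global measurability of locally integrable functions and for the Vitali covering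
argument. -/
theorem GeometricallyDoubling.secondCountable (hX : GeometricallyDoubling X) :
    SecondCountableTopology X := by
  rcases isEmpty_or_nonempty X with h | ⟨⟨x₀⟩⟩
  · infer_instance
  obtain ⟨N, hN⟩ := hX.exists_cover
  refine Metric.secondCountable_of_almost_dense_set fun ε hε => ?_
  have : ∀ n : ℕ, ∃ s : Finset X, ball x₀ (n + 1) ⊆ ⋃ y ∈ s, ball y ε := by
    intro n
    obtain ⟨k, hk⟩ := pow_unbounded_of_one_lt ((n + 1 : ℝ) / ε) (one_lt_two)
    obtain ⟨s, -, hs⟩ := hN k x₀ (n + 1) (by positivity)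
    refine ⟨s, hs.trans (Set.iUnion₂_mono fun y _ => ball_subset_ball ?_)⟩
    rw [div_lt_iff₀ hε] at hk
    rw [div_le_iff₀ (by positivity)]
    linarith
  choose s hs using this
  refine ⟨⋃ n, (s n : Set X), Set.countable_iUnion fun n => (s n).countable_toSet, fun x => ?_⟩
  obtain ⟨n, hn⟩ := exists_nat_gt (dist x x₀)
  obtain ⟨y, hy, hxy⟩ := Set.mem_iUnion₂.1 (hs n (mem_ball.2 (by linarith : dist x x₀ < n + 1)))
  exact ⟨y, Set.mem_iUnion.2 ⟨n, hy⟩, (mem_ball.1 hxy).le⟩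

end Covering

variable {X : Type*} [MetricSpace X] [MeasurableSpace X] {μ : Measure X} {lam : X → ℝ → ℝ}

/-! ### The dominating function and the coefficients `K` -/

namespace IsDominating

theorem lam_mul_le (hlam : IsDominating μ lam) (c : ℝ) (hc : 0 < c) :
    ∃ D : ℝ, 1 ≤ D ∧ ∀ x r, 0 < r → lam x (c * r) ≤ D * lam x r := by
  obtain ⟨C, hC, h⟩ := hlam.doubling
  obtain ⟨n, hn⟩ := pow_unbounded_of_one_lt c one_lt_two
  have key : ∀ (n : ℕ) x r, 0 < r → lam x (2 ^ n * r) ≤ (max C 1) ^ n * lam x r := by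
    intro n
    induction n with
    | zero => intro x r _; simp
    | succ n ih =>
      intro x r hr
      calc lam x (2 ^ (n + 1) * r) = lam x (2 * (2 ^ n * r)) := by congr 1; ring
        _ ≤ C * lam x (2 ^ n * r) := h x _ (by positivity)
        _ ≤ max C 1 * lam x (2 ^ n * r) :=
          mul_le_mul_of_nonneg_right (le_max_left _ _) (hlam.pos x _ (by positivity)).le
        _ ≤ max C 1 * ((max C 1) ^ n * lam x r) :=
          mul_le_mul_of_nonneg_left (ih x r hr) (by positivity)
        _ = _ := by ring
  refine ⟨(max C 1) ^ n, one_le_pow₀ (le_max_right _ _), fun x r hr => ?_⟩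
  exact (hlam.mono x _ _ (by positivity) (by gcongr)).trans (key n x r hr)

theorem measure_ball_lt_top (hlam : IsDominating μ lam) (x : X) (r : ℝ) : μ (ball x r) < ∞ := by
  rcases le_or_gt r 0 with hr | hr
  · simp [ball_eq_empty.2 hr]
  · exact (hlam.measure_le x r hr).trans_lt ENNReal.ofReal_lt_top

theorem measure_closedBall_lt_top (hlam : IsDominating μ lam) (x : X) (r : ℝ) :
    μ (closedBall x r) < ∞ :=
  (measure_mono (closedBall_subset_ball (lt_add_one r))).trans_lt (hlam.measure_ball_lt_top x _)

theorem isLocallyFiniteMeasure (hlam : IsDominating μ lam) : IsLocallyFiniteMeasure μ :=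
  ⟨fun x => ⟨ball x 1, ball_mem_nhds x one_pos, hlam.measure_ball_lt_top x 1⟩⟩

theorem toReal_measure_ball_le (hlam : IsDominating μ lam) (x : X) (r : ℝ) (hr : 0 < r) :
    (μ (ball x r)).toReal ≤ lam x r :=
  ENNReal.toReal_le_of_le_ofReal (hlam.pos x r hr).le (hlam.measure_le x r hr)

end IsDominating

variable [BorelSpace X]

theorem measurableSet_annulus (x : X) (r s : ℝ) :
    MeasurableSet {y | r ≤ dist y x ∧ dist y x ≤ s} := by
  have h : Measurable fun y => dist y x := by fun_prop
  exact (measurableSet_le measurable_const h).inter (measurableSet_le h measurable_const)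

namespace IsDominating

variable (hlam : IsDominating μ lam)
include hlam

theorem integrableOn_annulus (x : X) {r : ℝ} (hr : 0 < r) (s : ℝ) :
    IntegrableOn (fun y => (lam x (dist y x))⁻¹) {y | r ≤ dist y x ∧ dist y x ≤ s} μ := by
  have hfin : μ {y | r ≤ dist y x ∧ dist y x ≤ s} < ∞ :=
    (measure_mono fun y hy => mem_closedBall.2 hy.2).trans_lt (hlam.measure_closedBall_lt_top x s)
  -- `lam x` is monotone only at positive radii. Replacing the distance by its maximum with `r`
  -- gives an antitone, hence measurable, integrand that is unchanged on the annulus.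
  have hanti : Antitone fun t : ℝ => (lam x (max t r))⁻¹ := fun a b hab =>
    inv_anti₀ (hlam.pos x _ (lt_max_of_lt_right hr))
      (hlam.mono x _ _ (lt_max_of_lt_right hr) (max_le_max_right r hab))
  have hm : Measurable fun y : X => (lam x (max (dist y x) r))⁻¹ :=
    hanti.measurable.comp (by fun_prop)
  have h1 : IntegrableOn (fun y => (lam x (max (dist y x) r))⁻¹)
      {y | r ≤ dist y x ∧ dist y x ≤ s} μ := by
    refine Measure.integrableOn_of_bounded (M := (lam x r)⁻¹) hfin.ne hm.aestronglyMeasurable ?_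
    refine ae_of_all _ fun y => ?_
    have hp := hlam.pos x (max (dist y x) r) (lt_max_of_lt_right hr)
    rw [Real.norm_of_nonneg (inv_nonneg.2 hp.le)]
    exact inv_anti₀ (hlam.pos x r hr) (hlam.mono x _ _ hr (le_max_right _ _))
  refine h1.congr_fun (fun y hy => ?_) (measurableSet_annulus x r s)
  simp only
  rw [max_eq_left hy.1]

omit [BorelSpace X] in
theorem inv_nonneg_annulus (x : X) {r : ℝ} (hr : 0 < r) (s : ℝ) :
    ∀ y ∈ {y | r ≤ dist y x ∧ dist y x ≤ s}, 0 ≤ (lam x (dist y x))⁻¹ := fun _ hy =>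
  inv_nonneg.2 (hlam.pos x _ (hr.trans_le hy.1)).le

theorem one_le_kCoeff (x : X) {r : ℝ} (hr : 0 < r) (s : ℝ) : 1 ≤ kCoeff μ lam x r s := by
  unfold kCoeff
  have := setIntegral_nonneg (μ := μ) (measurableSet_annulus x r s)
    (hlam.inv_nonneg_annulus x hr s)
  linarith

theorem setIntegral_annulus_mono (x : X) {r r' s s' : ℝ} (hr' : 0 < r')
    (h : {y : X | r ≤ dist y x ∧ dist y x ≤ s} ⊆ {y | r' ≤ dist y x ∧ dist y x ≤ s'}) :
    kCoeff μ lam x r s ≤ kCoeff μ lam x r' s' := by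
  unfold kCoeff
  have := setIntegral_mono_set (hlam.integrableOn_annulus x hr' s')
    ((ae_restrict_iff' (measurableSet_annulus x r' s')).2
      (ae_of_all _ (hlam.inv_nonneg_annulus x hr' s'))) (LE.le.eventuallyLE h)
  linarith

theorem kCoeff_mono (x : X) {r r' s s' : ℝ} (hr' : 0 < r') (hr : r' ≤ r) (hs : s ≤ s') :
    kCoeff μ lam x r s ≤ kCoeff μ lam x r' s' :=
  hlam.setIntegral_annulus_mono x hr' fun _ hy => ⟨hr.trans hy.1, hy.2.trans hs⟩

/-- Each `K` carries its own summand 1, so cutting an annulus in two leaves one to spare. Chains of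
balls need this sharper form: the plain triangle inequality would lose 1 at every link. -/
theorem kCoeff_add_one_le_add (x : X) {r s : ℝ} (hr : 0 < r) (hs : 0 < s) (t : ℝ) :
    kCoeff μ lam x r t + 1 ≤ kCoeff μ lam x r s + kCoeff μ lam x s t := by
  rcases le_total r s with h | h
  · have hsub : {y : X | r ≤ dist y x ∧ dist y x ≤ t} ⊆
        {y | r ≤ dist y x ∧ dist y x ≤ s} ∪ {y | s ≤ dist y x ∧ dist y x ≤ t} := by
      intro y hy
      rcases le_total (dist y x) s with h' | h'
      · exact Or.inl ⟨hy.1, h'⟩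
      · exact Or.inr ⟨h', hy.2⟩
    have hi1 := hlam.integrableOn_annulus x hr s
    have hi2 := hlam.integrableOn_annulus x hs t
    have hnn := fun y (hy : y ∈ {y : X | r ≤ dist y x ∧ dist y x ≤ s} ∪
        {y | s ≤ dist y x ∧ dist y x ≤ t}) =>
      hy.elim (hlam.inv_nonneg_annulus x hr s y) (hlam.inv_nonneg_annulus x hs t y)
    have hmeas := (measurableSet_annulus x r s).union (measurableSet_annulus x s t)
    have h1 := setIntegral_mono_set (hi1.union hi2)
      ((ae_restrict_iff' hmeas).2 (ae_of_all μ hnn)) (LE.le.eventuallyLE hsub)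
    rw [← Set.union_sdiff_self, setIntegral_union Set.disjoint_sdiff_right
      ((measurableSet_annulus x s t).diff (measurableSet_annulus x r s)) hi1
      (hi2.mono_set Set.sdiff_subset)] at h1
    have h2 := setIntegral_mono_set hi2 ((ae_restrict_iff' (measurableSet_annulus x s t)).2
      (ae_of_all μ (hlam.inv_nonneg_annulus x hs t)))
      (LE.le.eventuallyLE (Set.sdiff_subset (t := {y : X | r ≤ dist y x ∧ dist y x ≤ s})))
    unfold kCoeff
    linarith
  · have h1 := hlam.kCoeff_mono x hs h le_rfl (s := t)
    have h2 := hlam.one_le_kCoeff x hr s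
    linarith

theorem kCoeff_le_add (x : X) {r s : ℝ} (hr : 0 < r) (hs : 0 < s) (t : ℝ) :
    kCoeff μ lam x r t ≤ kCoeff μ lam x r s + kCoeff μ lam x s t := by
  linarith [hlam.kCoeff_add_one_le_add x hr hs t]

/-- On the annulus the integrand is at most its value at radius `r`. The strict inequality `s < t`
places the closed annulus in an open ball. -/
theorem kCoeff_le_measure_div (x : X) {r s t : ℝ} (hr : 0 < r) (hst : s < t) :
    kCoeff μ lam x r s ≤ 1 + (μ (ball x t)).toReal / lam x r := by
  have h1 := setIntegral_mono_on (hlam.integrableOn_annulus x hr s)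
    (integrableOn_const (C := (lam x r)⁻¹)
      ((measure_mono fun y hy => mem_closedBall.2 hy.2).trans_lt
        (hlam.measure_closedBall_lt_top x s)).ne)
    (measurableSet_annulus x r s)
    (fun y hy => inv_anti₀ (hlam.pos x r hr) (hlam.mono x _ _ hr hy.1))
  rw [setIntegral_const, smul_eq_mul] at h1
  have h2 : μ.real {y | r ≤ dist y x ∧ dist y x ≤ s} ≤ (μ (ball x t)).toReal :=
    ENNReal.toReal_mono (hlam.measure_ball_lt_top x t).ne
      (measure_mono fun y hy => mem_ball.2 (hy.2.trans_lt hst))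
  have h3 := mul_le_mul_of_nonneg_right h2 (inv_nonneg.2 (hlam.pos x r hr).le)
  unfold kCoeff
  rw [div_eq_mul_inv]
  linarith

theorem exists_kCoeff_mul_le (c : ℝ) :
    ∃ C : ℝ, 1 ≤ C ∧ ∀ x r, 0 < r → kCoeff μ lam x r (c * r) ≤ C := by
  obtain ⟨D, hD, h⟩ := hlam.lam_mul_le (max c 0 + 1) (by positivity)
  refine ⟨1 + D, by linarith, fun x r hr => ?_⟩
  have hlt : c * r < (max c 0 + 1) * r :=
    mul_lt_mul_of_pos_right ((le_max_left c 0).trans_lt (lt_add_one _)) hr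
  refine (hlam.kCoeff_le_measure_div x hr hlt).trans ?_
  gcongr
  rw [div_le_iff₀ (hlam.pos x r hr)]
  exact (hlam.toReal_measure_ball_le x _ (by positivity)).trans (h x r hr)

/-- Changing the centre of the inner ball. -/
theorem exists_kCoeff_le_of_dist_le :
    ∃ C : ℝ, 1 ≤ C ∧ ∀ x y r s, 0 < r → dist x y ≤ r →
      kCoeff μ lam x r s ≤ C * kCoeff μ lam y r s := by
  obtain ⟨D₁, hD₁, h₁⟩ := hlam.exists_kCoeff_mul_le 2
  obtain ⟨D₂, hD₂, h₂⟩ := hlam.lam_mul_le 2 two_pos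
  obtain ⟨D₃, hD₃, h₃⟩ := hlam.comparable
  refine ⟨D₁ + (1 + D₃ * D₂) * (1 + D₁), by nlinarith [mul_pos hD₃ (one_pos.trans_le hD₂)],
    fun x y r s hr hxy => ?_⟩
  have hK := hlam.one_le_kCoeff y hr s
  rcases lt_or_ge s r with hs | hs
  · have : kCoeff μ lam x r s ≤ kCoeff μ lam x r (2 * r) :=
      hlam.kCoeff_mono x hr le_rfl (by linarith)
    have := h₁ x r hr
    have : 0 ≤ (1 + D₃ * D₂) * (1 + D₁) := by positivity
    nlinarith
  have hs0 : 0 < s := hr.trans_le hs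
  -- Only the part of the annulus at distance at least `2 * r` from `x` is compared with an annulus
  -- about `y`; the part nearer to `x` costs the constant `D₁`.
  have hsub : {w : X | 2 * r ≤ dist w x ∧ dist w x ≤ s} ⊆ {w | r ≤ dist w y ∧ dist w y ≤ 2 * s} := by
    rintro w ⟨hw1, hw2⟩
    have t1 := dist_triangle_right w x y
    have t2 := dist_triangle w x y
    constructor
    · linarith
    · linarith
  have hi := hlam.integrableOn_annulus y hr (2 * s)
  have hpt : ∀ w ∈ {w : X | 2 * r ≤ dist w x ∧ dist w x ≤ s},
      (lam x (dist w x))⁻¹ ≤ D₃ * D₂ * (lam y (dist w y))⁻¹ := by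
    intro w hw
    have hw' := hsub hw
    have hdx : 0 < dist w x := by linarith [hw.1]
    have hdy : 0 < dist w y := by linarith [hw'.1]
    have e1 : lam y (dist w y) ≤ lam y (2 * dist w x) :=
      hlam.mono y _ _ hdy (by linarith [dist_triangle w x y, hw.1])
    have e2 : lam y (2 * dist w x) ≤ D₃ * lam x (2 * dist w x) :=
      h₃ y x _ (by positivity) (by rw [dist_comm]; linarith [hw.1])
    have e3 := mul_le_mul_of_nonneg_left (h₂ x _ hdx) hD₃.le
    rw [← div_eq_mul_inv, le_div_iff₀ (hlam.pos y _ hdy), inv_mul_le_iff₀ (hlam.pos x _ hdx)]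
    linarith
  have h4 : kCoeff μ lam x (2 * r) s ≤ 1 + D₃ * D₂ * (kCoeff μ lam y r (2 * s) - 1) := by
    have e1 := setIntegral_mono_on (hlam.integrableOn_annulus x (by linarith : 0 < 2 * r) s)
      ((hi.mono_set hsub).const_mul (D₃ * D₂)) (measurableSet_annulus x _ _) hpt
    have e2 := setIntegral_mono_set hi ((ae_restrict_iff' (measurableSet_annulus y _ _)).2
      (ae_of_all _ (hlam.inv_nonneg_annulus y hr (2 * s)))) (LE.le.eventuallyLE hsub)
    rw [integral_const_mul] at e1
    have e3 := mul_le_mul_of_nonneg_left e2 (by positivity : 0 ≤ D₃ * D₂)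
    unfold kCoeff
    linarith
  have h5 := hlam.kCoeff_le_add x hr (by linarith : 0 < 2 * r) s
  have h6 := hlam.kCoeff_le_add y hr hs0 (2 * s)
  have h7 := h₁ x r hr
  have h8 := h₁ y s hs0
  have hP : 0 ≤ D₃ * D₂ := by positivity
  have h9 : kCoeff μ lam y r (2 * s) ≤ (1 + D₁) * kCoeff μ lam y r s := by nlinarith
  have h10 : D₃ * D₂ * (kCoeff μ lam y r (2 * s) - 1) ≤
      D₃ * D₂ * ((1 + D₁) * kCoeff μ lam y r s) :=
    mul_le_mul_of_nonneg_left (by linarith) hP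
  nlinarith

/-- If `B(x, r) ⊆ B(y, s)` then `r` exceeds `s` essentially only by empty annuli. -/
theorem exists_kCoeff_le_of_subset :
    ∃ C : ℝ, 1 ≤ C ∧ ∀ x y r s, 0 < r → 0 < s → ball x r ⊆ ball y s →
      kCoeff μ lam x s r ≤ C := by
  obtain ⟨D, hD, h⟩ := hlam.exists_kCoeff_mul_le 2
  refine ⟨D + D, by linarith, fun x y r s hr hs hsub => ?_⟩
  have h1 := hlam.kCoeff_le_add x hs (by linarith : 0 < 2 * s) r
  have h2 : kCoeff μ lam x (2 * s) r ≤ kCoeff μ lam x r (2 * r) := by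
    -- A point closer than `r` to `x` lies in `B(y, s)` together with `x`, so its distance to `x` is
    -- less than `2 * s`. Hence the annulus from `2 * s` to `r` is contained in the sphere of radius
    -- `r`.
    refine hlam.setIntegral_annulus_mono x hr fun w hw => ⟨?_, hw.2.trans (by linarith)⟩
    by_contra! hlt
    have e1 := mem_ball.1 (hsub (mem_ball.2 hlt))
    have e2 := mem_ball.1 (hsub (mem_ball_self hr))
    have := dist_triangle_right w x y
    linarith [hw.1]
  linarith [h x s hs, h x r hr]

end IsDominating

end NonHom

namespace NonHom

open Filter Topology

variable {X : Type*} [MetricSpace X] [MeasurableSpace X] {μ : Measure X} {lam : X → ℝ → ℝ}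

/-! ### Doubling balls -/

/-- The ball `B(x, r)` has positive measure and is `(α, β)`-doubling. -/
def DoublingBall (μ : Measure X) (α : ℝ) (β : ℝ≥0) (x : X) (r : ℝ) : Prop :=
  0 < r ∧ 0 < μ (ball x r) ∧ μ (ball x (α * r)) ≤ β * μ (ball x r)

/-- If the ball fails only because its measure is zero, the inequality is trivial, so requiring
positive measure of doubling balls costs nothing. -/
theorem mul_measure_le_of_not_doublingBall {α : ℝ} {β : ℝ≥0} {x : X} {r : ℝ} (hr : 0 < r)
    (h : ¬ DoublingBall μ α β x r) : β * μ (ball x r) ≤ μ (ball x (α * r)) := by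
  by_contra! hlt
  refine h ⟨hr, ?_, hlt.le⟩
  by_contra h0
  simp [nonpos_iff_eq_zero.1 (not_lt.1 h0)] at hlt

theorem pow_mul_measure_le {α : ℝ} {β : ℝ≥0} {x : X} {r : ℝ} (n : ℕ)
    (h : ∀ i < n, β * μ (ball x (α ^ i * r)) ≤ μ (ball x (α ^ (i + 1) * r))) :
    (β : ℝ≥0∞) ^ n * μ (ball x r) ≤ μ (ball x (α ^ n * r)) := by
  induction n with
  | zero => simp
  | succ n ih =>
    calc (β : ℝ≥0∞) ^ (n + 1) * μ (ball x r) = β * (β ^ n * μ (ball x r)) := by ring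
      _ ≤ β * μ (ball x (α ^ n * r)) := by
        gcongr; exact ih fun i hi => h i (hi.trans (Nat.lt_succ_self n))
      _ ≤ _ := h n (Nat.lt_succ_self n)

omit [MetricSpace X] [MeasurableSpace X] in
theorem pow_lam_le {α D : ℝ} (hα : 0 < α) (hD : 0 ≤ D)
    (h : ∀ x r, 0 < r → lam x (α * r) ≤ D * lam x r) (n : ℕ) (x : X) (r : ℝ) (hr : 0 < r) :
    lam x (α ^ n * r) ≤ D ^ n * lam x r := by
  induction n with
  | zero => simp
  | succ n ih =>
    calc lam x (α ^ (n + 1) * r) = lam x (α * (α ^ n * r)) := by congr 1; ring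
      _ ≤ D * lam x (α ^ n * r) := h x _ (by positivity)
      _ ≤ D * (D ^ n * lam x r) := by gcongr
      _ = _ := by ring

variable [BorelSpace X]

/-- Passing through a chain of non-doubling balls costs only a bounded `K`. -/
theorem IsDominating.kCoeff_le_of_chain (hlam : IsDominating μ lam) {α D : ℝ} (hα : 1 < α)
    (hD : 1 ≤ D) (h : ∀ x r, 0 < r → lam x (α * r) ≤ D * lam x r) {β : ℝ≥0} (hβ : 2 * D ≤ β)
    (n : ℕ) (x : X) (r : ℝ) (hr : 0 < r)
    (hch : ∀ i < n, β * μ (ball x (α ^ i * r)) ≤ μ (ball x (α ^ (i + 1) * r))) :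
    kCoeff μ lam x r (α ^ n * r) ≤ 1 + 4 * D ^ 2 * (2 - (1 / 2) ^ n) := by
  have hα0 : 0 < α := one_pos.trans hα
  have hβ0 : 0 < (β : ℝ) := by linarith
  induction n generalizing r with
  | zero =>
    have h1 := hlam.kCoeff_le_measure_div x hr (by nlinarith : α ^ 0 * r < α ^ 1 * r)
    have h2 : (μ (ball x (α ^ 1 * r))).toReal / lam x r ≤ D := by
      rw [div_le_iff₀ (hlam.pos x r hr), pow_one]
      exact (hlam.toReal_measure_ball_le x _ (by positivity)).trans (h x r hr)
    rw [pow_zero (1 / 2 : ℝ)]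
    nlinarith
  | succ n ih =>
    have hα' : 0 < α * r := by positivity
    have h1 := hlam.kCoeff_add_one_le_add x hr hα' (α ^ (n + 1) * r)
    have h2 := ih (α * r) hα' fun i hi => by
      have := hch (i + 1) (by omega)
      rwa [show α ^ (i + 1) * r = α ^ i * (α * r) by ring,
        show α ^ (i + 1 + 1) * r = α ^ (i + 1) * (α * r) by ring] at this
    rw [show α ^ n * (α * r) = α ^ (n + 1) * r by ring] at h2
    have h3 := hlam.kCoeff_le_measure_div x hr (by nlinarith : α * r < α ^ 2 * r)
    -- From radius `α ^ 2 * r` on, each link multiplies the measure by at least `2 * D` and `lam` by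
    -- at most `D`. So the first annulus contributes `D ^ 2` times 2 to the power minus the number
    -- of links used, and the sum over all annuli is geometric. The factor 4 makes up for the two
    -- links not used.
    have h4 : (μ (ball x (α ^ 2 * r))).toReal / lam x r ≤ 4 * D ^ 2 * (1 / 2) ^ (n + 1) := by
      rw [div_le_iff₀ (hlam.pos x r hr)]
      rcases n with _ | n
      · have e1 := hlam.toReal_measure_ball_le x (α ^ 2 * r) (by positivity)
        have e2 := pow_lam_le hα0 (by linarith) h 2 x r hr
        have := hlam.pos x r hr
        norm_num
        nlinarith [mul_pos (pow_pos (one_pos.trans_le hD) 2) this]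
      · have e1 := pow_mul_measure_le (μ := μ) (α := α) (β := β) (x := x) (r := α ^ 2 * r) n
          fun i hi => by
            have := hch (i + 2) (by omega)
            rwa [show α ^ (i + 2) * r = α ^ i * (α ^ 2 * r) by ring,
              show α ^ (i + 2 + 1) * r = α ^ (i + 1) * (α ^ 2 * r) by ring] at this
        rw [show α ^ n * (α ^ 2 * r) = α ^ (n + 2) * r by ring] at e1
        have e2 := ENNReal.toReal_mono (hlam.measure_ball_lt_top x _).ne e1
        rw [ENNReal.toReal_mul, ENNReal.toReal_pow, ENNReal.coe_toReal] at e2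
        have e3 := hlam.toReal_measure_ball_le x (α ^ (n + 2) * r) (by positivity)
        have e4 := pow_lam_le hα0 (by linarith) h (n + 2) x r hr
        have e5 : (2 * D) ^ n * (μ (ball x (α ^ 2 * r))).toReal ≤ D ^ (n + 2) * lam x r :=
          ((mul_le_mul_of_nonneg_right (pow_le_pow_left₀ (by linarith) hβ n)
            ENNReal.toReal_nonneg).trans e2).trans (e3.trans e4)
        have hDn : 0 < D ^ n := by positivity
        rw [mul_pow, pow_add, mul_comm (2 ^ n), mul_assoc, mul_assoc] at e5
        have e6 := le_of_mul_le_mul_left e5 hDn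
        have e7 : (μ (ball x (α ^ 2 * r))).toReal ≤ (1 / 2) ^ n * (D ^ 2 * lam x r) := by
          rw [one_div, inv_pow, ← div_eq_inv_mul, le_div_iff₀ (by positivity)]
          linarith
        calc _ ≤ _ := e7
          _ = _ := by ring
    have h5 : (1 / 2 : ℝ) ^ n = 2 * (1 / 2) ^ (n + 1) := by ring
    rw [h5] at h2
    nlinarith

/-- If no ball of radius `α ^ k * r` were doubling, the measures would eventually grow by `2 * D`
per step, against at most `D` for `lam`. Stopping at the least good `k` leaves a chain of
non-doubling balls, whose `K` is bounded. -/
theorem IsDominating.exists_doublingBall (hlam : IsDominating μ lam) {α D : ℝ} (hα : 1 < α)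
    (hD : 1 ≤ D) (h : ∀ x r, 0 < r → lam x (α * r) ≤ D * lam x r) {β : ℝ≥0} (hβ : 2 * D ≤ β)
    (hμ : μ ≠ 0) (x : X) (r : ℝ) (hr : 0 < r) :
    ∃ t, r ≤ t ∧ DoublingBall μ α β x t ∧ kCoeff μ lam x r t ≤ 1 + 4 * D ^ 2 * 2 := by
  classical
  have hα0 : 0 < α := one_pos.trans hα
  have hex : ∃ k : ℕ, DoublingBall μ α β x (α ^ k * r) := by
    by_contra! hno
    have hch : ∀ i : ℕ, β * μ (ball x (α ^ i * r)) ≤ μ (ball x (α ^ (i + 1) * r)) := fun i => by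
      rw [pow_succ', mul_assoc α]
      exact mul_measure_le_of_not_doublingBall (by positivity) (hno i)
    obtain ⟨i, hi⟩ : ∃ i : ℕ, 0 < μ (ball x (α ^ i * r)) := by
      by_contra! h0
      refine hμ (Measure.measure_univ_eq_zero.1 (measure_mono_null (fun y _ => ?_)
        (measure_iUnion_null fun i => nonpos_iff_eq_zero.1 (h0 i))))
      obtain ⟨i, hi⟩ := pow_unbounded_of_one_lt (dist y x / r) hα
      exact Set.mem_iUnion.2 ⟨i, mem_ball.2 ((div_lt_iff₀ hr).1 hi)⟩
    set r' := α ^ i * r with hr'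
    have hr'0 : 0 < r' := by positivity
    set M := (μ (ball x r')).toReal with hM
    have hM0 : 0 < M := ENNReal.toReal_pos hi.ne' (hlam.measure_ball_lt_top x r').ne
    obtain ⟨n, hn⟩ := pow_unbounded_of_one_lt (lam x r' / M) (one_lt_two)
    have e1 := pow_mul_measure_le (μ := μ) (α := α) (β := β) (x := x) (r := r') n
      fun j _ => by
        have := hch (j + i)
        rwa [show α ^ (j + i) * r = α ^ j * r' by rw [hr']; ring,
          show α ^ (j + i + 1) * r = α ^ (j + 1) * r' by rw [hr']; ring] at this
    have e2 := ENNReal.toReal_mono (hlam.measure_ball_lt_top x _).ne e1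
    rw [ENNReal.toReal_mul, ENNReal.toReal_pow, ENNReal.coe_toReal] at e2
    have e3 := hlam.toReal_measure_ball_le x (α ^ n * r') (by positivity)
    have e4 := pow_lam_le hα0 (by linarith) h n x r' hr'0
    have e5 : (2 * D) ^ n * M ≤ D ^ n * lam x r' :=
      ((mul_le_mul_of_nonneg_right (pow_le_pow_left₀ (by linarith) hβ n) hM0.le).trans
        e2).trans (e3.trans e4)
    have hDn : 0 < D ^ n := by positivity
    rw [mul_pow, mul_comm (2 ^ n), mul_assoc] at e5
    have e6 := le_of_mul_le_mul_left e5 hDn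
    rw [div_lt_iff₀ hM0] at hn
    linarith
  refine ⟨α ^ Nat.find hex * r, ?_, Nat.find_spec hex, ?_⟩
  · exact le_mul_of_one_le_left hr.le (one_le_pow₀ hα.le)
  · refine (hlam.kCoeff_le_of_chain hα hD h hβ (Nat.find hex) x r hr fun i hi => ?_).trans ?_
    · rw [pow_succ', mul_assoc α]
      exact mul_measure_le_of_not_doublingBall (by positivity) (Nat.find_min hex hi)
    · have : (0 : ℝ) ≤ (1 / 2) ^ Nat.find hex := by positivity
      gcongr
      linarith

omit [BorelSpace X] in
/-- Almost every point is the centre of arbitrarily small doubling balls. -/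
theorem IsDominating.ae_frequently_doublingBall (hlam : IsDominating μ lam) {N : ℕ} (hN1 : 1 ≤ N)
    (hN : ∀ (k : ℕ) (x : X) (r : ℝ) (E : Set X), 0 < r → E ⊆ ball x r →
      ∃ s : Finset X, (s : Set X) ⊆ E ∧ s.card ≤ N ^ k ∧ E ⊆ ⋃ y ∈ s, ball y (2 * (r / 2 ^ k)))
    {α : ℝ} (hα : 1 < α) {a : ℕ} (ha : α ≤ 2 ^ a) {β : ℝ≥0} (hβ : 2 * (N : ℝ≥0) ^ a ≤ β)
    (R : ℝ) (hR : 0 < R) :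
    ∀ᵐ x ∂μ, ∃ᶠ k : ℕ in atTop, DoublingBall μ α β x (R / α ^ k) := by
  have hα0 : 0 < α := one_pos.trans hα
  rcases isEmpty_or_nonempty X with hE | ⟨⟨x₀⟩⟩
  · exact ae_of_all _ fun x => (hE.false x).elim
  -- The exceptional set is the union of these sets of points without doubling balls from scale `k₀`
  -- on, cut off to bounded sets.
  let E : ℕ → ℕ → Set X := fun k₀ n =>
    {x | ∀ k ≥ k₀, ¬ DoublingBall μ α β x (R / α ^ k)} ∩ ball x₀ (n + 1)
  have hE0 : ∀ k₀ n, μ (E k₀ n) = 0 := by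
    intro k₀ n
    set M := μ (ball x₀ (n + 1 + R)) with hM
    have hMt : M < ∞ := hlam.measure_ball_lt_top _ _
    -- `m₀` halvings bring the covering radius from `n + 1` down to the scale of `R / α ^ k₀`; each
    -- further factor `α` takes at most `a` halvings.
    obtain ⟨m₀, hm₀⟩ := pow_unbounded_of_one_lt (2 * (n + 1) * α ^ k₀ / R) one_lt_two
    have hsmall : ∀ x ∈ E k₀ n, ∀ j : ℕ, (β : ℝ≥0∞) ^ j * μ (ball x (R / α ^ (k₀ + j))) ≤ M := by
      intro x hx j
      have h1 := pow_mul_measure_le (μ := μ) (α := α) (β := β) (x := x)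
        (r := R / α ^ (k₀ + j)) j fun i hi => by
          rw [pow_succ', mul_assoc α]
          refine mul_measure_le_of_not_doublingBall (by positivity) ?_
          have : α ^ i * (R / α ^ (k₀ + j)) = R / α ^ (k₀ + (j - i)) := by
            rw [show k₀ + j = k₀ + (j - i) + i by omega, pow_add α _ i]
            field_simp
          rw [this]
          exact hx.1 _ (by omega)
      refine h1.trans (measure_mono (ball_subset_ball' ?_))
      have h2 : α ^ j * (R / α ^ (k₀ + j)) ≤ R := by
        rw [pow_add, mul_div_assoc', div_le_iff₀ (by positivity)]
        have : 1 ≤ α ^ k₀ := one_le_pow₀ hα.le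
        have h0 : 0 < α ^ j * R := by positivity
        nlinarith
      have h3 := mem_ball.1 hx.2
      linarith
    -- About the points of the set, balls of scale `k₀ + j` have measure at most `β ^ (-j) * M`, and
    -- `N ^ (m₀ + a * j)` of them suffice for a cover. Since `β ≥ 2 * N ^ a`, a factor `2 ^ j` is
    -- gained, which forces measure zero.
    have hbound : ∀ j : ℕ, (2 : ℝ≥0∞) ^ j * μ (E k₀ n) ≤ (N : ℝ≥0∞) ^ m₀ * M := by
      intro j
      obtain ⟨s, hsE, hs, hc⟩ := hN (m₀ + a * j) x₀ (n + 1) (E k₀ n) (by positivity)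
        Set.inter_subset_right
      have hrad : 2 * ((n + 1 : ℝ) / 2 ^ (m₀ + a * j)) ≤ R / α ^ (k₀ + j) := by
        rw [div_lt_iff₀ hR] at hm₀
        have h1 : α ^ j ≤ 2 ^ (a * j) := by
          rw [pow_mul]; exact pow_le_pow_left₀ hα0.le ha j
        rw [← mul_div_assoc, div_le_div_iff₀ (by positivity) (by positivity), pow_add, pow_add]
        calc 2 * (n + 1 : ℝ) * (α ^ k₀ * α ^ j) = (2 * (n + 1) * α ^ k₀) * α ^ j := by ring
          _ ≤ (2 ^ m₀ * R) * 2 ^ (a * j) := by gcongr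
          _ = _ := by ring
      have h1 : μ (E k₀ n) ≤ ∑ y ∈ s, μ (ball y (R / α ^ (k₀ + j))) :=
        (measure_mono (hc.trans (Set.iUnion₂_mono fun y _ => ball_subset_ball hrad))).trans
          (measure_biUnion_finset_le s _)
      have h2 : (β : ℝ≥0∞) ^ j * μ (E k₀ n) ≤ (N : ℝ≥0∞) ^ (m₀ + a * j) * M := by
        calc (β : ℝ≥0∞) ^ j * μ (E k₀ n)
            ≤ β ^ j * ∑ y ∈ s, μ (ball y (R / α ^ (k₀ + j))) := by gcongr
          _ = ∑ y ∈ s, β ^ j * μ (ball y (R / α ^ (k₀ + j))) := Finset.mul_sum _ _ _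
          _ ≤ ∑ _y ∈ s, M := Finset.sum_le_sum fun y hy => hsmall y (hsE hy) j
          _ = s.card * M := by simp
          _ ≤ _ := by gcongr; exact_mod_cast hs
      have h3 : (2 * (N : ℝ≥0∞) ^ a) ^ j ≤ (β : ℝ≥0∞) ^ j := by
        gcongr; exact_mod_cast hβ
      have hN0 : ((N : ℝ≥0∞) ^ (a * j)) ≠ 0 := pow_ne_zero _ (by exact_mod_cast (by omega))
      have hNt : ((N : ℝ≥0∞) ^ (a * j)) ≠ ∞ := ENNReal.pow_ne_top (ENNReal.natCast_ne_top N)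
      rw [← ENNReal.mul_le_mul_iff_right hN0 hNt]
      calc (N : ℝ≥0∞) ^ (a * j) * (2 ^ j * μ (E k₀ n))
          = (2 * (N : ℝ≥0∞) ^ a) ^ j * μ (E k₀ n) := by rw [mul_pow, ← pow_mul]; ring
        _ ≤ β ^ j * μ (E k₀ n) := by gcongr
        _ ≤ _ := h2
        _ = _ := by rw [pow_add]; ring
    by_contra hne
    have hfin : (N : ℝ≥0∞) ^ m₀ * M < ∞ :=
      ENNReal.mul_lt_top (ENNReal.pow_lt_top (ENNReal.natCast_lt_top N)) hMt
    have hlim : Tendsto (fun j : ℕ => (2 : ℝ≥0∞) ^ j * μ (E k₀ n)) atTop (𝓝 ∞) := by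
      have := ENNReal.Tendsto.mul_const (b := μ (E k₀ n))
        (ENNReal.tendsto_pow_atTop_nhds_top_iff.2 (ENNReal.one_lt_two)) (Or.inl ENNReal.top_ne_zero)
      rwa [ENNReal.top_mul hne] at this
    exact (lt_irrefl _ (hfin.trans_le (le_of_tendsto' hlim hbound)))
  rw [ae_iff]
  refine measure_mono_null (fun x hx => ?_)
    (measure_iUnion_null fun k₀ => measure_iUnion_null fun n => hE0 k₀ n)
  simp only [Set.mem_ofPred_eq, not_frequently, eventually_atTop] at hx
  obtain ⟨k₀, hk₀⟩ := hx
  obtain ⟨n, hn⟩ := exists_nat_gt (dist x x₀)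
  exact Set.mem_iUnion.2 ⟨k₀, Set.mem_iUnion.2 ⟨n, hk₀, mem_ball.2 (by linarith)⟩⟩

/-- For every `α > 1` there is `β` for which doubling balls abound at small and at large scales. -/
theorem IsDominating.exists_doubling_constants (hX : GeometricallyDoubling X)
    (hlam : IsDominating μ lam) (α : ℝ) (hα : 1 < α) :
    ∃ β : ℝ≥0, 1 ≤ β ∧ ∃ C : ℝ, 1 ≤ C ∧
      (∀ (n : ℕ) x r, 0 < r → (∀ i < n, ¬ DoublingBall μ α β x (α ^ i * r)) →
        kCoeff μ lam x r (α ^ n * r) ≤ C) ∧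
      (μ ≠ 0 → ∀ x r, 0 < r → ∃ t, r ≤ t ∧ DoublingBall μ α β x t ∧ kCoeff μ lam x r t ≤ C) ∧
      ∀ R, 0 < R → ∀ᵐ x ∂μ, ∃ᶠ k : ℕ in atTop, DoublingBall μ α β x (R / α ^ k) := by
  have hα0 : 0 < α := one_pos.trans hα
  obtain ⟨N, hN1, hN⟩ := hX.exists_cover_subset
  obtain ⟨D, hD, h⟩ := hlam.lam_mul_le α hα0
  obtain ⟨a, ha⟩ := pow_unbounded_of_one_lt α one_lt_two
  -- `β` is the sum of what the two scales require: `2 * D` for large balls and `2 * N ^ a` for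
  -- small ones.
  have hDβ : 2 * D ≤ (Real.toNNReal (2 * D) + 2 * (N : ℝ≥0) ^ a : ℝ≥0) := by
    rw [NNReal.coe_add, Real.coe_toNNReal _ (by linarith)]
    exact le_add_of_nonneg_right (NNReal.coe_nonneg _)
  refine ⟨Real.toNNReal (2 * D) + 2 * (N : ℝ≥0) ^ a, ?_, 1 + 4 * D ^ 2 * 2, by nlinarith,
    fun n x r hr hn => ?_, fun hμ x r hr => hlam.exists_doublingBall hα hD h hDβ hμ x r hr,
    fun R hR => hlam.ae_frequently_doublingBall hN1 hN hα ha.le (le_add_of_nonneg_left zero_le)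
      R hR⟩
  · rw [← NNReal.coe_le_coe]; exact le_trans (by norm_num; linarith) hDβ
  · refine (hlam.kCoeff_le_of_chain hα hD h hDβ n x r hr fun i hi => ?_).trans ?_
    · rw [pow_succ', mul_assoc α]
      exact mul_measure_le_of_not_doublingBall (by positivity) (hn i hi)
    · have : (0 : ℝ) ≤ (1 / 2) ^ n := by positivity
      gcongr
      linarith

/-! ### Differentiation along doubling balls -/

/-- Lebesgue differentiation for a Vitali family adapted to doubling balls. Since `α ≥ 4`, the
closed ball of triple radius lies in the ball enlarged by `α`, which is the hypothesis of Vitali's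
covering theorem. The averages tend to 0, so some doubling ball has average at most 1; `β` accounts
for passing from the closed ball to the open one. -/
theorem ae_tendsto_of_frequently_doubling [SecondCountableTopology X] [IsLocallyFiniteMeasure μ]
    {g : X → ℝ} (hg : LocallyIntegrable g μ) {α : ℝ} (hα : 4 ≤ α) {β : ℝ≥0} (R : ℝ)
    (hfr : ∀ᵐ x ∂μ, ∃ᶠ k : ℕ in atTop, DoublingBall μ α β x (R / α ^ k)) :
    ∀ᵐ x ∂μ, ∃ k : ℕ, DoublingBall μ α β x (R / α ^ k) ∧
      ∫⁻ y in ball x (R / α ^ k), ‖g y - g x‖ₑ ∂μ ≤ β * μ (ball x (R / α ^ k)) := by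
  have hα0 : 0 < α := by linarith
  let good : X → Prop := fun x => ∃ᶠ k : ℕ in atTop, DoublingBall μ α β x (R / α ^ k)
  have hdbl : ∀ x r, DoublingBall μ α β x r → μ (closedBall x (3 * r)) ≤ β * μ (ball x r) :=
    fun x r h => (measure_mono (closedBall_subset_ball (by nlinarith [h.1]))).trans h.2.2
  have hlim : Tendsto (fun k : ℕ => R / α ^ k) atTop (𝓝 0) := by
    have := (tendsto_pow_atTop_nhds_zero_of_lt_one (inv_nonneg.2 hα0.le)
      (inv_lt_one_of_one_lt₀ (by linarith : 1 < α))).const_mul R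
    simpa [div_eq_mul_inv] using this
  let v : VitaliFamily μ :=
    -- The measure condition is imposed at good points only; the other points form a null set, and
    -- all closed balls are admitted there so that the family is nontrivial.
    { setsAt := fun x => {a | ∃ r > 0, a = closedBall x r ∧
        (good x → μ (closedBall x (3 * r)) ≤ β * μ (closedBall x r))}
      measurableSet := by
        rintro x _ ⟨r, _, rfl, _⟩; exact measurableSet_closedBall
      nonempty_interior := by
        rintro x _ ⟨r, hr, rfl, _⟩
        exact ⟨x, ball_subset_interior_closedBall (mem_ball_self hr)⟩
      nontrivial := by
        intro x ε hε
        by_cases hx : good x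
        · obtain ⟨k, hk, hkε⟩ := (hx.and_eventually (hlim.eventually_le_const hε)).exists
          exact ⟨closedBall x (R / α ^ k), ⟨_, hk.1, rfl, fun _ => (hdbl x _ hk).trans
            (by gcongr; exact ball_subset_closedBall)⟩, closedBall_subset_closedBall hkε⟩
        · exact ⟨closedBall x ε, ⟨ε, hε, rfl, fun h => (hx h).elim⟩, subset_rfl⟩
      covering := by
        intro s f hfs hff
        let t : Set (ℝ × X × Set X) :=
          {p | p.2.2 ⊆ closedBall p.2.1 p.1 ∧ μ (closedBall p.2.1 (3 * p.1)) ≤ β * μ p.2.2 ∧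
            (interior p.2.2).Nonempty ∧ IsClosed p.2.2 ∧ p.2.2 ∈ f p.2.1 ∧ p.2.1 ∈ s}
        have A : ∀ x ∈ s ∩ {x | good x}, ∀ ε : ℝ, ε > 0 → ∃ p, p ∈ t ∧ p.1 ≤ ε ∧ p.2.1 = x := by
          rintro x ⟨xs, hx⟩ ε hε
          obtain ⟨a, ha, h'a⟩ := hff x xs ε hε
          obtain ⟨r, hr, rfl, hμ⟩ := hfs x xs ha
          -- A closed ball contained in that of radius `ε` may still be presented with a radius `r >
          -- ε`; recording the minimum keeps both requirements.
          refine ⟨⟨min r ε, x, closedBall x r⟩, ⟨?_, ?_, ?_, isClosed_closedBall, ha, xs⟩,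
            min_le_right _ _, rfl⟩
          · rcases min_cases r ε with h' | h' <;> simp only [h'.1]
            · exact subset_rfl
            · exact h'a
          · refine le_trans ?_ (hμ hx)
            gcongr
            exact min_le_left _ _
          · exact ⟨x, ball_subset_interior_closedBall (mem_ball_self hr)⟩
        obtain ⟨t', t't, -, t'_disj, μt'⟩ := Vitali.exists_disjoint_covering_ae μ
          (s ∩ {x | good x}) t β (fun p => p.1) (fun p => p.2.1) (fun p => p.2.2)
          (fun p hp => hp.1) (fun p hp => hp.2.1) (fun p hp => hp.2.2.1)
          (fun p hp => hp.2.2.2.1) A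
        refine ⟨(fun p : ℝ × X × Set X => p.2) '' t', ?_, ?_, ?_, ?_⟩
        · rintro - ⟨q, hq, rfl⟩
          exact (t't hq).2.2.2.2.2
        · rintro p ⟨q, hq, rfl⟩ p' ⟨q', hq', rfl⟩ hqq'
          exact t'_disj hq hq' (ne_of_apply_ne _ hqq')
        · rintro - ⟨q, hq, rfl⟩
          exact (t't hq).2.2.2.2.1
        · refine measure_mono_null (t := (s ∩ {x | good x}) \ (⋃ p ∈ t', p.2.2) ∪ {x | ¬ good x})
            ?_ (measure_union_null μt' hfr)
          rw [Set.biUnion_image]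
          rintro x ⟨hx, hx'⟩
          by_cases h : good x
          · exact Or.inl ⟨⟨hx, h⟩, hx'⟩
          · exact Or.inr h }
  filter_upwards [v.ae_tendsto_lintegral_enorm_sub_div hg, hfr] with x hx hgood
  have h1 := hx.eventually_le_const (zero_lt_one)
  obtain ⟨ε, hε, h2⟩ := v.eventually_filterAt_iff.1 h1
  obtain ⟨k, hk, hkε⟩ := (hgood.and_eventually (hlim.eventually_le_const hε)).exists
  have hle := hdbl x _ hk
  have hcl : μ (closedBall x (R / α ^ k)) ≤ β * μ (ball x (R / α ^ k)) :=
    (measure_mono (closedBall_subset_closedBall (by linarith [hk.1]))).trans hle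
  have h3 := h2 (closedBall x (R / α ^ k)) ⟨_, hk.1, rfl, fun _ => hle.trans
    (by gcongr; exact ball_subset_closedBall)⟩ (closedBall_subset_closedBall hkε)
  refine ⟨k, hk, ?_⟩
  have hpos : μ (closedBall x (R / α ^ k)) ≠ 0 :=
    (hk.2.1.trans_le (measure_mono ball_subset_closedBall)).ne'
  calc ∫⁻ y in ball x (R / α ^ k), ‖g y - g x‖ₑ ∂μ
      ≤ ∫⁻ y in closedBall x (R / α ^ k), ‖g y - g x‖ₑ ∂μ :=
        lintegral_mono_set ball_subset_closedBall
    _ ≤ μ (closedBall x (R / α ^ k)) := by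
        by_cases htop : μ (closedBall x (R / α ^ k)) = ∞
        · rw [htop]; exact le_top
        · simpa using (ENNReal.div_le_iff hpos htop).1 h3
    _ ≤ _ := hcl

end NonHom

namespace NonHom

open Filter Topology

variable {X : Type*} [MetricSpace X] [MeasurableSpace X] {μ : Measure X} {lam : X → ℝ → ℝ}

/-! ### Independence of RBMO of its parameter -/

/-- The constant `C` is admissible for `g` with the numbers `m`. -/
def OscBound (μ : Measure X) (lam : X → ℝ → ℝ) (σ : ℝ) (g : X → ℝ) (m : X → ℝ → ℝ)
    (C : ℝ≥0) : Prop :=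
  (∀ x r, 0 < r → ∫⁻ y in ball x r, ‖g y - m x r‖ₑ ∂μ ≤ C * μ (ball x (σ * r))) ∧
  ∀ x y r s, 0 < r → 0 < s → ball x r ⊆ ball y s → |m x r - m y s| ≤ C * kCoeff μ lam x r s

omit [MetricSpace X] in
theorem lintegral_sub_le_add (g : X → ℝ) (c d : ℝ) (S : Set X) :
    ∫⁻ y in S, ‖g y - c‖ₑ ∂μ ≤ ∫⁻ y in S, ‖g y - d‖ₑ ∂μ + ‖d - c‖ₑ * μ S := by
  calc ∫⁻ y in S, ‖g y - c‖ₑ ∂μ ≤ ∫⁻ y in S, (‖g y - d‖ₑ + ‖d - c‖ₑ) ∂μ := by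
        refine lintegral_mono fun y => ?_
        rw [show g y - c = (g y - d) + (d - c) by ring]
        exact enorm_add_le _ _
    _ = _ := by rw [lintegral_add_right _ measurable_const, setLIntegral_const]

omit [MetricSpace X] in
theorem enorm_sub_mul_le (g : X → ℝ) (hg : AEStronglyMeasurable g μ) (c d : ℝ) (S : Set X) :
    ‖c - d‖ₑ * μ S ≤ ∫⁻ y in S, ‖g y - c‖ₑ ∂μ + ∫⁻ y in S, ‖g y - d‖ₑ ∂μ := by
  rw [← setLIntegral_const, ← lintegral_add_left']
  · refine lintegral_mono fun y => ?_
    rw [show c - d = (g y - d) - (g y - c) by ring, add_comm]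
    exact enorm_sub_le
  · exact (hg.restrict.sub aestronglyMeasurable_const).enorm

theorem lintegral_biUnion_finset_le {α ι : Type*} [MeasurableSpace α] {μ : Measure α}
    (s : Finset ι) (t : ι → Set α) (f : α → ℝ≥0∞) :
    ∫⁻ y in ⋃ i ∈ s, t i, f y ∂μ ≤ ∑ i ∈ s, ∫⁻ y in t i, f y ∂μ := by
  classical
  induction s using Finset.induction_on with
  | empty => simp
  | insert i s hi ih =>
    rw [Finset.set_biUnion_insert, Finset.sum_insert hi]
    exact (lintegral_union_le _ _ _).trans (by gcongr)

theorem enorm_le_coe_of_abs_le {a : ℝ} {b : ℝ≥0} (h : |a| ≤ b) : ‖a‖ₑ ≤ b := by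
  rw [← Real.enorm_abs, Real.enorm_of_nonneg (abs_nonneg a)]
  exact ENNReal.ofReal_le_of_le_toReal (by simpa using h)

theorem coe_le_enorm_of_le_abs {a : ℝ} {b : ℝ≥0} (h : b ≤ |a|) : (b : ℝ≥0∞) ≤ ‖a‖ₑ := by
  rw [← Real.enorm_abs, Real.enorm_of_nonneg (abs_nonneg a), ← ENNReal.ofReal_coe_nnreal]
  exact ENNReal.ofReal_le_ofReal h

variable [BorelSpace X]

/-- Both balls lie in `B(x, 2r)` and have radii comparable to `2r`, so each number is compared with
that of `B(x, 2r)` through a bounded `K`. -/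
theorem IsDominating.exists_near_bound (hlam : IsDominating μ lam) (ε : ℝ) (hε : 0 < ε)
    (hε1 : ε ≤ 1) :
    ∃ A : ℝ≥0, ∀ σ g m C, OscBound μ lam σ g m C → ∀ x r y, 0 < r → y ∈ ball x r →
      |m y (ε * r) - m x r| ≤ C * A := by
  obtain ⟨D₁, hD₁, h₁⟩ := hlam.exists_kCoeff_mul_le 2
  obtain ⟨D₂, hD₂, h₂⟩ := hlam.exists_kCoeff_mul_le (2 / ε)
  refine ⟨Real.toNNReal (D₁ + D₂), fun σ g m C hm x r y hr hy => ?_⟩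
  rw [Real.coe_toNNReal _ (by linarith)]
  have e1 := hm.2 y x (ε * r) (2 * r) (by positivity) (by positivity)
    (ball_subset_ball' (by nlinarith [mem_ball.1 hy]))
  have e2 := hm.2 x x r (2 * r) hr (by positivity) (ball_subset_ball (by linarith))
  have e3 := h₂ y (ε * r) (by positivity)
  rw [show 2 / ε * (ε * r) = 2 * r by field_simp] at e3
  have e4 := h₁ x r hr
  have e5 := abs_sub_le (m y (ε * r)) (m x (2 * r)) (m x r)
  rw [abs_sub_comm (m x (2 * r))] at e5
  have e6 := mul_le_mul_of_nonneg_left e3 C.coe_nonneg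
  have e7 := mul_le_mul_of_nonneg_left e4 C.coe_nonneg
  linarith

/-- The parameter in the definition of RBMO may be changed at the cost of a constant. -/
theorem IsDominating.exists_oscBound_of_oscBound (hX : GeometricallyDoubling X)
    (hlam : IsDominating μ lam) (σ₁ σ₂ : ℝ) (h₁ : 1 < σ₁) (h₂ : 1 < σ₂) :
    ∃ A : ℝ≥0, ∀ g m C, OscBound μ lam σ₁ g m C → OscBound μ lam σ₂ g m (A * C) := by
  obtain ⟨N, hN1, hN⟩ := hX.exists_cover_subset
  -- `k` is so large that the balls of the cover, enlarged by `σ₁`, stay inside `B(x, σ₂ r)`.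
  obtain ⟨k, hk⟩ := pow_unbounded_of_one_lt (max 2 (2 * σ₁ / (σ₂ - 1))) one_lt_two
  have hk1 := (le_max_left _ _).trans_lt hk
  have hk2 := (le_max_right _ _).trans_lt hk
  rw [div_lt_iff₀ (by linarith)] at hk2
  have hε : (0 : ℝ) < 2 / 2 ^ k := by positivity
  have hε1 : (2 : ℝ) / 2 ^ k ≤ 1 := by rw [div_le_one (by positivity)]; exact hk1.le
  obtain ⟨D, hD⟩ := hlam.exists_near_bound (2 / 2 ^ k) hε hε1
  refine ⟨N ^ k * (1 + D) + 1, fun g m C hm => ⟨fun x r hr => ?_, fun x y r s hr hs hsub => ?_⟩⟩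
  · obtain ⟨s, hsE, hs, hc⟩ := hN k x r (ball x r) hr subset_rfl
    rw [show 2 * (r / 2 ^ k) = 2 / 2 ^ k * r by ring] at hc
    have hδ : 0 < 2 / 2 ^ k * r := by positivity
    calc ∫⁻ y in ball x r, ‖g y - m x r‖ₑ ∂μ
        ≤ ∫⁻ y in ⋃ z ∈ s, ball z (2 / 2 ^ k * r), ‖g y - m x r‖ₑ ∂μ := lintegral_mono_set hc
      _ ≤ ∑ z ∈ s, ∫⁻ y in ball z (2 / 2 ^ k * r), ‖g y - m x r‖ₑ ∂μ :=
          lintegral_biUnion_finset_le _ _ _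
      _ ≤ ∑ _z ∈ s, (C * (1 + D) * μ (ball x (σ₂ * r)) : ℝ≥0∞) := by
          refine Finset.sum_le_sum fun z hz => ?_
          have hzx : dist z x < r := mem_ball.1 (hsE hz)
          have hsub : ball z (σ₁ * (2 / 2 ^ k * r)) ⊆ ball x (σ₂ * r) := by
            refine ball_subset_ball' ?_
            have : σ₁ * (2 / 2 ^ k * r) ≤ (σ₂ - 1) * r := by
              rw [← mul_assoc]
              gcongr
              rw [mul_div_assoc', div_le_iff₀ (by positivity)]
              linarith
            linarith
          have hsub' : ball z (2 / 2 ^ k * r) ⊆ ball x (σ₂ * r) :=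
            (ball_subset_ball (le_mul_of_one_le_left hδ.le h₁.le)).trans hsub
          calc _ ≤ _ := lintegral_sub_le_add g (m x r) (m z (2 / 2 ^ k * r)) _
            _ ≤ C * μ (ball x (σ₂ * r)) + (C * D : ℝ≥0) * μ (ball x (σ₂ * r)) := by
                gcongr
                · exact (hm.1 z _ hδ).trans (by gcongr)
                · exact enorm_le_coe_of_abs_le (hD σ₁ g m C hm x r z hr (hsE hz))
            _ = _ := by push_cast; ring
      _ = s.card * (C * (1 + D) * μ (ball x (σ₂ * r))) := by simp
      _ ≤ (N ^ k * (1 + D) + 1) * C * μ (ball x (σ₂ * r)) := by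
          have : (s.card : ℝ≥0∞) ≤ N ^ k := by exact_mod_cast hs
          calc _ ≤ (N ^ k : ℝ≥0∞) * (C * (1 + D) * μ (ball x (σ₂ * r))) := by gcongr
            _ = (N ^ k * (1 + D)) * C * μ (ball x (σ₂ * r)) := by ring
            _ ≤ _ := by gcongr; exact le_self_add
      _ = _ := by push_cast; ring
  · refine (hm.2 x y r s hr hs hsub).trans ?_
    have h0 := hlam.one_le_kCoeff x hr s
    have : C ≤ (N ^ k * (1 + D) + 1) * C := le_mul_of_one_le_left C.2 le_add_self
    have h3 : (C : ℝ) ≤ ((N ^ k * (1 + D) + 1) * C : ℝ≥0) := by exact_mod_cast this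
    gcongr

/-! ### The John-Nirenberg inequality -/

omit [BorelSpace X] in
theorem locallyIntegrable_of_ball {g : X → ℝ} (hg : ∀ x r, IntegrableOn g (ball x r) μ) :
    LocallyIntegrable g μ := fun x => ⟨ball x 1, ball_mem_nhds x one_pos, hg x 1⟩

/-- Induction on `n` by a stopping argument. Where `|g - m x r|` is large, differentiation gives a
small doubling ball whose number differs from `m x r` by more than `L`; the largest such ball about
each point is selected, and a disjoint subfamily is extracted. Doubling makes `g - m x r` large on
average over these balls, so they have small total measure. By maximality their numbers are still
within a constant of `m x r`, so the level `n` estimate applies to their enlargements. The parameter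
`√ρ` is used twice: once to contain the selected balls, once for the oscillation on the ball
containing them. -/
theorem IsDominating.john_nirenberg (hX : GeometricallyDoubling X)
    (hlam : IsDominating μ lam) (ρ : ℝ) (hρ : 1 < ρ) :
    ∃ A : ℝ, 0 < A ∧ ∀ g m, (∀ x r, IntegrableOn g (ball x r) μ) →
      OscBound μ lam (√ρ) g m 1 → ∀ (n : ℕ) x r, 0 < r →
        μ {y ∈ ball x r | n * A < |g y - m x r|} ≤ 2⁻¹ ^ n * μ (ball x (ρ * r)) := by
  have hsq : 1 < √ρ := by rw [Real.lt_sqrt] <;> linarith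
  have hsqρ : √ρ * √ρ = ρ := Real.mul_self_sqrt (by linarith)
  have hsqle : √ρ ≤ ρ := by nlinarith
  -- Balls of radius at most `ε * r` centred in `B(x, r)` stay in `B(x, √ρ r)`.
  set ε : ℝ := min (√ρ - 1) 1 with hεdef
  have hε : 0 < ε := lt_min (by linarith) one_pos
  have hε1 : ε ≤ 1 := min_le_right _ _
  have hε2 : ε ≤ √ρ - 1 := min_le_left _ _
  -- Room for the fivefold Vitali enlargement followed by the enlargement by `ρ` in the induction
  -- hypothesis.
  set α : ℝ := 5 * ρ with hαdef
  have hα1 : 1 < α := by linarith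
  have hα0 : 0 < α := by linarith
  obtain ⟨β, hβ1, Cd, hCd, hchain, -, hsmall⟩ := hlam.exists_doubling_constants hX α hα1
  obtain ⟨A₀, hA₀⟩ := hlam.exists_near_bound ε hε hε1
  obtain ⟨A₁', hA₁1, hA₁'⟩ := hlam.exists_kCoeff_mul_le α
  obtain ⟨A₁, rfl⟩ : ∃ A₁ : ℝ≥0, A₁' = A₁ := ⟨⟨A₁', by linarith⟩, rfl⟩
  -- The summand `β` pays for the oscillation of `g` on a selected ball; the rest brings `β` times
  -- the total measure of the selected balls down to half of `μ(B(x, ρ r))`.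
  set L : ℝ≥0 := β + 2 * β * (1 + A₁) with hL
  refine ⟨L + 2 * β + 2 * A₁ + Cd + A₀, by positivity, fun g m hg hm => ?_⟩
  set A : ℝ := L + 2 * β + 2 * A₁ + Cd + A₀ with hA
  have := hX.secondCountable
  have := hlam.isLocallyFiniteMeasure
  have hgl := locallyIntegrable_of_ball hg
  have hgm : AEStronglyMeasurable g μ := hgl.aestronglyMeasurable
  have hstep : ∀ x r c, 0 < r → 1 ≤ c → c ≤ α → |m x r - m x (c * r)| ≤ A₁ := by
    intro x r c hr hc1 hcα
    have := hm.2 x x r (c * r) hr (by positivity) (ball_subset_ball (by nlinarith))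
    have h2 : kCoeff μ lam x r (c * r) ≤ kCoeff μ lam x r (α * r) :=
      hlam.kCoeff_mono x hr le_rfl (by gcongr)
    have h3 := hA₁' x r hr
    simp only [NNReal.coe_one, one_mul] at this
    linarith
  -- Going up from scale `k`, one meets a doubling scale, where the difference is at most `L`, or
  -- the top scale, where it is at most `A₀`. The balls passed on the way are not doubling, so they
  -- cost only `Cd`, and `A₁` pays for one step of scale.
  have hcontrol : ∀ x r y, 0 < r → y ∈ ball x r → ∀ k : ℕ,
      (∀ j < k, DoublingBall μ α β y (ε * r / α ^ j) →
        |m y (ε * r / α ^ j) - m x r| ≤ L) →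
      |m y (ε * r / α ^ k) - m x r| ≤ L + A₁ + Cd + A₀ := by
    intro x r y hr hy k hk
    have h0 : |m y (ε * r) - m x r| ≤ A₀ := by simpa using hA₀ _ g m 1 hm x r y hr hy
    rcases k with _ | k
    · rw [pow_zero, div_one]
      have : (0 : ℝ) ≤ L := L.2
      have : (0 : ℝ) ≤ A₁ := A₁.2
      linarith
    have hfind : ∀ k : ℕ, ∃ j ≤ k, (j = 0 ∨ DoublingBall μ α β y (ε * r / α ^ j)) ∧
        ∀ i, j < i → i ≤ k → ¬ DoublingBall μ α β y (ε * r / α ^ i) := by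
      intro k
      induction k with
      | zero => exact ⟨0, le_rfl, Or.inl rfl, fun i h1 h2 => by omega⟩
      | succ k ih =>
        by_cases hd : DoublingBall μ α β y (ε * r / α ^ (k + 1))
        · exact ⟨k + 1, le_rfl, Or.inr hd, fun i h1 h2 => by omega⟩
        · obtain ⟨j, hj, hj1, hj2⟩ := ih
          refine ⟨j, by omega, hj1, fun i h1 h2 => ?_⟩
          rcases Nat.lt_or_ge i (k + 1) with h | h
          · exact hj2 i h1 (by omega)
          · rwa [show i = k + 1 by omega]
    obtain ⟨j, hjk, hj1, hj2⟩ := hfind k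
    have hpow : ∀ i ≤ k, α ^ i * (ε * r / α ^ k) = ε * r / α ^ (k - i) := by
      intro i hi
      rw [show α ^ k = α ^ (k - i) * α ^ i by rw [← pow_add]; congr 1; omega]
      field_simp
    have e1 : |m y (ε * r / α ^ (k + 1)) - m y (ε * r / α ^ k)| ≤ A₁ := by
      have := hstep y (ε * r / α ^ (k + 1)) α (by positivity) hα1.le le_rfl
      rwa [show α * (ε * r / α ^ (k + 1)) = ε * r / α ^ k by rw [pow_succ]; field_simp] at this
    have e2 : |m y (ε * r / α ^ k) - m y (ε * r / α ^ j)| ≤ Cd := by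
      have h1 := hchain (k - j) y (ε * r / α ^ k) (by positivity) fun i hi => by
        rw [hpow i (by omega)]
        exact hj2 _ (by omega) (by omega)
      rw [hpow (k - j) (by omega), show k - (k - j) = j by omega] at h1
      have h2 := hm.2 y y (ε * r / α ^ k) (ε * r / α ^ j) (by positivity) (by positivity)
        (ball_subset_ball (by gcongr; exact hα1.le))
      simp only [NNReal.coe_one, one_mul] at h2
      linarith
    have e3 : |m y (ε * r / α ^ j) - m x r| ≤ L + A₀ := by
      rcases hj1 with rfl | hd
      · rw [pow_zero, div_one]
        have : (0 : ℝ) ≤ L := L.2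
        linarith
      · have := hk j (by omega) hd
        have : (0 : ℝ) ≤ A₀ := A₀.2
        linarith
    have e4 := abs_sub_le (m y (ε * r / α ^ (k + 1))) (m y (ε * r / α ^ k)) (m x r)
    have e5 := abs_sub_le (m y (ε * r / α ^ k)) (m y (ε * r / α ^ j)) (m x r)
    linarith
  intro n
  induction n with
  | zero =>
    intro x r hr
    rw [pow_zero, one_mul]
    exact measure_mono fun y hy => ball_subset_ball (by nlinarith) hy.1
  | succ n ih =>
    intro x r hr
    have hR : 0 < ε * r := by positivity
    have hdiff := ae_tendsto_of_frequently_doubling hgl (by linarith : 4 ≤ α) (ε * r)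
      (hsmall _ hR)
    classical
    let P : X → ℕ → Prop := fun y k =>
      DoublingBall μ α β y (ε * r / α ^ k) ∧ (L : ℝ) < |m y (ε * r / α ^ k) - m x r|
    let T : Set X := {y ∈ ball x r | ∃ k, P y k}
    -- The least `k` gives the largest ball; the value 0 outside `T` is never used.
    let rad : X → ℝ := fun y => if h : ∃ k, P y k then ε * r / α ^ (Nat.find h) else 0
    have hrad : ∀ y ∈ T, DoublingBall μ α β y (rad y) ∧ rad y ≤ ε * r ∧
        (L : ℝ) < |m y (rad y) - m x r| ∧ |m y (rad y) - m x r| ≤ L + A₁ + Cd + A₀ := by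
      rintro y ⟨hy, h⟩
      have hr' : rad y = ε * r / α ^ (Nat.find h) := dif_pos h
      rw [hr']
      refine ⟨(Nat.find_spec h).1, div_le_self hR.le (one_le_pow₀ hα1.le), (Nat.find_spec h).2,
        hcontrol x r y hr hy _ fun j hj hd => ?_⟩
      by_contra! hlt
      exact Nat.find_min h hj ⟨hd, hlt⟩
    -- The closed enlargement by 4 lies in the open enlargement by 5.
    obtain ⟨u, huT, hdisj, hcov⟩ :=
      Vitali.exists_disjoint_subfamily_covering_enlargement_closedBall T (fun y => y) rad (ε * r)
        (fun y hy => (hrad y hy).2.1) 4 (by norm_num)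
    have hdisj' : u.PairwiseDisjoint fun y => ball y (rad y) := fun a ha b hb hab =>
      (hdisj ha hb hab).mono ball_subset_closedBall ball_subset_closedBall
    have hcount : u.Countable := hdisj'.countable_of_isOpen (fun _ _ => isOpen_ball)
      fun y hy => ⟨y, mem_ball_self (hrad y (huT hy)).1.1⟩
    -- the selected balls are small in total
    have hsum : (β : ℝ≥0∞) * ∑' z : u, μ (ball (z : X) (rad z)) ≤ 2⁻¹ * μ (ball x (ρ * r)) := by
      have h1 : ∀ z : u, (2 * β * (1 + A₁) : ℝ≥0∞) * μ (ball (z : X) (rad z)) ≤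
          ∫⁻ y in ball (z : X) (rad z), ‖g y - m x r‖ₑ ∂μ := by
        rintro ⟨z, hz⟩
        obtain ⟨hd, -, hlt, -⟩ := hrad z (huT hz)
        have e1 := enorm_sub_mul_le g hgm (m z (rad z)) (m x r) (ball z (rad z))
        have e2 := hm.1 z (rad z) hd.1
        have e3 : μ (ball z (√ρ * rad z)) ≤ β * μ (ball z (rad z)) :=
          (measure_mono (ball_subset_ball (by gcongr; exact hd.1.le; linarith))).trans hd.2.2
        have e4 : (L : ℝ≥0∞) * μ (ball z (rad z)) ≤ ‖m z (rad z) - m x r‖ₑ * μ (ball z (rad z)) := by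
          gcongr; exact coe_le_enorm_of_le_abs hlt.le
        have hfin : β * μ (ball z (rad z)) ≠ ∞ :=
          ENNReal.mul_ne_top ENNReal.coe_ne_top (hlam.measure_ball_lt_top _ _).ne
        rw [← ENNReal.add_le_add_iff_left hfin]
        calc _ = (L : ℝ≥0∞) * μ (ball z (rad z)) := by rw [hL]; push_cast; ring
          _ ≤ _ := e4.trans e1
          _ ≤ _ := by
            gcongr
            refine e2.trans ?_
            simpa using e3
      have h2 : ∑' z : u, ∫⁻ y in ball (z : X) (rad z), ‖g y - m x r‖ₑ ∂μ ≤
          (1 + A₁) * μ (ball x (ρ * r)) := by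
        rw [← lintegral_biUnion hcount (fun _ _ => measurableSet_ball) hdisj']
        have hsub : (⋃ z ∈ u, ball z (rad z)) ⊆ ball x (√ρ * r) := by
          refine Set.iUnion₂_subset fun z hz => ball_subset_ball' ?_
          have e1 := (hrad z (huT hz)).2.1
          have e2 := mem_ball.1 (huT hz).1
          nlinarith
        have e1 := hm.1 x (√ρ * r) (by positivity)
        rw [← mul_assoc, hsqρ, ENNReal.coe_one, one_mul] at e1
        have e2 := hstep x r (√ρ) hr hsq.le (by linarith)
        rw [abs_sub_comm] at e2
        calc _ ≤ ∫⁻ y in ball x (√ρ * r), ‖g y - m x r‖ₑ ∂μ := lintegral_mono_set hsub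
          _ ≤ _ := lintegral_sub_le_add g (m x r) (m x (√ρ * r)) _
          _ ≤ μ (ball x (ρ * r)) + A₁ * μ (ball x (ρ * r)) := by
            gcongr
            exact enorm_le_coe_of_abs_le e2
          _ = _ := by ring
      have h3 := (ENNReal.tsum_le_tsum h1).trans h2
      rw [ENNReal.tsum_mul_left] at h3
      have hne0 : (2 * (1 + A₁) : ℝ≥0∞) ≠ 0 := by simp
      have hnet : (2 * (1 + A₁) : ℝ≥0∞) ≠ ∞ := by finiteness
      rw [← ENNReal.mul_le_mul_iff_right hne0 hnet]
      calc _ = (2 * β * (1 + A₁) : ℝ≥0∞) * ∑' z : u, μ (ball (z : X) (rad z)) := by ring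
        _ ≤ _ := h3
        _ = (2 * 2⁻¹) * ((1 + A₁) * μ (ball x (ρ * r))) := by
          rw [ENNReal.mul_inv_cancel two_ne_zero ENNReal.ofNat_ne_top, one_mul]
        _ = _ := by ring
    have hsubset : ∀ᵐ y ∂μ, y ∈ {y ∈ ball x r | (n + 1 : ℕ) * A < |g y - m x r|} →
        y ∈ ⋃ z ∈ u, {y ∈ ball z (5 * rad z) | n * A < |g y - m z (5 * rad z)|} := by
      filter_upwards [hdiff] with y ⟨k, hk, hkint⟩ ⟨hyB, hyA⟩
      push_cast at hyA
      have hβ0 : (0 : ℝ) ≤ β := β.2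
      have hL0 : (0 : ℝ) ≤ L := L.2
      have hA₁0 : (0 : ℝ) ≤ A₁ := A₁.2
      have hA₀0 : (0 : ℝ) ≤ A₀ := A₀.2
      have hnA : 0 ≤ n * A := by positivity
      -- On this doubling ball both `g y` and the number of the ball are close to `g` on average, up
      -- to `β` times its measure; dividing by the measure compares the two.
      have hclose : |g y - m y (ε * r / α ^ k)| ≤ 2 * β := by
        have e1 := enorm_sub_mul_le g hgm (g y) (m y (ε * r / α ^ k)) (ball y (ε * r / α ^ k))
        have e2 := hm.1 y _ hk.1
        have e3 : μ (ball y (√ρ * (ε * r / α ^ k))) ≤ β * μ (ball y (ε * r / α ^ k)) :=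
          (measure_mono (ball_subset_ball (by gcongr; linarith))).trans hk.2.2
        rw [ENNReal.coe_one, one_mul] at e2
        have e4 : ‖g y - m y (ε * r / α ^ k)‖ₑ * μ (ball y (ε * r / α ^ k)) ≤
            (2 * β : ℝ≥0) * μ (ball y (ε * r / α ^ k)) := by
          refine e1.trans ((add_le_add hkint (e2.trans e3)).trans (le_of_eq ?_))
          push_cast; ring
        rw [ENNReal.mul_le_mul_iff_left hk.2.1.ne' (hlam.measure_ball_lt_top _ _).ne] at e4
        rw [← Real.enorm_abs, Real.enorm_of_nonneg (abs_nonneg _)] at e4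
        have := ENNReal.toReal_mono ENNReal.coe_ne_top e4
        rwa [ENNReal.toReal_ofReal (abs_nonneg _)] at this
      -- `A` is at least `L + 2 * β`, so a deviation above `A` at `y` forces a deviation above `L`
      -- on the small doubling ball.
      have hyT : y ∈ T := by
        refine ⟨hyB, k, hk, ?_⟩
        have := abs_sub_le (g y) (m y (ε * r / α ^ k)) (m x r)
        nlinarith
      obtain ⟨z, hz, hyz⟩ := hcov y hyT
      obtain ⟨hd, -, -, hle⟩ := hrad z (huT hz)
      refine Set.mem_iUnion₂.2 ⟨z, hz, ?_, ?_⟩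
      · have := mem_closedBall.1 (hyz (mem_closedBall_self (hrad y hyT).1.1.le))
        exact mem_ball.2 (this.trans_lt (by nlinarith [hd.1]))
      · have e1 := hstep z (rad z) 5 hd.1 (by norm_num) (by linarith)
        have e2 := abs_sub_le (g y) (m z (5 * rad z)) (m x r)
        have e3 := abs_sub_le (m z (5 * rad z)) (m z (rad z)) (m x r)
        rw [abs_sub_comm (m z (5 * rad z)) (m z (rad z))] at e3
        nlinarith
    calc μ {y ∈ ball x r | (n + 1 : ℕ) * A < |g y - m x r|}
        ≤ μ (⋃ z ∈ u, {y ∈ ball z (5 * rad z) | n * A < |g y - m z (5 * rad z)|}) :=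
          measure_mono_ae hsubset
      _ ≤ ∑' z : u, μ {y ∈ ball (z : X) (5 * rad z) | n * A < |g y - m z (5 * rad z)|} :=
          measure_biUnion_le μ hcount _
      _ ≤ ∑' z : u, 2⁻¹ ^ n * (β * μ (ball (z : X) (rad z))) := by
          refine ENNReal.tsum_le_tsum fun z => ?_
          obtain ⟨hd, -⟩ := hrad z (huT z.2)
          refine (ih z (5 * rad z) (by linarith [hd.1])).trans ?_
          gcongr
          rw [show ρ * (5 * rad z) = α * rad z by rw [hαdef]; ring]
          exact hd.2.2
      _ = 2⁻¹ ^ n * (β * ∑' z : u, μ (ball (z : X) (rad z))) := by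
          rw [ENNReal.tsum_mul_left, ENNReal.tsum_mul_left]
      _ ≤ 2⁻¹ ^ n * (2⁻¹ * μ (ball x (ρ * r))) := by gcongr
      _ = _ := by rw [pow_succ]; ring

end NonHom

/-! ### Integral form of John-Nirenberg and the pairing with atoms. -/

namespace NonHom

open Filter Topology

variable {X : Type*} [MetricSpace X] [MeasurableSpace X] {μ : Measure X} {lam : X → ℝ → ℝ}

theorem tsum_pow_mul_geometric_lt_top (A : ℝ) (hA : 0 < A) (s : ℝ) :
    ∑' n : ℕ, ENNReal.ofReal (((n + 1) * A) ^ s) * 2⁻¹ ^ n < ∞ := by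
  set k := ⌈s⌉₊
  have hsum : Summable fun n : ℕ => ((n : ℝ) + 1) ^ k * (1 / 2) ^ n := by
    have h1 := summable_pow_mul_geometric_of_norm_lt_one (R := ℝ) k (r := 1 / 2) (by norm_num)
    have h2 := ((summable_nat_add_iff 1).2 h1).mul_left 2
    refine h2.congr fun n => ?_
    push_cast; ring
  have hsum' := (hsum.mul_left (A ^ s)).tsum_ofReal_lt_top
  refine lt_of_le_of_lt (ENNReal.tsum_le_tsum fun n => ?_) hsum'
  have h2 : (2⁻¹ : ℝ≥0∞) ^ n = ENNReal.ofReal ((1 / 2) ^ n) := by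
    rw [ENNReal.ofReal_pow (by norm_num), one_div, ENNReal.ofReal_inv_of_pos two_pos]
    simp
  rw [h2, ← ENNReal.ofReal_mul (by positivity)]
  refine ENNReal.ofReal_le_ofReal ?_
  rw [Real.mul_rpow (by positivity) hA.le, mul_comm _ (A ^ s), mul_assoc]
  gcongr
  rw [← Real.rpow_natCast]
  exact Real.rpow_le_rpow_of_exponent_le (by linarith [n.cast_nonneg (α := ℝ)]) (Nat.le_ceil s)

variable [BorelSpace X]

theorem OscBound.mono (hlam : IsDominating μ lam) {σ : ℝ} {g : X → ℝ} {m : X → ℝ → ℝ} {C D : ℝ≥0}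
    (h : OscBound μ lam σ g m C) (hCD : C ≤ D) : OscBound μ lam σ g m D := by
  refine ⟨fun x r hr => (h.1 x r hr).trans (by gcongr), fun x y r s hr hs hsub =>
    (h.2 x y r s hr hs hsub).trans ?_⟩
  have := hlam.one_le_kCoeff x hr s
  gcongr

omit [BorelSpace X] in
theorem OscBound.const_mul {σ : ℝ} {g : X → ℝ} {m : X → ℝ → ℝ} {C : ℝ≥0}
    (h : OscBound μ lam σ g m C) (t : ℝ≥0) :
    OscBound μ lam σ (fun y => t * g y) (fun x r => t * m x r) (t * C) := by
  refine ⟨fun x r hr => ?_, fun x y r s hr hs hsub => ?_⟩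
  · have h0 : ∀ y, ‖t * g y - t * m x r‖ₑ = t * ‖g y - m x r‖ₑ := fun y => by
      rw [← mul_sub, enorm_mul, Real.enorm_of_nonneg t.coe_nonneg, ENNReal.ofReal_coe_nnreal]
    simp_rw [h0]
    rw [lintegral_const_mul' _ _ ENNReal.coe_ne_top, ENNReal.coe_mul, mul_assoc]
    gcongr
    exact h.1 x r hr
  · rw [← mul_sub, abs_mul, NNReal.coe_mul, mul_assoc, NNReal.abs_eq]
    gcongr
    exact h.2 x y r s hr hs hsub

/-- The `L^s` form of the John-Nirenberg inequality. -/
theorem IsDominating.exists_lintegral_rpow_le (hX : GeometricallyDoubling X)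
    (hlam : IsDominating μ lam) (σ ρ : ℝ) (hσ : 1 < σ) (hρ : 1 < ρ) (s : ℝ) (hs : 0 < s) :
    ∃ A : ℝ≥0, ∀ g m C, (∀ x r, IntegrableOn g (ball x r) μ) → OscBound μ lam σ g m C →
      ∀ x r, 0 < r → (∫⁻ y in ball x r, ‖g y - m x r‖ₑ ^ s ∂μ) ^ (1 / s) ≤
        A * C * μ (ball x (ρ * r)) ^ (1 / s) := by
  have hsq : 1 < √ρ := by rw [Real.lt_sqrt] <;> linarith
  obtain ⟨A, hA, hJN⟩ := hlam.john_nirenberg hX ρ hρ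
  obtain ⟨A', hA'⟩ := hlam.exists_oscBound_of_oscBound hX σ (√ρ) hσ hsq
  set S : ℝ≥0∞ := ∑' n : ℕ, ENNReal.ofReal (((n + 1) * A) ^ s) * 2⁻¹ ^ n with hSdef
  have hS : S < ∞ := tsum_pow_mul_geometric_lt_top A hA s
  have hS' : S ^ (1 / s) ≠ ∞ := ENNReal.rpow_ne_top_of_nonneg (by positivity) hS.ne
  refine ⟨(A' + 1) * (S ^ (1 / s)).toNNReal, fun g m C hg hm x r hr => ?_⟩
  have := hX.secondCountable
  have hgm : AEStronglyMeasurable g μ := (locallyIntegrable_of_ball hg).aestronglyMeasurable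
  rcases eq_or_ne C 0 with rfl | hC
  · have h1 := hm.1 x r hr
    rw [ENNReal.coe_zero, zero_mul, nonpos_iff_eq_zero] at h1
    replace h1 := (lintegral_eq_zero_iff'
      (hgm.restrict.sub (aestronglyMeasurable_const (b := m x r))).enorm).1 h1
    have h2 : ∫⁻ y in ball x r, ‖g y - m x r‖ₑ ^ s ∂μ = 0 := by
      rw [← lintegral_zero]
      refine lintegral_congr_ae ?_
      filter_upwards [h1] with y hy
      have hy' : ‖g y - m x r‖ₑ = 0 := hy
      rw [hy', ENNReal.zero_rpow_of_pos hs]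
    rw [h2, ENNReal.zero_rpow_of_pos (by positivity)]
    exact zero_le
  -- Normalization to oscillation constant 1; the added 1 keeps `D` nonzero, and the case `C = 0`
  -- was settled separately.
  set D : ℝ≥0 := (A' + 1) * C with hD
  have hD0 : D ≠ 0 := mul_ne_zero (by positivity) hC
  have hm' := ((hA' g m C hm).mono hlam
    (mul_le_mul_left le_self_add C : A' * C ≤ D)).const_mul D⁻¹
  rw [inv_mul_cancel₀ hD0] at hm'
  have hJ := hJN (fun y => (D⁻¹ : ℝ≥0) * g y) _ (fun x r => (hg x r).const_mul _) hm'
  set h : X → ℝ := fun y => |(D⁻¹ : ℝ≥0) * g y - (D⁻¹ : ℝ≥0) * m x r| with hh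
  have hhm : AEMeasurable h μ := (((hgm.const_mul _).sub aestronglyMeasurable_const).norm).aemeasurable
  -- Layers of the values of `h`. Layer 0 has no lower bound, so that it includes the zeros of `h`.
  let G : ℕ → Set X := fun n => ball x r ∩ ({y | h y ≤ (n + 1) * A} ∩ {y | n = 0 ∨ n * A < h y})
  have hGm : ∀ n, NullMeasurableSet (G n) μ := by
    intro n
    refine measurableSet_ball.nullMeasurableSet.inter
      ((nullMeasurableSet_le hhm aemeasurable_const).inter ?_)
    by_cases hn : n = 0
    · simp [hn]
    · simp only [hn, false_or]
      exact nullMeasurableSet_lt aemeasurable_const hhm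
  have hGμ : ∀ n, μ (G n) ≤ 2⁻¹ ^ n * μ (ball x (ρ * r)) := by
    intro n
    by_cases hn : n = 0
    · subst hn
      rw [pow_zero, one_mul]
      exact measure_mono fun y hy => ball_subset_ball (by nlinarith) hy.1
    · refine (measure_mono fun y hy => ?_).trans (hJ n x r hr)
      exact ⟨hy.1, hy.2.2.resolve_left hn⟩
  have hcov : ball x r ⊆ ⋃ n, G n := by
    intro y hy
    -- Truncated subtraction sends the points with `h y = 0` to layer 0.
    refine Set.mem_iUnion.2 ⟨⌈h y / A⌉₊ - 1, hy, ?_, ?_⟩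
    · have h1 := Nat.le_ceil (h y / A)
      rw [div_le_iff₀ hA] at h1
      have h2 : (⌈h y / A⌉₊ : ℝ) ≤ ((⌈h y / A⌉₊ - 1 : ℕ) : ℝ) + 1 := by
        exact_mod_cast (by omega)
      exact h1.trans (by gcongr)
    · rcases Nat.eq_zero_or_pos (⌈h y / A⌉₊ - 1) with h0 | h0
      · exact Or.inl h0
      · right
        have h1 : ⌈h y / A⌉₊ - 1 < ⌈h y / A⌉₊ := by omega
        rwa [Nat.lt_ceil, lt_div_iff₀ hA] at h1
  have hmain : ∫⁻ y in ball x r, ENNReal.ofReal (h y) ^ s ∂μ ≤ S * μ (ball x (ρ * r)) := by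
    calc ∫⁻ y in ball x r, ENNReal.ofReal (h y) ^ s ∂μ
        ≤ ∫⁻ y in ⋃ n, G n, ENNReal.ofReal (h y) ^ s ∂μ := lintegral_mono_set hcov
      _ ≤ ∑' n, ∫⁻ y in G n, ENNReal.ofReal (h y) ^ s ∂μ := lintegral_iUnion_le _ _
      _ ≤ ∑' n : ℕ, ENNReal.ofReal (((n + 1) * A) ^ s) * 2⁻¹ ^ n * μ (ball x (ρ * r)) := by
          refine ENNReal.tsum_le_tsum fun n => ?_
          calc ∫⁻ y in G n, ENNReal.ofReal (h y) ^ s ∂μ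
              ≤ ∫⁻ _y in G n, ENNReal.ofReal (((n + 1) * A) ^ s) ∂μ := by
                refine lintegral_mono_ae ((ae_restrict_iff'₀ (hGm n)).2 (ae_of_all _ fun y hy => ?_))
                rw [ENNReal.ofReal_rpow_of_nonneg (abs_nonneg _) hs.le]
                exact ENNReal.ofReal_le_ofReal (Real.rpow_le_rpow (abs_nonneg _) hy.2.1 hs.le)
            _ = ENNReal.ofReal (((n + 1) * A) ^ s) * μ (G n) := setLIntegral_const _ _
            _ ≤ _ := by rw [mul_assoc]; gcongr; exact hGμ n
      _ = S * μ (ball x (ρ * r)) := ENNReal.tsum_mul_right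
  have hgh : ∀ y, ‖g y - m x r‖ₑ ^ s = (D : ℝ≥0∞) ^ s * ENNReal.ofReal (h y) ^ s := by
    intro y
    rw [← ENNReal.mul_rpow_of_nonneg _ _ hs.le,
      show h y = |(D⁻¹ : ℝ≥0) * g y - (D⁻¹ : ℝ≥0) * m x r| from rfl, ← mul_sub, abs_mul, NNReal.abs_eq,
      ENNReal.ofReal_mul (NNReal.coe_nonneg _), ENNReal.ofReal_coe_nnreal, ← mul_assoc,
      ← ENNReal.coe_mul, mul_inv_cancel₀ hD0, ENNReal.coe_one, one_mul,
      ← Real.enorm_of_nonneg (abs_nonneg _), Real.enorm_abs]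
  simp_rw [hgh]
  have hDt : (D : ℝ≥0∞) ^ s ≠ ∞ := ENNReal.rpow_ne_top_of_nonneg hs.le ENNReal.coe_ne_top
  rw [lintegral_const_mul' _ _ hDt]
  calc ((D : ℝ≥0∞) ^ s * ∫⁻ y in ball x r, ENNReal.ofReal (h y) ^ s ∂μ) ^ (1 / s)
      ≤ ((D : ℝ≥0∞) ^ s * (S * μ (ball x (ρ * r)))) ^ (1 / s) := by gcongr
    _ = D * (S ^ (1 / s) * μ (ball x (ρ * r)) ^ (1 / s)) := by
        rw [ENNReal.mul_rpow_of_nonneg _ _ (by positivity), ← ENNReal.rpow_mul,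
          ENNReal.mul_rpow_of_nonneg _ _ (by positivity), mul_one_div_cancel hs.ne',
          ENNReal.rpow_one]
    _ = _ := by
        rw [hD]
        push_cast
        rw [ENNReal.coe_toNNReal hS']
        ring

/-- Atoms for large exponents and parameters are atoms for smaller ones. -/
theorem eLpNorm_atom_mono (hfin : ∀ x r, μ (ball x r) < ∞) {a : X → ℝ}
    (ha : AEStronglyMeasurable a μ) {z : X} {s : ℝ} (hs : 0 < s)
    (hsupp : ∀ᵐ y ∂μ, y ∉ ball z s → a y = 0) {q₁ q₂ : ℝ≥0∞} (hq : q₂ ≤ q₁) (hq₂ : 1 ≤ q₂)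
    {ρ₁ ρ₂ : ℝ} (hρ : ρ₂ ≤ ρ₁) (hρ₂ : 1 ≤ ρ₂) {k : ℝ≥0∞}
    (h : eLpNorm a q₁ μ ≤ μ (ball z (ρ₁ * s)) ^ ((q₁⁻¹).toReal - 1) * k) :
    eLpNorm a q₂ μ ≤ μ (ball z (ρ₂ * s)) ^ ((q₂⁻¹).toReal - 1) * k := by
  have hsub : ball z s ⊆ ball z (ρ₂ * s) := ball_subset_ball (by nlinarith)
  have hres : ∀ q : ℝ≥0∞, eLpNorm a q (μ.restrict (ball z (ρ₂ * s))) = eLpNorm a q μ := by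
    intro q
    rw [← eLpNorm_indicator_eq_eLpNorm_restrict measurableSet_ball]
    refine eLpNorm_congr_ae ?_
    filter_upwards [hsupp] with y hy
    by_cases hyb : y ∈ ball z (ρ₂ * s)
    · rw [Set.indicator_of_mem hyb]
    · rw [Set.indicator_of_notMem hyb, hy fun h' => hyb (hsub h')]
  set M₁ := μ (ball z (ρ₁ * s))
  set M₂ := μ (ball z (ρ₂ * s)) with hM₂
  have hM : M₂ ≤ M₁ := measure_mono (ball_subset_ball (by gcongr))
  have h1 := eLpNorm_le_eLpNorm_mul_rpow_measure_univ hq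
    (ha.restrict (s := ball z (ρ₂ * s)))
  rw [hres, hres, Measure.restrict_apply_univ, ← hM₂] at h1
  have hinv : ∀ q : ℝ≥0∞, (q⁻¹).toReal = 1 / q.toReal := fun q => by
    rw [ENNReal.toReal_inv, one_div]
  rcases eq_or_ne M₂ 0 with h0 | h0
  · have : eLpNorm a q₂ μ = 0 := by
      rw [← hres, Measure.restrict_eq_zero.2 h0, eLpNorm_measure_zero]
    rw [this]; exact zero_le
  have hq₁ : (q₁⁻¹).toReal ≤ 1 := by
    have : q₁⁻¹ ≤ 1 := ENNReal.inv_le_one.2 (hq₂.trans hq)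
    simpa using ENNReal.toReal_mono ENNReal.one_ne_top this
  calc eLpNorm a q₂ μ ≤ eLpNorm a q₁ μ * M₂ ^ (1 / q₂.toReal - 1 / q₁.toReal) := h1
    _ ≤ (M₂ ^ ((q₁⁻¹).toReal - 1) * k) * M₂ ^ (1 / q₂.toReal - 1 / q₁.toReal) := by
        gcongr
        refine h.trans ?_
        gcongr ?_ * _
        -- The exponent `1/q₁ - 1` is not positive, so shrinking the ball weakens the condition.
        rw [← neg_sub, ENNReal.rpow_neg, ENNReal.rpow_neg]
        exact ENNReal.inv_le_inv.2 (ENNReal.rpow_le_rpow hM (by linarith))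
    _ = M₂ ^ ((q₁⁻¹).toReal - 1) * M₂ ^ (1 / q₂.toReal - 1 / q₁.toReal) * k := by ring
    _ = _ := by
        rw [← ENNReal.rpow_add _ _ h0 (hfin _ _).ne, hinv, hinv]
        congr 2; ring

/-- Against `g - m z s` Hölder's inequality applies, with the `L^{p'}` bound for the oscillation.
Against the constant `m z s - m x r`, of size at most `C K`, the `L¹` norm of the atom, at most
`K⁻¹`, compensates exactly. This is the purpose of the factor `K⁻¹` in the definition of atoms. -/
theorem IsDominating.exists_lintegral_atom_le (hX : GeometricallyDoubling X)
    (hlam : IsDominating μ lam) (σ ρ : ℝ) (hσ : 1 < σ) (hρ : 1 < ρ) (p : ℝ≥0∞) (hp : 1 < p)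
    (hp' : p < ∞) :
    ∃ A : ℝ≥0, ∀ g m C, (∀ x r, IntegrableOn g (ball x r) μ) → OscBound μ lam σ g m C →
      ∀ (a : X → ℝ) z s x r, AEStronglyMeasurable a μ → 0 < s → 0 < r → ball z s ⊆ ball x r →
      (∀ᵐ y ∂μ, y ∉ ball z s → a y = 0) →
      eLpNorm a p μ ≤ μ (ball z (ρ * s)) ^ ((p⁻¹).toReal - 1) *
        (ENNReal.ofReal (kCoeff μ lam z s r))⁻¹ →
      ∫⁻ y, ‖a y‖ₑ * ‖g y - m x r‖ₑ ∂μ ≤ A * C := by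
  have hp1 : 1 < p.toReal := by
    rw [← ENNReal.toReal_one]; exact (ENNReal.toReal_lt_toReal ENNReal.one_ne_top hp'.ne).2 hp
  set p' := p.toReal.conjExponent with hp'def
  have hpq : p.toReal.HolderConjugate p' := Real.HolderConjugate.conjExponent hp1
  obtain ⟨A, hA⟩ := hlam.exists_lintegral_rpow_le hX σ ρ hσ hρ p' hpq.symm.pos
  refine ⟨A + 1, fun g m C hg hm a z s x r ha hs hr hsub hsupp hnorm => ?_⟩
  have := hX.secondCountable
  have hgm : AEStronglyMeasurable g μ := (locallyIntegrable_of_ball hg).aestronglyMeasurable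
  set K := ENNReal.ofReal (kCoeff μ lam z s r) with hK
  have hK1 : 1 ≤ K := by
    rw [hK, ENNReal.one_le_ofReal]; exact hlam.one_le_kCoeff z hs r
  have hKt : K ≠ ∞ := ENNReal.ofReal_ne_top
  have hK0 : K ≠ 0 := (one_pos.trans_le hK1).ne'
  set M := μ (ball z (ρ * s)) with hM
  have hMt : M ≠ ∞ := (hlam.measure_ball_lt_top _ _).ne
  have hL1 : ∫⁻ y, ‖a y‖ₑ ∂μ ≤ K⁻¹ := by
    have := eLpNorm_atom_mono (q₂ := 1) (ρ₂ := 1) hlam.measure_ball_lt_top ha hs hsupp hp.le le_rfl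
      hρ.le le_rfl hnorm
    rw [eLpNorm_one_eq_lintegral_enorm] at this
    simpa using this
  have hb1 : ∫⁻ y, ‖a y‖ₑ * ‖g y - m z s‖ₑ ∂μ ≤ A * C := by
    have e1 : ∫⁻ y, ‖a y‖ₑ * ‖g y - m z s‖ₑ ∂μ =
        ∫⁻ y in ball z s, ‖a y‖ₑ * ‖g y - m z s‖ₑ ∂μ := by
      rw [← lintegral_indicator measurableSet_ball]
      refine lintegral_congr_ae ?_
      filter_upwards [hsupp] with y hy
      by_cases hyb : y ∈ ball z s
      · rw [Set.indicator_of_mem hyb]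
      · rw [Set.indicator_of_notMem hyb, hy hyb]; simp
    have e2 := ENNReal.lintegral_mul_le_Lp_mul_Lq (μ.restrict (ball z s)) hpq
      ha.restrict.enorm (hgm.restrict.sub (aestronglyMeasurable_const (b := m z s))).enorm
    have e3 : (∫⁻ y in ball z s, ‖a y‖ₑ ^ p.toReal ∂μ) ^ (1 / p.toReal) ≤ eLpNorm a p μ := by
      rw [eLpNorm_eq_lintegral_rpow_enorm_toReal (one_pos.trans hp).ne' hp'.ne]
      gcongr
      exact Measure.restrict_le_self
    have e4 := hA g m C hg hm z s hs
    have e5 : (p⁻¹).toReal - 1 = -(1 / p') := by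
      rw [ENNReal.toReal_inv, one_div, ← hpq.inv_add_inv_eq_one]; ring
    rw [e1]
    refine e2.trans ((mul_le_mul' (e3.trans hnorm) e4).trans ?_)
    rw [e5]
    rcases eq_or_ne M 0 with h0 | h0
    · rw [← hM, h0, ENNReal.zero_rpow_of_pos (one_div_pos.2 hpq.symm.pos)]
      simp
    · have e6 : M ^ (-(1 / p')) * M ^ (1 / p') = 1 := by
        rw [← ENNReal.rpow_add _ _ h0 hMt]; simp
      calc M ^ (-(1 / p')) * K⁻¹ * (A * C * M ^ (1 / p'))
          = (M ^ (-(1 / p')) * M ^ (1 / p')) * (K⁻¹ * (A * C)) := by ring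
        _ ≤ 1 * (1 * (A * C)) := by
            rw [e6]; gcongr; exact ENNReal.inv_le_one.2 hK1
        _ = _ := by ring
  have hb2 : ‖m z s - m x r‖ₑ ≤ C * K := by
    rw [← Real.enorm_abs, Real.enorm_of_nonneg (abs_nonneg _), hK, ← ENNReal.ofReal_coe_nnreal,
      ← ENNReal.ofReal_mul C.coe_nonneg]
    exact ENNReal.ofReal_le_ofReal (hm.2 z x s r hs hr hsub)
  calc ∫⁻ y, ‖a y‖ₑ * ‖g y - m x r‖ₑ ∂μ
      ≤ ∫⁻ y, (‖a y‖ₑ * ‖g y - m z s‖ₑ + ‖a y‖ₑ * ‖m z s - m x r‖ₑ) ∂μ := by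
        refine lintegral_mono fun y => ?_
        rw [← mul_add, show g y - m x r = (g y - m z s) + (m z s - m x r) by ring]
        gcongr
        exact enorm_add_le _ _
    _ = ∫⁻ y, ‖a y‖ₑ * ‖g y - m z s‖ₑ ∂μ + (∫⁻ y, ‖a y‖ₑ ∂μ) * ‖m z s - m x r‖ₑ := by
        rw [lintegral_add_left', lintegral_mul_const' _ _ enorm_ne_top]
        exact ha.enorm.mul (hgm.sub aestronglyMeasurable_const).enorm
    _ ≤ A * C + K⁻¹ * (C * K) := by gcongr
    _ = _ := by
        rw [mul_comm (C : ℝ≥0∞) K, ← mul_assoc, ENNReal.inv_mul_cancel hK0 hKt]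
        push_cast; ring

end NonHom

namespace NonHom

open Filter Topology

variable {X : Type*} [MetricSpace X] [MeasurableSpace X] {μ : Measure X} {lam : X → ℝ → ℝ}

/-! ### The norm of the atomic Hardy spaces -/

section Sums

variable {α : Type*} [MeasurableSpace α] {ν : Measure α}

/-- An `L¹` sum is dominated almost everywhere by the sum of the absolute values. -/
theorem ae_enorm_le_tsum {f : ℕ → Lp ℝ 1 ν} {b : Lp ℝ 1 ν} (h : HasSum f b) :
    ∀ᵐ y ∂ν, ‖b y‖ₑ ≤ ∑' j, ‖f j y‖ₑ := by
  obtain ⟨ns, -, hns⟩ := (tendstoInMeasure_of_tendsto_Lp h.tendsto_sum_nat).exists_seq_tendsto_ae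
  have hall : ∀ᵐ y ∂ν, ∀ n, (∑ j ∈ Finset.range n, f j : Lp ℝ 1 ν) y =
      ∑ j ∈ Finset.range n, f j y := ae_all_iff.2 fun n => Lp.coeFn_fun_finsetSum _ f
  filter_upwards [hns, hall] with y h1 h2
  refine le_of_tendsto h1.enorm (Eventually.of_forall fun i => ?_)
  rw [h2]
  exact (enorm_sum_le _ _).trans (ENNReal.sum_le_tsum _)

theorem enorm_le_tsum_of_hasSum {E ι : Type*} [NormedAddCommGroup E] {f : ι → E} {b : E}
    (h : HasSum f b) : ‖b‖ₑ ≤ ∑' j, ‖f j‖ₑ := by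
  rw [← h.tsum_eq]; exact enorm_tsum_le_tsum_enorm

theorem summable_of_tsum_enorm_lt_top {E ι : Type*} [NormedAddCommGroup E] [CompleteSpace E]
    {f : ι → E} (h : ∑' j, ‖f j‖ₑ < ∞) : Summable f := by
  refine Summable.of_norm ?_
  exact ENNReal.tsum_coe_ne_top_iff_summable_coe.1 h.ne

end Sums

omit [MetricSpace X] in
theorem SupportedIn.of_hasSum {f : ℕ → Lp ℝ 1 μ} {b : Lp ℝ 1 μ} (h : HasSum f b) {s : Set X}
    (hf : ∀ j, SupportedIn (f j) s) : SupportedIn b s := by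
  filter_upwards [ae_enorm_le_tsum h, ae_all_iff.2 hf] with y h1 h2 hy
  have : ∑' j, ‖f j y‖ₑ = 0 := by simp [h2 _ hy]
  rw [this, nonpos_iff_eq_zero, enorm_eq_zero] at h1
  exact h1

omit [MetricSpace X] in
theorem SupportedIn.smul {b : Lp ℝ 1 μ} {s : Set X} (h : SupportedIn b s) (t : ℝ) :
    SupportedIn (t • b) s := by
  filter_upwards [h, Lp.coeFn_smul t b] with y hy hy' hyn
  rw [hy', Pi.smul_apply, hy hyn, smul_zero]

omit [MetricSpace X] in
theorem SupportedIn.mono {b : Lp ℝ 1 μ} {s t : Set X} (h : SupportedIn b s) (hst : s ⊆ t) :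
    SupportedIn b t := by
  filter_upwards [h] with y hy hyt
  exact hy fun h' => hyt (hst h')

omit [MetricSpace X] in
theorem supportedIn_zero (s : Set X) : SupportedIn (0 : Lp ℝ 1 μ) s := by
  filter_upwards [Lp.coeFn_zero ℝ 1 μ] with y hy _
  simpa using hy

theorem isAtomicBlock_zero [Nonempty X] (μ : Measure X) (lam : X → ℝ → ℝ) (ρ : ℝ) (q : ℝ≥0∞) :
    IsAtomicBlock μ lam ρ q 0 0 := by
  refine ⟨Classical.arbitrary X, 1, one_pos, supportedIn_zero _, ?_, fun _ => 0,
    fun _ => Classical.arbitrary X, fun _ => 1, fun j => ?_, by simp⟩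
  · rw [integral_congr_ae (Lp.coeFn_zero ℝ 1 μ)]; simp
  · refine ⟨one_pos, subset_rfl, supportedIn_zero _, ?_⟩
    rw [eLpNorm_congr_ae (Lp.coeFn_zero ℝ 1 μ)]; simp

theorem mem_hardySpace_iff [Nonempty X] {ρ : ℝ} {q : ℝ≥0∞} {f : Lp ℝ 1 μ} :
    f ∈ hardySpace μ lam ρ q ↔ hardyNorm μ lam ρ q f < ∞ := by
  simp only [hardyNorm, iInf_lt_iff, exists_prop]
  exact Iff.rfl

theorem hardyNorm_le_of_isDecomposition {ρ : ℝ} {q : ℝ≥0∞} {f : Lp ℝ 1 μ} {c : ℕ → ℕ → ℝ}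
    (h : IsDecomposition μ lam ρ q f c) : hardyNorm μ lam ρ q f ≤ ∑' i, ∑' j, ‖c i j‖ₑ :=
  iInf₂_le c h

theorem IsAtomicBlock.hardyNorm_le [Nonempty X] {ρ : ℝ} {q : ℝ≥0∞} {b : Lp ℝ 1 μ} {c : ℕ → ℝ}
    (h : IsAtomicBlock μ lam ρ q b c) : hardyNorm μ lam ρ q b ≤ ∑' j, ‖c j‖ₑ := by
  have hd : IsDecomposition μ lam ρ q b (fun i => if i = 0 then c else 0) := by
    refine ⟨fun i => if i = 0 then b else 0, fun i => ?_, ?_⟩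
    · by_cases hi : i = 0
      · simpa [hi] using h
      · simpa [hi] using isAtomicBlock_zero μ lam ρ q
    · exact hasSum_ite_eq 0 b
  refine (hardyNorm_le_of_isDecomposition hd).trans (le_of_eq ?_)
  rw [tsum_eq_single 0]
  · simp
  · intro i hi; simp [hi]

/-- A function of integral zero that is the sum of multiples of atoms, with a bound of its norm. -/
theorem hardyNorm_le_of_hasSum_atoms [Nonempty X] {ρ : ℝ} {q : ℝ≥0∞} (hq : q ≠ 0) {b : Lp ℝ 1 μ}
    {x : X} {r : ℝ} (hr : 0 < r) {e : ℕ → Lp ℝ 1 μ} {z : ℕ → X} {s : ℕ → ℝ} (t : ℕ → ℝ≥0)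
    (hs : ∀ j, 0 < s j) (hsub : ∀ j, ball (z j) (s j) ⊆ ball x r)
    (hsupp : ∀ j, SupportedIn (e j) (ball (z j) (s j)))
    (he : ∀ j, eLpNorm (e j) q μ ≤ t j * (μ (ball (z j) (ρ * s j)) ^ ((q⁻¹).toReal - 1) *
      (ENNReal.ofReal (kCoeff μ lam (z j) (s j) r))⁻¹))
    (hsum : HasSum e b) (hint : ∫ y, b y ∂μ = 0) :
    hardyNorm μ lam ρ q b ≤ ∑' j, (t j : ℝ≥0∞) := by
  have hblock : IsAtomicBlock μ lam ρ q b (fun j => t j) := by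
    refine ⟨x, r, hr, SupportedIn.of_hasSum hsum fun j => (hsupp j).mono (hsub j), hint,
      fun j => (t j : ℝ)⁻¹ • e j, z, s, fun j => ⟨hs j, hsub j, (hsupp j).smul _, ?_⟩, ?_⟩
    · rw [eLpNorm_congr_ae (Lp.coeFn_smul _ (e j)), eLpNorm_const_smul]
      rcases eq_or_ne (t j) 0 with h0 | h0
      · simp [h0]
      · have h1 : ‖(t j : ℝ)⁻¹‖ₑ = (t j : ℝ≥0∞)⁻¹ := by
          rw [enorm_inv (by exact_mod_cast h0), Real.enorm_of_nonneg (t j).coe_nonneg,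
            ENNReal.ofReal_coe_nnreal]
        rw [h1]
        calc _ ≤ _ := mul_le_mul_right (he j) _
          _ = _ := by
            rw [← mul_assoc, ENNReal.inv_mul_cancel (by exact_mod_cast h0) ENNReal.coe_ne_top,
              one_mul]
    · convert! hsum using 2 with j
      simp only
      -- For `t j = 0` the rescaled atom is 0, and nothing is lost because the bound then forces `e
      -- j = 0`.
      rcases eq_or_ne (t j) 0 with h0 | h0
      · have h1 := he j
        rw [h0, ENNReal.coe_zero, zero_mul, nonpos_iff_eq_zero,
          eLpNorm_eq_zero_iff (Lp.aestronglyMeasurable _) hq] at h1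
        rw [h0, (Lp.eq_zero_iff_ae_eq_zero (f := e j)).2 h1]
        simp
      · rw [smul_smul, mul_inv_cancel₀ (by exact_mod_cast h0), one_smul]
  refine hblock.hardyNorm_le.trans (le_of_eq ?_)
  congr 1 with j
  rw [Real.enorm_of_nonneg (t j).coe_nonneg, ENNReal.ofReal_coe_nnreal]

theorem hardyNorm_smul_le {ρ : ℝ} {q : ℝ≥0∞} (t : ℝ) {f : Lp ℝ 1 μ}
    (hf : hardyNorm μ lam ρ q f < ∞) :
    hardyNorm μ lam ρ q (t • f) ≤ ‖t‖ₑ * hardyNorm μ lam ρ q f := by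
  refine ENNReal.le_of_forall_pos_le_add fun ε hε _ => ?_
  have hlt : hardyNorm μ lam ρ q f < hardyNorm μ lam ρ q f + ε / (‖t‖₊ + 1 : ℝ≥0) :=
    ENNReal.lt_add_right hf.ne
      (ENNReal.div_pos (by exact_mod_cast hε.ne') ENNReal.coe_ne_top).ne'
  obtain ⟨c, hc, hclt⟩ : ∃ c, IsDecomposition μ lam ρ q f c ∧ ∑' i, ∑' j, ‖c i j‖ₑ <
      hardyNorm μ lam ρ q f + ε / (‖t‖₊ + 1 : ℝ≥0) := by
    simpa only [hardyNorm, iInf_lt_iff, exists_prop] using hlt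
  obtain ⟨b, hb, hbs⟩ := hc
  have hd : IsDecomposition μ lam ρ q (t • f) (fun i j => t * c i j) := by
    refine ⟨fun i => t • b i, fun i => ?_, hbs.const_smul t⟩
    obtain ⟨x, r, hr, hsupp, hint, a, z, s, ha, hs⟩ := hb i
    refine ⟨x, r, hr, hsupp.smul t, ?_, a, z, s, ha, ?_⟩
    · rw [integral_congr_ae (Lp.coeFn_smul t (b i))]
      simp only [Pi.smul_apply]
      rw [integral_smul, hint, smul_zero]
    · simpa only [smul_smul] using hs.const_smul t
  calc hardyNorm μ lam ρ q (t • f) ≤ ∑' i, ∑' j, ‖t * c i j‖ₑ := hardyNorm_le_of_isDecomposition hd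
    _ = ‖t‖ₑ * ∑' i, ∑' j, ‖c i j‖ₑ := by simp only [enorm_mul, ENNReal.tsum_mul_left]
    _ ≤ ‖t‖ₑ * (hardyNorm μ lam ρ q f + ε / (‖t‖₊ + 1 : ℝ≥0)) := by gcongr
    _ = ‖t‖ₑ * hardyNorm μ lam ρ q f + ‖t‖ₑ * (ε / (‖t‖₊ + 1 : ℝ≥0)) := mul_add _ _ _
    _ ≤ _ := by
      gcongr
      rw [mul_div_assoc']
      refine ENNReal.div_le_of_le_mul ?_
      rw [mul_comm]
      gcongr
      exact ENNReal.coe_le_coe.2 le_self_add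

variable [BorelSpace X]

theorem IsAtomicBlock.mono (hfin : ∀ x r, μ (ball x r) < ∞) {q₁ q₂ : ℝ≥0∞} (hq : q₂ ≤ q₁)
    (hq₂ : 1 ≤ q₂) {ρ₁ ρ₂ : ℝ} (hρ : ρ₂ ≤ ρ₁) (hρ₂ : 1 ≤ ρ₂) {b : Lp ℝ 1 μ} {c : ℕ → ℝ}
    (h : IsAtomicBlock μ lam ρ₁ q₁ b c) : IsAtomicBlock μ lam ρ₂ q₂ b c := by
  obtain ⟨x, r, hr, hsupp, hint, a, z, s, ha, hs⟩ := h
  refine ⟨x, r, hr, hsupp, hint, a, z, s, fun j => ?_, hs⟩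
  obtain ⟨h1, h2, h3, h4⟩ := ha j
  exact ⟨h1, h2, h3, eLpNorm_atom_mono hfin (Lp.aestronglyMeasurable _) h1 h3 hq hq₂ hρ hρ₂ h4⟩

theorem hardyNorm_mono (hfin : ∀ x r, μ (ball x r) < ∞) {q₁ q₂ : ℝ≥0∞} (hq : q₂ ≤ q₁)
    (hq₂ : 1 ≤ q₂) {ρ₁ ρ₂ : ℝ} (hρ : ρ₂ ≤ ρ₁) (hρ₂ : 1 ≤ ρ₂) (f : Lp ℝ 1 μ) :
    hardyNorm μ lam ρ₂ q₂ f ≤ hardyNorm μ lam ρ₁ q₁ f := by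
  refine le_iInf₂ fun c hc => iInf₂_le c ?_
  obtain ⟨b, hb, hbs⟩ := hc
  exact ⟨b, fun i => (hb i).mono hfin hq hq₂ hρ hρ₂, hbs⟩

theorem IsDominating.enorm_atom_le (hlam : IsDominating μ lam) {ρ : ℝ} (hρ : 1 ≤ ρ) {q : ℝ≥0∞}
    (hq : 1 ≤ q) {a : Lp ℝ 1 μ} {z : X} {s r : ℝ} (hs : 0 < s) (hsupp : SupportedIn a (ball z s))
    (h : eLpNorm a q μ ≤ μ (ball z (ρ * s)) ^ ((q⁻¹).toReal - 1) *
      (ENNReal.ofReal (kCoeff μ lam z s r))⁻¹) : ‖a‖ₑ ≤ 1 := by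
  have h1 := eLpNorm_atom_mono (q₂ := 1) (ρ₂ := 1) hlam.measure_ball_lt_top
    (Lp.aestronglyMeasurable a) hs hsupp hq le_rfl hρ le_rfl h
  rw [Lp.enorm_def]
  refine h1.trans ?_
  have : 1 ≤ ENNReal.ofReal (kCoeff μ lam z s r) :=
    ENNReal.one_le_ofReal.2 (hlam.one_le_kCoeff z hs r)
  simpa using this

theorem IsDominating.enorm_block_le (hlam : IsDominating μ lam) {ρ : ℝ} (hρ : 1 ≤ ρ) {q : ℝ≥0∞}
    (hq : 1 ≤ q) {b : Lp ℝ 1 μ} {c : ℕ → ℝ} (h : IsAtomicBlock μ lam ρ q b c) :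
    ‖b‖ₑ ≤ ∑' j, ‖c j‖ₑ := by
  obtain ⟨x, r, hr, hsupp, hint, a, z, s, ha, hs⟩ := h
  refine (enorm_le_tsum_of_hasSum hs).trans (ENNReal.tsum_le_tsum fun j => ?_)
  obtain ⟨h1, h2, h3, h4⟩ := ha j
  rw [enorm_smul]
  exact mul_le_of_le_one_right zero_le (hlam.enorm_atom_le hρ hq h1 h3 h4)

/-- Atoms have `L¹` norm at most 1 by Hölder's inequality and `K ≥ 1`. So summability of Hardy norms
implies convergence in `L¹`. -/
theorem IsDominating.enorm_le_hardyNorm (hlam : IsDominating μ lam) {ρ : ℝ} (hρ : 1 ≤ ρ)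
    {q : ℝ≥0∞} (hq : 1 ≤ q) (f : Lp ℝ 1 μ) : ‖f‖ₑ ≤ hardyNorm μ lam ρ q f := by
  refine le_iInf₂ fun c hc => ?_
  obtain ⟨b, hb, hbs⟩ := hc
  exact (enorm_le_tsum_of_hasSum hbs).trans
    (ENNReal.tsum_le_tsum fun i => hlam.enorm_block_le hρ hq (hb i))

/-- Countable subadditivity of the Hardy norm. -/
theorem IsDominating.hardyNorm_le_tsum (hlam : IsDominating μ lam) {ρ : ℝ} (hρ : 1 ≤ ρ)
    {q : ℝ≥0∞} (hq : 1 ≤ q) {f : ℕ → Lp ℝ 1 μ} {F : Lp ℝ 1 μ} (h : HasSum f F) :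
    hardyNorm μ lam ρ q F ≤ ∑' k, hardyNorm μ lam ρ q (f k) := by
  refine ENNReal.le_of_forall_pos_le_add fun ε hε hfin => ?_
  obtain ⟨ε', hε', hεsum⟩ := ENNReal.exists_pos_sum_of_countable
    (ENNReal.coe_pos.2 hε).ne' ℕ
  have hk : ∀ k, ∃ c, IsDecomposition μ lam ρ q (f k) c ∧ ∑' i, ∑' j, ‖c i j‖ₑ <
      hardyNorm μ lam ρ q (f k) + ε' k := by
    intro k
    have : hardyNorm μ lam ρ q (f k) < hardyNorm μ lam ρ q (f k) + ε' k :=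
      ENNReal.lt_add_right ((ENNReal.le_tsum k).trans_lt hfin).ne
        (ENNReal.coe_pos.2 (hε' k)).ne'
    simpa only [hardyNorm, iInf_lt_iff, exists_prop] using this
  choose c hc hclt using hk
  choose b hb hbs using hc
  have htot : ∑' p : ℕ × ℕ, ∑' j, ‖c p.1 p.2 j‖ₑ ≤ ∑' k, hardyNorm μ lam ρ q (f k) + ε := by
    rw [ENNReal.tsum_prod (f := fun k i => ∑' j, ‖c k i j‖ₑ)]
    calc _ ≤ ∑' k, (hardyNorm μ lam ρ q (f k) + ε' k) := ENNReal.tsum_le_tsum fun k => (hclt k).le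
      _ = _ := ENNReal.tsum_add
      _ ≤ _ := by gcongr
  have hsummable : Summable fun p : ℕ × ℕ => b p.1 p.2 := by
    refine summable_of_tsum_enorm_lt_top (lt_of_le_of_lt ?_
      (htot.trans_lt (ENNReal.add_lt_top.2 ⟨hfin, ENNReal.coe_lt_top⟩)))
    exact ENNReal.tsum_le_tsum fun p => hlam.enorm_block_le hρ hq (hb p.1 p.2)
  -- The double family of blocks is absolutely summable in `L¹`, so it may be summed in any order
  -- and re-enumerated as one sequence of blocks.
  have hF : HasSum (fun p : ℕ × ℕ => b p.1 p.2) F := by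
    have h1 := hsummable.hasSum.prod_fiberwise fun k => hbs k
    rw [← h1.unique h]
    exact hsummable.hasSum
  obtain ⟨E⟩ : Nonempty (ℕ ≃ ℕ × ℕ) := ⟨Nat.pairEquiv.symm⟩
  have hd : IsDecomposition μ lam ρ q F fun n => c (E n).1 (E n).2 :=
    ⟨fun n => b (E n).1 (E n).2, fun n => hb _ _, E.hasSum_iff.2 hF⟩
  refine (hardyNorm_le_of_isDecomposition hd).trans ?_
  rw [E.tsum_eq (fun p : ℕ × ℕ => ∑' j, ‖c p.1 p.2 j‖ₑ)]
  exact htot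

omit [BorelSpace X] in
theorem hardyNorm_zero [Nonempty X] {ρ : ℝ} {q : ℝ≥0∞} :
    hardyNorm μ lam ρ q (0 : Lp ℝ 1 μ) = 0 :=
  nonpos_iff_eq_zero.1 ((isAtomicBlock_zero μ lam ρ q).hardyNorm_le.trans (by simp))

theorem IsDominating.hardyNorm_add_le [Nonempty X] (hlam : IsDominating μ lam) {ρ : ℝ} (hρ : 1 ≤ ρ)
    {q : ℝ≥0∞} (hq : 1 ≤ q) (f g : Lp ℝ 1 μ) :
    hardyNorm μ lam ρ q (f + g) ≤ hardyNorm μ lam ρ q f + hardyNorm μ lam ρ q g := by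
  have h : HasSum (fun n : ℕ => if n = 0 then f else if n = 1 then g else 0) (f + g) := by
    have := hasSum_sum_of_ne_finset_zero (s := Finset.range 2) (L := .unconditional ℕ)
      (f := fun n : ℕ => if n = 0 then f else if n = 1 then g else 0) (fun n hn => by
        have : ¬ n < 2 := by simpa using hn
        rw [if_neg (by omega), if_neg (by omega)])
    simpa [Finset.sum_range_succ] using this
  refine (hlam.hardyNorm_le_tsum hρ hq h).trans (le_of_eq ?_)
  rw [tsum_eq_sum (s := Finset.range 2) (fun n hn => by
    have : ¬ n < 2 := by simpa using hn
    rw [if_neg (by omega), if_neg (by omega), hardyNorm_zero])]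
  simp [Finset.sum_range_succ]

/-- The norm of the atomic Hardy space as a seminorm. -/
noncomputable def hardySeminorm [Nonempty X] (hlam : IsDominating μ lam) {ρ : ℝ} (hρ : 1 ≤ ρ)
    {q : ℝ≥0∞} (hq : 1 ≤ q) : Seminorm ℝ (hardySpace μ lam ρ q) :=
  Seminorm.ofSMulLE (fun f => (hardyNorm μ lam ρ q (f : Lp ℝ 1 μ)).toReal)
    (by simp [hardyNorm_zero])
    (fun f g => by
      have hf := mem_hardySpace_iff.1 f.2
      have hg := mem_hardySpace_iff.1 g.2
      rw [← ENNReal.toReal_add hf.ne hg.ne]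
      exact ENNReal.toReal_mono (ENNReal.add_ne_top.2 ⟨hf.ne, hg.ne⟩)
        (hlam.hardyNorm_add_le hρ hq _ _))
    (fun t f => by
      have hf := mem_hardySpace_iff.1 f.2
      have := ENNReal.toReal_mono (ENNReal.mul_ne_top enorm_ne_top hf.ne) (hardyNorm_smul_le t hf)
      rwa [ENNReal.toReal_mul, toReal_enorm] at this)

theorem hardySeminorm_apply [Nonempty X] (hlam : IsDominating μ lam) {ρ : ℝ} (hρ : 1 ≤ ρ)
    {q : ℝ≥0∞} (hq : 1 ≤ q) (f : hardySpace μ lam ρ q) :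
    hardySeminorm hlam hρ hq f = (hardyNorm μ lam ρ q (f : Lp ℝ 1 μ)).toReal := rfl

/-- A bounded functional is bounded by its dual norm. -/
theorem IsDominating.abs_apply_le_dualNorm [Nonempty X] (hlam : IsDominating μ lam) {ρ : ℝ}
    (hρ : 1 ≤ ρ) {q : ℝ≥0∞} (hq : 1 ≤ q) {L : hardySpace μ lam ρ q →ₗ[ℝ] ℝ} (hL : dualNorm L < ∞)
    (f : hardySpace μ lam ρ q) : |L f| ≤ (dualNorm L).toReal * hardySeminorm hlam hρ hq f := by
  have hf := mem_hardySpace_iff.1 f.2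
  set D := (dualNorm L).toReal
  have hD : 0 ≤ D := ENNReal.toReal_nonneg
  have hn : 0 ≤ hardySeminorm hlam hρ hq f := apply_nonneg _ _
  refine le_of_forall_pos_le_add fun δ hδ => ?_
  -- The positive addition allows normalization even where the seminorm vanishes.
  set t := hardySeminorm hlam hρ hq f + δ / (D + 1) with ht
  have ht0 : 0 < t := by positivity
  have h1 : hardySeminorm hlam hρ hq (t⁻¹ • f) ≤ 1 := by
    rw [map_smul_eq_mul, Real.norm_of_nonneg (by positivity), inv_mul_le_iff₀ ht0, mul_one]
    exact le_add_of_nonneg_right (by positivity)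
  have h2 : hardyNorm μ lam ρ q ((t⁻¹ • f : hardySpace μ lam ρ q) : Lp ℝ 1 μ) ≤ 1 := by
    rw [hardySeminorm_apply] at h1
    rw [← ENNReal.ofReal_toReal (mem_hardySpace_iff.1 (t⁻¹ • f).2).ne]
    exact ENNReal.ofReal_le_one.2 h1
  have h3 : ‖L (t⁻¹ • f)‖ₑ ≤ dualNorm L := le_iSup₂ (f := fun f _ => ‖L f‖ₑ) (t⁻¹ • f) h2
  have h4 := ENNReal.toReal_mono hL.ne h3
  rw [toReal_enorm, map_smul, norm_smul, Real.norm_of_nonneg (by positivity), inv_mul_le_iff₀ ht0,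
    Real.norm_eq_abs] at h4
  refine h4.trans ?_
  have h5 : D * (δ / (D + 1)) ≤ δ := by
    rw [mul_div_assoc', div_le_iff₀ (by positivity)]
    nlinarith
  calc t * D = D * hardySeminorm hlam hρ hq f + D * (δ / (D + 1)) := by rw [ht]; ring
    _ ≤ _ := by gcongr

theorem IsDominating.dualNorm_le [Nonempty X] (hlam : IsDominating μ lam) {ρ : ℝ}
    (hρ : 1 ≤ ρ) {q : ℝ≥0∞} (hq : 1 ≤ q) {L : hardySpace μ lam ρ q →ₗ[ℝ] ℝ} {C : ℝ≥0}
    (h : ∀ f, |L f| ≤ C * hardySeminorm hlam hρ hq f) : dualNorm L ≤ C := by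
  refine iSup₂_le fun f hf => enorm_le_coe_of_abs_le ((h f).trans ?_)
  refine mul_le_of_le_one_right C.coe_nonneg ?_
  rw [hardySeminorm_apply]
  simpa using ENNReal.toReal_mono ENNReal.one_ne_top hf

end NonHom

namespace NonHom

open Filter Topology

variable {X : Type*} [MetricSpace X] [MeasurableSpace X] {μ : Measure X} {lam : X → ℝ → ℝ}

/-! ### Truncation -/

/-- The truncation of a real number to `[-k, k]`. -/
def trunc (k : ℕ) (t : ℝ) : ℝ := max (-(k : ℝ)) (min k t)

theorem abs_trunc_sub_trunc_le (k : ℕ) (s t : ℝ) : |trunc k s - trunc k t| ≤ |s - t| := by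
  refine (abs_max_sub_max_le_max _ _ _ _).trans ?_
  rw [sub_self, abs_zero, max_eq_right (abs_nonneg _)]
  refine (abs_min_sub_min_le_max _ _ _ _).trans ?_
  rw [sub_self, abs_zero, max_eq_right (abs_nonneg _)]

theorem abs_trunc_le (k : ℕ) (t : ℝ) : |trunc k t| ≤ k := by
  rw [abs_le]
  exact ⟨le_max_left _ _, max_le (by linarith [k.cast_nonneg (α := ℝ)]) (min_le_left _ _)⟩

theorem trunc_of_abs_le {k : ℕ} {t : ℝ} (h : |t| ≤ k) : trunc k t = t := by
  rw [abs_le] at h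
  rw [trunc, min_eq_right h.2, max_eq_right h.1]

theorem abs_trunc_le_abs (k : ℕ) (t : ℝ) : |trunc k t| ≤ |t| := by
  have h0 : trunc k 0 = 0 := trunc_of_abs_le (by simp)
  simpa [h0] using abs_trunc_sub_trunc_le k t 0

theorem continuous_trunc (k : ℕ) : Continuous (trunc k) := by unfold trunc; fun_prop

theorem tendsto_trunc (t : ℝ) : Tendsto (fun k => trunc k t) atTop (𝓝 t) := by
  obtain ⟨n, hn⟩ := exists_nat_ge |t|
  refine tendsto_const_nhds.congr' ?_
  filter_upwards [eventually_ge_atTop n] with k hk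
  exact (trunc_of_abs_le (hn.trans (by exact_mod_cast hk))).symm

/-- Truncation is 1-Lipschitz, so it preserves the constant once the numbers are truncated too. The
bounds on pairings are thereby uniform in `k`, while bounded functions can be integrated against all
of `L¹`. -/
theorem OscBound.trunc {σ : ℝ} {g : X → ℝ} {m : X → ℝ → ℝ} {C : ℝ≥0}
    (h : OscBound μ lam σ g m C) (k : ℕ) :
    OscBound μ lam σ (fun y => trunc k (g y)) (fun x r => NonHom.trunc k (m x r)) C := by
  refine ⟨fun x r hr => (lintegral_mono fun y => ?_).trans (h.1 x r hr), fun x y r s hr hs hsub =>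
    (abs_trunc_sub_trunc_le k _ _).trans (h.2 x y r s hr hs hsub)⟩
  rw [enorm_le_iff_norm_le]
  exact abs_trunc_sub_trunc_le k _ _

omit [MetricSpace X] in
theorem tendsto_integral_mul_trunc {f g : X → ℝ} (hf : AEStronglyMeasurable f μ)
    (hg : AEStronglyMeasurable g μ) (hfg : Integrable (fun y => f y * g y) μ) :
    Tendsto (fun k => ∫ y, f y * trunc k (g y) ∂μ) atTop (𝓝 (∫ y, f y * g y ∂μ)) := by
  refine tendsto_integral_of_dominated_convergence (fun y => ‖f y * g y‖)
    (fun k => hf.mul ((continuous_trunc k).comp_aestronglyMeasurable hg)) hfg.norm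
    (fun k => ae_of_all _ fun y => ?_) (ae_of_all _ fun y => (tendsto_trunc _).const_mul _)
  rw [norm_mul, norm_mul]
  exact mul_le_mul_of_nonneg_left (abs_trunc_le_abs k _) (norm_nonneg _)

omit [MetricSpace X] in
theorem integrable_mul_of_bounded (f : Lp ℝ 1 μ) {φ : X → ℝ} (hφ : AEStronglyMeasurable φ μ)
    {M : ℝ} (hM : ∀ y, |φ y| ≤ M) : Integrable (fun y => f y * φ y) μ :=
  (L1.integrable_coeFn f).mul_bdd hφ (ae_of_all _ hM)

/-- Integration of `L¹` functions against a bounded function. -/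
noncomputable def integralAgainst {φ : X → ℝ} (hφ : AEStronglyMeasurable φ μ)
    {M : ℝ} (hM : ∀ y, |φ y| ≤ M) : Lp ℝ 1 μ →L[ℝ] ℝ :=
  LinearMap.mkContinuous
    { toFun := fun f => ∫ y, f y * φ y ∂μ
      map_add' := fun f g => by
        rw [← integral_add (integrable_mul_of_bounded f hφ hM) (integrable_mul_of_bounded g hφ hM)]
        refine integral_congr_ae ?_
        filter_upwards [Lp.coeFn_add f g] with y hy
        rw [hy, Pi.add_apply, add_mul]
      map_smul' := fun t f => by
        rw [RingHom.id_apply, smul_eq_mul, ← integral_const_mul]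
        refine integral_congr_ae ?_
        filter_upwards [Lp.coeFn_smul t f] with y hy
        rw [hy, Pi.smul_apply, smul_eq_mul, mul_assoc] } M fun f => by
    simp only [LinearMap.coe_mk, AddHom.coe_mk]
    calc ‖∫ y, f y * φ y ∂μ‖ ≤ ∫ y, ‖f y * φ y‖ ∂μ := norm_integral_le_integral_norm _
      _ ≤ ∫ y, M * ‖f y‖ ∂μ := by
        refine integral_mono (integrable_mul_of_bounded f hφ hM).norm
          ((L1.integrable_coeFn f).norm.const_mul M) fun y => ?_
        simp only [norm_mul]
        rw [mul_comm]
        exact mul_le_mul_of_nonneg_right (hM y) (norm_nonneg _)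
      _ = M * ‖f‖ := by rw [integral_const_mul, L1.norm_eq_integral_norm]

theorem exists_isDecomposition_lt {ρ : ℝ} {q : ℝ≥0∞} {f : Lp ℝ 1 μ} {D : ℝ≥0∞}
    (h : hardyNorm μ lam ρ q f < D) :
    ∃ c, IsDecomposition μ lam ρ q f c ∧ ∑' i, ∑' j, ‖c i j‖ₑ < D := by
  simpa only [hardyNorm, iInf_lt_iff, exists_prop] using h

theorem hasSum_toReal_tsum_enorm {c : ℕ → ℕ → ℝ} (hc : ∑' i, ∑' j, ‖c i j‖ₑ < ∞) :
    HasSum (fun i => (∑' j, ‖c i j‖ₑ).toReal) (∑' i, ∑' j, ‖c i j‖ₑ).toReal := by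
  rw [ENNReal.tsum_toReal_eq fun i => ((ENNReal.le_tsum i).trans_lt hc).ne]
  exact (ENNReal.summable_toReal hc.ne).hasSum

variable [BorelSpace X]

/-! ### RBMO functions as functionals -/

/-- The block has integral zero, so `g` may be replaced by `g - m x r`, with `B(x, r)` the ball of
the block; then the atoms are estimated one by one. -/
theorem IsDominating.exists_block_pairing (hX : GeometricallyDoubling X)
    (hlam : IsDominating μ lam) (σ ρ : ℝ) (hσ : 1 < σ) (hρ : 1 < ρ) (p : ℝ≥0∞) (hp : 1 < p)
    (hp' : p < ∞) :
    ∃ A : ℝ≥0, ∀ g m C, (∀ x r, IntegrableOn g (ball x r) μ) → OscBound μ lam σ g m C →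
      ∀ b c, IsAtomicBlock μ lam ρ p b c → ∑' j, ‖c j‖ₑ < ∞ →
        Integrable (fun y => b y * g y) μ ∧
        |∫ y, b y * g y ∂μ| ≤ A * C * (∑' j, ‖c j‖ₑ).toReal := by
  obtain ⟨A, hA⟩ := hlam.exists_lintegral_atom_le hX σ ρ hσ hρ p hp hp'
  refine ⟨A, fun g m C hg hm b c hb hc => ?_⟩
  have := hX.secondCountable
  have hgm : AEStronglyMeasurable g μ := (locallyIntegrable_of_ball hg).aestronglyMeasurable
  obtain ⟨x, r, hr, hsupp, hint, a, z, s, ha, hs⟩ := hb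
  have hcoe : ∀ᵐ y ∂μ, ∀ j, (c j • a j : Lp ℝ 1 μ) y = c j * a j y :=
    ae_all_iff.2 fun j => Lp.coeFn_smul (c j) (a j)
  have hsubm : AEStronglyMeasurable (fun y => g y - m x r) μ := hgm.sub aestronglyMeasurable_const
  have hle : ∫⁻ y, ‖b y * (g y - m x r)‖ₑ ∂μ ≤ A * C * ∑' j, ‖c j‖ₑ := by
    calc ∫⁻ y, ‖b y * (g y - m x r)‖ₑ ∂μ
        ≤ ∫⁻ y, ∑' j, ‖c j‖ₑ * (‖a j y‖ₑ * ‖g y - m x r‖ₑ) ∂μ := by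
          refine lintegral_mono_ae ?_
          filter_upwards [ae_enorm_le_tsum hs, hcoe] with y h1 h2
          rw [enorm_mul]
          calc ‖b y‖ₑ * ‖g y - m x r‖ₑ ≤ (∑' j, ‖(c j • a j : Lp ℝ 1 μ) y‖ₑ) * ‖g y - m x r‖ₑ := by
                gcongr
            _ = _ := by
                rw [← ENNReal.tsum_mul_right]
                simp_rw [h2, enorm_mul, mul_assoc]
      _ = ∑' j, ∫⁻ y, ‖c j‖ₑ * (‖a j y‖ₑ * ‖g y - m x r‖ₑ) ∂μ :=
          lintegral_tsum fun j => ((Lp.aestronglyMeasurable (a j)).enorm.mul hsubm.enorm).const_mul _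
      _ ≤ ∑' j, ‖c j‖ₑ * (A * C) := by
          refine ENNReal.tsum_le_tsum fun j => ?_
          obtain ⟨h1, h2, h3, h4⟩ := ha j
          rw [lintegral_const_mul' _ _ enorm_ne_top]
          gcongr
          exact hA g m C hg hm (a j) (z j) (s j) x r (Lp.aestronglyMeasurable _) h1 hr h2 h3 h4
      _ = _ := by rw [ENNReal.tsum_mul_right, mul_comm]
  have hfin : A * C * ∑' j, ‖c j‖ₑ < ∞ :=
    ENNReal.mul_lt_top (ENNReal.mul_lt_top ENNReal.coe_lt_top ENNReal.coe_lt_top) hc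
  have hi1 : Integrable (fun y => b y * (g y - m x r)) μ :=
    ⟨(Lp.aestronglyMeasurable b).mul hsubm, hle.trans_lt hfin⟩
  have hi2 : Integrable (fun y => b y * m x r) μ := (L1.integrable_coeFn b).mul_const _
  have hsplit : ∀ y, b y * g y = b y * (g y - m x r) + b y * m x r := fun y => by ring
  refine ⟨by simp_rw [hsplit]; exact hi1.add hi2, ?_⟩
  have heq : ∫ y, b y * g y ∂μ = ∫ y, b y * (g y - m x r) ∂μ := by
    simp_rw [hsplit]
    rw [integral_add hi1 hi2, integral_mul_const, hint, zero_mul, add_zero]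
  rw [heq]
  have h5 := (enorm_integral_le_lintegral_enorm _).trans hle
  have h6 := ENNReal.toReal_mono hfin.ne h5
  rwa [toReal_enorm, ENNReal.toReal_mul, ENNReal.toReal_mul, ENNReal.coe_toReal,
    ENNReal.coe_toReal] at h6

/-- The functional is the limit of the integrals of `f` against the truncations of `g`. This limit
refers to `f` alone, so it does not depend on a decomposition and is linear; a decomposition serves
only to prove existence and the bound. -/
theorem IsDominating.exists_functional [Nonempty X] (hX : GeometricallyDoubling X)
    (hlam : IsDominating μ lam) (σ ρ : ℝ) (hσ : 1 < σ) (hρ : 1 < ρ) (p : ℝ≥0∞) (hp : 1 < p)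
    (hp' : p < ∞) :
    ∃ A : ℝ≥0, ∀ g m C, (∀ x r, IntegrableOn g (ball x r) μ) → OscBound μ lam σ g m C →
      ∃ L : hardySpace μ lam ρ p →ₗ[ℝ] ℝ,
        (∀ f, |L f| ≤ A * C * hardySeminorm hlam hρ.le hp.le f) ∧ IsIntegrationAgainst g L := by
  obtain ⟨A, hA⟩ := hlam.exists_block_pairing hX σ ρ hσ hρ p hp hp'
  refine ⟨A, fun g m C hg hm => ?_⟩
  have := hX.secondCountable
  have hgm : AEStronglyMeasurable g μ := (locallyIntegrable_of_ball hg).aestronglyMeasurable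
  have htm : ∀ k, AEStronglyMeasurable (fun y => trunc k (g y)) μ := fun k =>
    (continuous_trunc k).comp_aestronglyMeasurable hgm
  have htb : ∀ k y, |trunc k (g y)| ≤ k := fun k y => abs_trunc_le k _
  have htl : ∀ k x r, IntegrableOn (fun y => trunc k (g y)) (ball x r) μ := fun k x r =>
    Integrable.mono (hg x r) (htm k).restrict (ae_of_all _ fun y => abs_trunc_le_abs k _)
  have hlim : ∀ (f : Lp ℝ 1 μ) c, IsDecomposition μ lam ρ p f c → ∑' i, ∑' j, ‖c i j‖ₑ < ∞ →
      ∃ l, Tendsto (fun k => ∫ y, f y * trunc k (g y) ∂μ) atTop (𝓝 l) ∧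
        |l| ≤ A * C * (∑' i, ∑' j, ‖c i j‖ₑ).toReal := by
    rintro f c ⟨b, hb, hbs⟩ hc
    have hci : ∀ i, ∑' j, ‖c i j‖ₑ < ∞ := fun i => (ENNReal.le_tsum i).trans_lt hc
    have hsum := (hasSum_toReal_tsum_enorm hc).mul_left (A * C : ℝ)
    have h1 : ∀ k, ∫ y, f y * trunc k (g y) ∂μ = ∑' i, ∫ y, b i y * trunc k (g y) ∂μ := fun k =>
      ((integralAgainst (htm k) (htb k)).hasSum hbs).tsum_eq.symm
    have h2 : Tendsto (fun k => ∑' i, ∫ y, b i y * trunc k (g y) ∂μ) atTop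
        (𝓝 (∑' i, ∫ y, b i y * g y ∂μ)) := by
      -- The bound for the pairing with each block is the same for all truncations and is summable
      -- over the blocks.
      refine tendsto_tsum_of_dominated_convergence hsum.summable (fun i =>
        tendsto_integral_mul_trunc (Lp.aestronglyMeasurable _) hgm
          (hA g m C hg hm _ _ (hb i) (hci i)).1) (Eventually.of_forall fun k i => ?_)
      exact (hA _ _ C (htl k) (hm.trunc k) _ _ (hb i) (hci i)).2
    refine ⟨_, by simpa only [h1] using h2, ?_⟩
    rw [← hsum.tsum_eq, ← Real.norm_eq_abs]
    exact tsum_of_norm_bounded hsum.summable.hasSum fun i =>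
      (hA g m C hg hm _ _ (hb i) (hci i)).2
  have hex : ∀ f : hardySpace μ lam ρ p, ∃ l,
      Tendsto (fun k => ∫ y, (f : Lp ℝ 1 μ) y * trunc k (g y) ∂μ) atTop (𝓝 l) := by
    rintro ⟨f, c, hd, hc⟩
    obtain ⟨l, hl, -⟩ := hlim f c hd hc
    exact ⟨l, hl⟩
  choose l hl using hex
  let L : hardySpace μ lam ρ p →ₗ[ℝ] ℝ :=
    { toFun := l
      map_add' := fun f f' => by
        refine tendsto_nhds_unique (hl (f + f')) (((hl f).add (hl f')).congr fun k => ?_)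
        exact ((integralAgainst (htm k) (htb k)).map_add (f : Lp ℝ 1 μ) f').symm
      map_smul' := fun t f => by
        refine tendsto_nhds_unique (hl (t • f)) (((hl f).const_mul t).congr fun k => ?_)
        exact ((integralAgainst (htm k) (htb k)).map_smul t (f : Lp ℝ 1 μ)).symm }
  refine ⟨L, fun f => ?_, fun f hf => ?_⟩
  · have hfin := mem_hardySpace_iff.1 f.2
    set D : ℝ := A * C with hD
    have hD0 : 0 ≤ D := by positivity
    refine le_of_forall_pos_le_add fun δ hδ => ?_
    have hε : 0 < δ / (D + 1) := by positivity
    obtain ⟨c, hd, hc⟩ := exists_isDecomposition_lt (ENNReal.lt_add_right hfin.ne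
      (ENNReal.ofReal_pos.2 hε).ne')
    have hct := hc.trans (ENNReal.add_lt_top.2 ⟨hfin, ENNReal.ofReal_lt_top⟩)
    obtain ⟨l', hl', hle⟩ := hlim f c hd hct
    have heq : L f = l' := tendsto_nhds_unique (hl f) hl'
    rw [heq, hardySeminorm_apply]
    have h1 := ENNReal.toReal_mono (ENNReal.add_ne_top.2 ⟨hfin.ne, ENNReal.ofReal_ne_top⟩) hc.le
    rw [ENNReal.toReal_add hfin.ne ENNReal.ofReal_ne_top, ENNReal.toReal_ofReal hε.le] at h1
    have h2 : D * (δ / (D + 1)) ≤ δ := by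
      rw [mul_div_assoc', div_le_iff₀ (by positivity)]
      nlinarith
    have h3 := mul_le_mul_of_nonneg_left h1 hD0
    rw [mul_add] at h3
    linarith
  · exact tendsto_nhds_unique (hl f)
      (tendsto_integral_mul_trunc (Lp.aestronglyMeasurable _) hgm hf)

omit [BorelSpace X] in
theorem IsAtomicBlock.mem_hardySpace [Nonempty X] {ρ : ℝ} {q : ℝ≥0∞} {b : Lp ℝ 1 μ} {c : ℕ → ℝ}
    (h : IsAtomicBlock μ lam ρ q b c) (hc : ∑' j, ‖c j‖ₑ < ∞) : b ∈ hardySpace μ lam ρ q :=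
  mem_hardySpace_iff.2 (h.hardyNorm_le.trans_lt hc)

/-- A bounded functional that vanishes on all atomic blocks is zero. -/
theorem IsDominating.eq_zero_of_blocks [Nonempty X] (hlam : IsDominating μ lam) {ρ : ℝ}
    (hρ : 1 ≤ ρ) {q : ℝ≥0∞} (hq : 1 ≤ q) {D : hardySpace μ lam ρ q →ₗ[ℝ] ℝ} {M : ℝ}
    (hD : ∀ f, |D f| ≤ M * hardySeminorm hlam hρ hq f)
    (h : ∀ b c (_ : IsAtomicBlock μ lam ρ q b c) (_ : ∑' j, ‖c j‖ₑ < ∞)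
      (hb : b ∈ hardySpace μ lam ρ q), D ⟨b, hb⟩ = 0) : D = 0 := by
  ext ⟨f, hf⟩
  obtain ⟨c, ⟨b, hb, hbs⟩, hc⟩ := hf
  have hci : ∀ i, ∑' j, ‖c i j‖ₑ < ∞ := fun i => (ENNReal.le_tsum i).trans_lt hc
  let B : ℕ → hardySpace μ lam ρ q := fun i => ⟨b i, (hb i).mem_hardySpace (hci i)⟩
  let F : hardySpace μ lam ρ q := ⟨f, c, ⟨b, hb, hbs⟩, hc⟩
  have htail : Tendsto (fun n => (∑' i, ∑' j, ‖c (i + n) j‖ₑ).toReal) atTop (𝓝 0) := by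
    have := ENNReal.tendsto_sum_nat_add (fun i => ∑' j, ‖c i j‖ₑ) hc.ne
    exact (ENNReal.tendsto_toReal ENNReal.zero_ne_top).comp this
  -- Subtracting the first `n` blocks does not change `D F`, and the remainder is decomposed by the
  -- tail.
  have hbound : ∀ n, |D F| ≤ |M| * (∑' i, ∑' j, ‖c (i + n) j‖ₑ).toReal := by
    intro n
    have h1 : D F = D (F - ∑ i ∈ Finset.range n, B i) := by
      rw [map_sub, map_sum, Finset.sum_eq_zero fun i _ => h _ _ (hb i) (hci i) _, sub_zero]
    have h2 : IsDecomposition μ lam ρ q ((F - ∑ i ∈ Finset.range n, B i : hardySpace μ lam ρ q) :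
        Lp ℝ 1 μ) fun i => c (i + n) := by
      refine ⟨fun i => b (i + n), fun i => hb _, ?_⟩
      have := (hasSum_nat_add_iff' n).2 hbs
      convert! this using 1
      simp [F, B]
    have h3 := hardyNorm_le_of_isDecomposition h2
    have hfin : ∑' i, ∑' j, ‖c (i + n) j‖ₑ < ∞ :=
      (ENNReal.tsum_comp_le_tsum_of_injective (add_left_injective n)
        (fun i => ∑' j, ‖c i j‖ₑ)).trans_lt hc
    have h4 := ENNReal.toReal_mono hfin.ne h3
    rw [h1]
    refine (hD _).trans ?_
    rw [hardySeminorm_apply]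
    exact (mul_le_mul_of_nonneg_right (le_abs_self M) ENNReal.toReal_nonneg).trans
      (mul_le_mul_of_nonneg_left h4 (abs_nonneg M))
  have hz : |D F| ≤ 0 := by
    have hlim : Tendsto (fun n => |M| * (∑' i, ∑' j, ‖c (i + n) j‖ₑ).toReal) atTop (𝓝 0) := by
      simpa using htail.const_mul |M|
    exact ge_of_tendsto' hlim hbound
  simpa using hz

end NonHom

namespace NonHom

open Filter Topology

variable {X : Type*} [MetricSpace X] [MeasurableSpace X] {μ : Measure X} {lam : X → ℝ → ℝ}

/-! ### Elementary members of the atomic Hardy spaces -/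

/-- The largest `L^q` norm of an atom on `B(z, s)` in a block of radius `r`. -/
noncomputable def atomBound (μ : Measure X) (lam : X → ℝ → ℝ) (ρ : ℝ) (q : ℝ≥0∞) (z : X)
    (s r : ℝ) : ℝ≥0∞ :=
  μ (ball z (ρ * s)) ^ ((q⁻¹).toReal - 1) * (ENNReal.ofReal (kCoeff μ lam z s r))⁻¹

omit [MetricSpace X] in
theorem integral_add_Lp (f g : Lp ℝ 1 μ) :
    ∫ y, (f + g : Lp ℝ 1 μ) y ∂μ = ∫ y, f y ∂μ + ∫ y, g y ∂μ := by
  rw [integral_congr_ae (Lp.coeFn_add f g)]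
  exact integral_add (L1.integrable_coeFn f) (L1.integrable_coeFn g)

omit [MetricSpace X] in
theorem integral_smul_Lp (t : ℝ) (f : Lp ℝ 1 μ) :
    ∫ y, (t • f : Lp ℝ 1 μ) y ∂μ = t * ∫ y, f y ∂μ := by
  rw [integral_congr_ae (Lp.coeFn_smul t f)]
  exact integral_const_mul t _

omit [MetricSpace X] in
theorem integral_sub_Lp (f g : Lp ℝ 1 μ) :
    ∫ y, (f - g : Lp ℝ 1 μ) y ∂μ = ∫ y, f y ∂μ - ∫ y, g y ∂μ := by
  rw [integral_congr_ae (Lp.coeFn_sub f g)]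
  exact integral_sub (L1.integrable_coeFn f) (L1.integrable_coeFn g)

omit [MetricSpace X] in
theorem enorm_integral_le_enorm (f : Lp ℝ 1 μ) : ‖∫ y, f y ∂μ‖ₑ ≤ ‖f‖ₑ := by
  rw [Lp.enorm_def, eLpNorm_one_eq_lintegral_enorm]
  exact enorm_integral_le_lintegral_enorm _

variable [BorelSpace X]

omit [BorelSpace X] in
theorem IsDominating.atomBound_ne_zero (hlam : IsDominating μ lam) (ρ : ℝ) {q : ℝ≥0∞} (hq : 1 ≤ q)
    (z : X) (s r : ℝ) : atomBound μ lam ρ q z s r ≠ 0 := by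
  have hq₁ : (q⁻¹).toReal ≤ 1 := by
    have : q⁻¹ ≤ 1 := ENNReal.inv_le_one.2 hq
    simpa using ENNReal.toReal_mono ENNReal.one_ne_top this
  refine mul_ne_zero ?_ (ENNReal.inv_ne_zero.2 ENNReal.ofReal_ne_top)
  rw [← neg_sub, ENNReal.rpow_neg]
  exact ENNReal.inv_ne_zero.2 (ENNReal.rpow_ne_top_of_nonneg (by linarith)
    (hlam.measure_ball_lt_top _ _).ne)

/-- For a fixed ball every `L^q` function supported in it is a multiple of an atom. If the ball is
null the atom bound may be infinite, but then the function vanishes. -/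
theorem IsDominating.exists_eLpNorm_le_atomBound (hlam : IsDominating μ lam) {ρ : ℝ} (hρ : 1 ≤ ρ)
    {q : ℝ≥0∞} (hq : 1 ≤ q) (z : X) {s : ℝ} (hs : 0 < s) (r : ℝ) :
    ∃ E : ℝ≥0, ∀ f : X → ℝ, (∀ᵐ y ∂μ, y ∉ ball z s → f y = 0) →
      eLpNorm f q μ ≤ E * eLpNorm f q μ * atomBound μ lam ρ q z s r := by
  have h0 := hlam.atomBound_ne_zero ρ hq z s r
  refine ⟨(atomBound μ lam ρ q z s r)⁻¹.toNNReal, fun f hf => ?_⟩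
  rcases eq_or_ne (μ (ball z s)) 0 with hμ | hμ
  · have : eLpNorm f q μ = 0 := by
      have hz : f =ᵐ[μ] 0 := by
        have h1 : ∀ᵐ y ∂μ, y ∉ ball z s := measure_eq_zero_iff_ae_notMem.1 hμ
        filter_upwards [hf, h1] with y h2 h3 using h2 h3
      rw [eLpNorm_congr_ae hz, eLpNorm_zero]
    rw [this]; simp
  · have hM : μ (ball z (ρ * s)) ≠ 0 := fun h =>
      hμ (measure_mono_null (ball_subset_ball (by nlinarith)) h)
    have ht : atomBound μ lam ρ q z s r ≠ ∞ := by
      refine ENNReal.mul_ne_top ?_ (ENNReal.inv_ne_top.2 ?_)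
      · exact ENNReal.rpow_ne_top_of_ne_zero hM (hlam.measure_ball_lt_top _ _).ne
      · exact (ENNReal.ofReal_pos.2 (one_pos.trans_le (hlam.one_le_kCoeff z hs r))).ne'
    rw [ENNReal.coe_toNNReal (ENNReal.inv_ne_top.2 h0), mul_comm _ (eLpNorm f q μ), mul_assoc,
      ENNReal.inv_mul_cancel h0 ht, mul_one]

/-- Correcting the integral of a sum of atoms by a multiple of a fixed function. -/
theorem IsDominating.exists_hardyNorm_sub_le [Nonempty X] (hlam : IsDominating μ lam) {ρ : ℝ}
    (hρ : 1 ≤ ρ) {q : ℝ≥0∞} (hq : 1 ≤ q) {x : X} {r : ℝ} (hr : 0 < r) {φ : Lp ℝ 1 μ}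
    (hφ : SupportedIn φ (ball x r)) (hφq : eLpNorm φ q μ < ∞) (hφ1 : ∫ y, φ y ∂μ = 1) :
    ∃ E : ℝ≥0, ∀ (h : Lp ℝ 1 μ) (e : ℕ → Lp ℝ 1 μ) (z : ℕ → X) (s : ℕ → ℝ) (t : ℕ → ℝ≥0),
      (∀ j, 0 < s j) → (∀ j, ball (z j) (s j) ⊆ ball x r) →
      (∀ j, SupportedIn (e j) (ball (z j) (s j))) →
      (∀ j, eLpNorm (e j) q μ ≤ t j * atomBound μ lam ρ q (z j) (s j) r) → HasSum e h →
      hardyNorm μ lam ρ q (h - (∫ y, h y ∂μ) • φ) ≤ E * ∑' j, (t j : ℝ≥0∞) := by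
  obtain ⟨E₀, hE₀⟩ := hlam.exists_eLpNorm_le_atomBound hρ hq x hr r
  set E₁ : ℝ≥0 := E₀ * (eLpNorm φ q μ).toNNReal with hE₁
  have hE₁' : eLpNorm φ q μ ≤ E₁ * atomBound μ lam ρ q x r r := by
    rw [hE₁, ENNReal.coe_mul, ENNReal.coe_toNNReal hφq.ne]
    exact hE₀ φ hφ
  refine ⟨E₁ + 1, fun h e z s t hs hsub hsupp he hsum => ?_⟩
  have hq0 : q ≠ 0 := (one_pos.trans_le hq).ne'
  set I := ∫ y, h y ∂μ with hI
  have hL1 : ‖h‖ₑ ≤ ∑' j, (t j : ℝ≥0∞) := by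
    refine (enorm_le_tsum_of_hasSum hsum).trans (ENNReal.tsum_le_tsum fun j => ?_)
    have h1 := eLpNorm_atom_mono (q₂ := 1) (ρ₂ := 1) (ρ₁ := ρ)
      (k := t j * (ENNReal.ofReal (kCoeff μ lam (z j) (s j) r))⁻¹) hlam.measure_ball_lt_top
      (Lp.aestronglyMeasurable (e j)) (hs j) (hsupp j) hq le_rfl hρ le_rfl
      ((he j).trans (le_of_eq (by rw [atomBound]; ring)))
    have h2 : (ENNReal.ofReal (kCoeff μ lam (z j) (s j) r))⁻¹ ≤ 1 :=
      ENNReal.inv_le_one.2 (ENNReal.one_le_ofReal.2 (hlam.one_le_kCoeff _ (hs j) r))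
    rw [Lp.enorm_def]
    refine h1.trans ?_
    simpa using mul_le_of_le_one_right (zero_le (a := (t j : ℝ≥0∞))) h2
  -- The correction `-I • φ` is put in front of the given terms, as a multiple of an atom on the
  -- whole ball.
  obtain ⟨e', he0, he1⟩ : ∃ e' : ℕ → Lp ℝ 1 μ, e' 0 = (-I) • φ ∧ ∀ j, e' (j + 1) = e j :=
    ⟨fun n => Nat.casesOn n ((-I) • φ) e, rfl, fun _ => rfl⟩
  obtain ⟨z', hz0, hz1⟩ : ∃ z' : ℕ → X, z' 0 = x ∧ ∀ j, z' (j + 1) = z j :=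
    ⟨fun n => Nat.casesOn n x z, rfl, fun _ => rfl⟩
  obtain ⟨s', hs0, hs1⟩ : ∃ s' : ℕ → ℝ, s' 0 = r ∧ ∀ j, s' (j + 1) = s j :=
    ⟨fun n => Nat.casesOn n r s, rfl, fun _ => rfl⟩
  obtain ⟨t', ht0, ht1⟩ : ∃ t' : ℕ → ℝ≥0, t' 0 = ‖I‖₊ * E₁ ∧ ∀ j, t' (j + 1) = t j :=
    ⟨fun n => Nat.casesOn n (‖I‖₊ * E₁) t, rfl, fun _ => rfl⟩
  have hsum' : HasSum e' (h - I • φ) := by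
    rw [← hasSum_nat_add_iff' 1]
    simpa only [he1, Finset.sum_range_one, he0, neg_smul, sub_neg_eq_add, sub_add_cancel] using hsum
  have hbound := hardyNorm_le_of_hasSum_atoms (lam := lam) (ρ := ρ) hq0 hr (z := z') (s := s') t'
    (by rintro (_ | j) <;> simp only [hs0, hs1, hr, hs])
    (by
      rintro (_ | j)
      · rw [hz0, hs0]
      · rw [hz1, hs1]; exact hsub j)
    (by
      rintro (_ | j)
      · rw [he0, hz0, hs0]; exact hφ.smul (-I)
      · rw [he1, hz1, hs1]; exact hsupp j)
    (by
      rintro (_ | j)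
      · rw [he0, hz0, hs0, ht0, eLpNorm_congr_ae (Lp.coeFn_smul _ φ), eLpNorm_const_smul, enorm_neg,
          ENNReal.coe_mul, mul_assoc]
        exact mul_le_mul_right hE₁' _
      · rw [he1, hz1, hs1, ht1]; exact he j)
    hsum' (by rw [integral_sub_Lp, integral_smul_Lp, hφ1, mul_one, sub_self])
  refine hbound.trans ?_
  rw [tsum_eq_zero_add' ENNReal.summable]
  simp only [ht0, ht1]
  have h3 : (‖I‖₊ : ℝ≥0∞) ≤ ∑' j, (t j : ℝ≥0∞) := (enorm_integral_le_enorm h).trans hL1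
  push_cast
  calc _ ≤ (∑' j, (t j : ℝ≥0∞)) * E₁ + ∑' j, (t j : ℝ≥0∞) := by gcongr
    _ = _ := by ring

theorem IsDominating.exists_hardyNorm_sub_le_eLpNorm [Nonempty X] (hlam : IsDominating μ lam)
    {ρ : ℝ} (hρ : 1 ≤ ρ) {q : ℝ≥0∞} (hq : 1 ≤ q) {x : X} {r : ℝ} (hr : 0 < r) {φ : Lp ℝ 1 μ}
    (hφ : SupportedIn φ (ball x r)) (hφq : eLpNorm φ q μ < ∞) (hφ1 : ∫ y, φ y ∂μ = 1) :
    ∃ E : ℝ≥0, ∀ h : Lp ℝ 1 μ, SupportedIn h (ball x r) → eLpNorm h q μ < ∞ →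
      hardyNorm μ lam ρ q (h - (∫ y, h y ∂μ) • φ) ≤ E * eLpNorm h q μ := by
  obtain ⟨E, hE⟩ := hlam.exists_hardyNorm_sub_le hρ hq hr hφ hφq hφ1
  obtain ⟨E₀, hE₀⟩ := hlam.exists_eLpNorm_le_atomBound hρ hq x hr r
  refine ⟨E * E₀, fun h hh hq' => ?_⟩
  refine (hE h (fun n => if n = 0 then h else 0) (fun _ => x) (fun _ => r)
    (fun n => if n = 0 then E₀ * (eLpNorm h q μ).toNNReal else 0) (fun _ => hr)
    (fun _ => subset_rfl) (fun j => ?_) (fun j => ?_) (hasSum_ite_eq 0 h)).trans ?_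
  · by_cases hj : j = 0
    · simpa [hj] using hh
    · simpa [hj] using supportedIn_zero _
  · by_cases hj : j = 0
    · simp only [hj, if_true]
      rw [ENNReal.coe_mul, ENNReal.coe_toNNReal hq'.ne]
      exact hE₀ h hh
    · simp only [hj, if_false]
      rw [eLpNorm_congr_ae (Lp.coeFn_zero ℝ 1 μ)]; simp
  · rw [tsum_eq_single 0 (fun n hn => by simp [hn])]
    simp [hq'.ne, mul_assoc]

/-- The normalized indicator function of a ball of positive measure. -/
theorem IsDominating.exists_normalized (hlam : IsDominating μ lam) (x : X) (r : ℝ)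
    (h : μ (ball x r) ≠ 0) :
    ∃ φ : Lp ℝ 1 μ, SupportedIn φ (ball x r) ∧ eLpNorm φ ∞ μ < ∞ ∧ ∫ y, φ y ∂μ = 1 := by
  have hfin := (hlam.measure_ball_lt_top x r).ne
  let c : ℝ := (μ.real (ball x r))⁻¹
  refine ⟨indicatorConstLp 1 measurableSet_ball hfin c, ?_, ?_, ?_⟩
  · filter_upwards [indicatorConstLp_coeFn (p := 1) (hs := measurableSet_ball) (hμs := hfin)
      (c := c)] with y hy hyn
    rw [hy, Set.indicator_of_notMem hyn]
  · rw [eLpNorm_congr_ae indicatorConstLp_coeFn]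
    refine (eLpNorm_indicator_le _).trans_lt ?_
    exact (memLp_top_const c).2
  · rw [integral_congr_ae indicatorConstLp_coeFn, integral_indicator measurableSet_ball,
      setIntegral_const, smul_eq_mul]
    exact mul_inv_cancel₀ (ENNReal.toReal_ne_zero.2 ⟨h, hfin⟩)

theorem SupportedIn.eLpNorm_lt_top (hlam : IsDominating μ lam) {f : Lp ℝ 1 μ} {x : X} {r : ℝ}
    (hf : SupportedIn f (ball x r)) {q₁ q₂ : ℝ≥0∞} (hq : q₂ ≤ q₁) (h : eLpNorm f q₁ μ < ∞) :
    eLpNorm f q₂ μ < ∞ := by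
  have hres : ∀ q : ℝ≥0∞, eLpNorm f q (μ.restrict (ball x r)) = eLpNorm f q μ := by
    intro q
    rw [← eLpNorm_indicator_eq_eLpNorm_restrict measurableSet_ball]
    refine eLpNorm_congr_ae ?_
    filter_upwards [hf] with y hy
    by_cases hyb : y ∈ ball x r
    · rw [Set.indicator_of_mem hyb]
    · rw [Set.indicator_of_notMem hyb, hy hyb]
  have : IsFiniteMeasure (μ.restrict (ball x r)) :=
    ⟨by rw [Measure.restrict_apply_univ]; exact hlam.measure_ball_lt_top _ _⟩
  have h1 : MemLp f q₁ (μ.restrict (ball x r)) :=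
    ⟨(Lp.aestronglyMeasurable f).restrict, by rwa [hres]⟩
  rw [← hres]
  exact (h1.mono_exponent hq).2

omit [BorelSpace X] in
theorem SupportedIn.eq_zero {f : Lp ℝ 1 μ} {x : X} {r : ℝ}
    (hf : SupportedIn f (ball x r)) (h : μ (ball x r) = 0) : f = 0 := by
  have h1 : ∀ᵐ y ∂μ, y ∉ ball x r := measure_eq_zero_iff_ae_notMem.1 h
  refine (Lp.eq_zero_iff_ae_eq_zero (f := f)).2 ?_
  filter_upwards [hf, h1] with y h2 h3 using h2 h3

/-- When the integral is zero, the correction by a multiple of `φ` disappears. -/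
theorem IsDominating.mem_hardySpace_of_integral_eq_zero [Nonempty X] (hlam : IsDominating μ lam)
    {ρ : ℝ} (hρ : 1 ≤ ρ) {q : ℝ≥0∞} (hq : 1 ≤ q) {x : X} {r : ℝ} (hr : 0 < r) {f : Lp ℝ 1 μ}
    (hf : SupportedIn f (ball x r)) (hfq : eLpNorm f q μ < ∞) (hf0 : ∫ y, f y ∂μ = 0) :
    f ∈ hardySpace μ lam ρ q := by
  rcases eq_or_ne (μ (ball x r)) 0 with h | h
  · rw [hf.eq_zero h]; exact Submodule.zero_mem _
  · obtain ⟨φ, h1, h2, h3⟩ := hlam.exists_normalized x r h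
    obtain ⟨E, hE⟩ := hlam.exists_hardyNorm_sub_le_eLpNorm hρ hq hr h1
      (h1.eLpNorm_lt_top hlam le_top h2) h3
    have := hE f hf hfq
    rw [hf0, zero_smul, sub_zero] at this
    exact mem_hardySpace_iff.2 (this.trans_lt (ENNReal.mul_lt_top ENNReal.coe_lt_top hfq))

omit [BorelSpace X] [MetricSpace X] in
theorem SupportedIn.add {f g : Lp ℝ 1 μ} {s : Set X} (hf : SupportedIn f s)
    (hg : SupportedIn g s) : SupportedIn (f + g) s := by
  filter_upwards [hf, hg, Lp.coeFn_add f g] with y h1 h2 h3 hy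
  rw [h3, Pi.add_apply, h1 hy, h2 hy, add_zero]

omit [BorelSpace X] [MetricSpace X] in
theorem SupportedIn.sub {f g : Lp ℝ 1 μ} {s : Set X} (hf : SupportedIn f s)
    (hg : SupportedIn g s) : SupportedIn (f - g) s := by
  filter_upwards [hf, hg, Lp.coeFn_sub f g] with y h1 h2 h3 hy
  rw [h3, Pi.sub_apply, h1 hy, h2 hy, sub_zero]

omit [BorelSpace X] [MetricSpace X] in
theorem eLpNorm_sub_lt_top {q : ℝ≥0∞} (hq : 1 ≤ q) {f g : Lp ℝ 1 μ} (hf : eLpNorm f q μ < ∞)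
    (hg : eLpNorm g q μ < ∞) : eLpNorm (f - g : Lp ℝ 1 μ) q μ < ∞ := by
  rw [eLpNorm_congr_ae (Lp.coeFn_sub f g)]
  exact (eLpNorm_sub_le (Lp.aestronglyMeasurable f) (Lp.aestronglyMeasurable g) hq).trans_lt
    (ENNReal.add_lt_top.2 ⟨hf, hg⟩)

/-- Approximation of an `L^p` function supported in a ball by bounded ones. -/
theorem exists_bounded_approx {f : Lp ℝ 1 μ} {x : X} {r : ℝ} (hf : SupportedIn f (ball x r))
    {p : ℝ≥0∞} (hp' : p ≠ ∞) (hfp : eLpNorm f p μ < ∞) {ε : ℝ≥0∞} (hε : ε ≠ 0)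
    (hfin : μ (ball x r) < ∞) :
    ∃ f' : Lp ℝ 1 μ, SupportedIn f' (ball x r) ∧ eLpNorm f' ∞ μ < ∞ ∧
      eLpNorm (f - f' : Lp ℝ 1 μ) p μ ≤ ε := by
  obtain ⟨s, hs, -⟩ := MemLp.exists_simpleFunc_eLpNorm_sub_lt
    (⟨Lp.aestronglyMeasurable f, hfp⟩ : MemLp f p μ) hp' hε
  have hfinm : IsFiniteMeasure (μ.restrict (ball x r)) :=
    ⟨by rwa [Measure.restrict_apply_univ]⟩
  have hm : MemLp ((ball x r).indicator s) 1 μ :=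
    (memLp_indicator_iff_restrict measurableSet_ball).2 (s.memLp_of_isFiniteMeasure 1 _)
  refine ⟨hm.toLp _, ?_, ?_, ?_⟩
  · filter_upwards [hm.coeFn_toLp] with y hy hyn
    rw [hy, Set.indicator_of_notMem hyn]
  · rw [eLpNorm_congr_ae hm.coeFn_toLp]
    exact (eLpNorm_indicator_le _).trans_lt (s.memLp_top μ).2
  · refine le_trans ?_ hs.le
    have : (f - hm.toLp _ : Lp ℝ 1 μ) =ᵐ[μ] (ball x r).indicator (f - s : X → ℝ) := by
      filter_upwards [Lp.coeFn_sub f (hm.toLp _), hm.coeFn_toLp, hf] with y h1 h2 h3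
      rw [h1, Pi.sub_apply, h2]
      by_cases hy : y ∈ ball x r
      · rw [Set.indicator_of_mem hy, Set.indicator_of_mem hy]; rfl
      · rw [Set.indicator_of_notMem hy, Set.indicator_of_notMem hy, h3 hy, sub_zero]
    rw [eLpNorm_congr_ae this]
    exact eLpNorm_indicator_le _

end NonHom

namespace NonHom

open Filter Topology

variable {X : Type*} [MetricSpace X] [MeasurableSpace X] {μ : Measure X} {lam : X → ℝ → ℝ}
  [BorelSpace X]

/-! ### Density of bounded functions -/

theorem tsum_ite_eq_tsum_add (f : ℕ → ℝ≥0∞) (n : ℕ) :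
    ∑' j, (if n ≤ j then f j else 0) = ∑' j, f (j + n) := by
  rw [← Summable.sum_add_tsum_nat_add' (k := n) ENNReal.summable,
    Finset.sum_eq_zero fun j hj => if_neg (not_le.2 (Finset.mem_range.1 hj)), zero_add]
  simp

set_option maxHeartbeats 1000000 in
/-- A bounded functional that vanishes on the bounded functions of bounded support and integral
zero is zero. -/
theorem IsDominating.eq_zero_of_bounded [Nonempty X] (hlam : IsDominating μ lam) {ρ : ℝ}
    (hρ : 1 ≤ ρ) {p : ℝ≥0∞} (hp : 1 ≤ p) (hp' : p ≠ ∞) {D : hardySpace μ lam ρ p →ₗ[ℝ] ℝ} {M : ℝ}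
    (hD : ∀ f, |D f| ≤ M * hardySeminorm hlam hρ hp f)
    (h : ∀ (f : Lp ℝ 1 μ) x r (hf : f ∈ hardySpace μ lam ρ p), 0 < r → SupportedIn f (ball x r) →
      eLpNorm f ∞ μ < ∞ → ∫ y, f y ∂μ = 0 → D ⟨f, hf⟩ = 0) : D = 0 := by
  refine hlam.eq_zero_of_blocks hρ hp hD fun b c hb hc hbm => ?_
  obtain ⟨x, r, hr, hsupp, hint, a, z, s, ha, hs⟩ := hb
  rcases eq_or_ne (μ (ball x r)) 0 with hμ | hμ
  · have hb0 : b = 0 := hsupp.eq_zero hμ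
    subst hb0
    exact map_zero D
  obtain ⟨φ, hφ1, hφ2, hφ3⟩ := hlam.exists_normalized x r hμ
  obtain ⟨E, hE⟩ := hlam.exists_hardyNorm_sub_le hρ hp hr hφ1 (hφ1.eLpNorm_lt_top hlam le_top hφ2)
    hφ3
  set S : ℝ≥0∞ := ∑' j, ‖c j‖ₑ with hS
  -- The first `n` atoms are replaced by bounded ones, each with relative error `ε`, the others are
  -- dropped, and `φ` restores integral zero. The result is killed by `D`, and its distance to `b`
  -- in the Hardy norm is controlled by `ε * S` plus the tail of the coefficients.
  have key : ∀ (n : ℕ) (ε : ℝ≥0), 0 < ε →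
      |D ⟨b, hbm⟩| ≤ |M| * (E * (ε * S + ∑' j, ‖c (j + n)‖ₑ)).toReal := by
    intro n ε hε
    have happ : ∀ j, ∃ f' : Lp ℝ 1 μ, SupportedIn f' (ball (z j) (s j)) ∧ eLpNorm f' ∞ μ < ∞ ∧
        eLpNorm (a j - f' : Lp ℝ 1 μ) p μ ≤
          (if j < n then ε else 1) * atomBound μ lam ρ p (z j) (s j) r ∧ (n ≤ j → f' = 0) := by
      intro j
      obtain ⟨h1, h2, h3, h4⟩ := ha j
      by_cases hj : j < n
      · have hfp : eLpNorm (a j) p μ < ∞ := by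
          rcases eq_or_ne (μ (ball (z j) (ρ * s j))) 0 with h0 | h0
          · have : a j = 0 := h3.eq_zero
              (measure_mono_null (ball_subset_ball (by nlinarith)) h0)
            rw [this, eLpNorm_congr_ae (Lp.coeFn_zero ℝ 1 μ)]; simp
          · refine h4.trans_lt (ENNReal.mul_lt_top ?_ ?_)
            · exact (ENNReal.rpow_ne_top_of_ne_zero h0 (hlam.measure_ball_lt_top _ _).ne).lt_top
            · exact (ENNReal.inv_ne_top.2 (ENNReal.ofReal_pos.2
                (one_pos.trans_le (hlam.one_le_kCoeff _ h1 r))).ne').lt_top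
        obtain ⟨f', h5, h6, h7⟩ := exists_bounded_approx h3 hp' hfp
          (ε := ε * atomBound μ lam ρ p (z j) (s j) r)
          (mul_ne_zero (by exact_mod_cast hε.ne') (hlam.atomBound_ne_zero ρ hp _ _ _))
          (hlam.measure_ball_lt_top _ _)
        exact ⟨f', h5, h6, by simpa [hj] using h7, fun h => by omega⟩
      · refine ⟨0, supportedIn_zero _, ?_, ?_, fun _ => rfl⟩
        · rw [eLpNorm_congr_ae (Lp.coeFn_zero ℝ 1 μ)]; simp
        · rw [sub_zero, if_neg hj, ENNReal.coe_one, one_mul]; exact h4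
    choose a' ha1 ha2 ha3 ha4 using happ
    set b' : Lp ℝ 1 μ := ∑ j ∈ Finset.range n, c j • a' j with hb'
    have hb's : SupportedIn b' (ball x r) ∧ eLpNorm b' ∞ μ < ∞ := by
      have : ∀ t : Finset ℕ, SupportedIn (∑ j ∈ t, c j • a' j) (ball x r) ∧
          eLpNorm (∑ j ∈ t, c j • a' j : Lp ℝ 1 μ) ∞ μ < ∞ := by
        intro t
        induction t using Finset.induction_on with
        | empty =>
          refine ⟨by simpa using supportedIn_zero _, ?_⟩
          rw [Finset.sum_empty, eLpNorm_congr_ae (Lp.coeFn_zero ℝ 1 μ)]; simp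
        | insert j t hj ih =>
          rw [Finset.sum_insert hj]
          refine ⟨(((ha1 j).smul _).mono (ha j).2.1).add ih.1, ?_⟩
          rw [eLpNorm_congr_ae (Lp.coeFn_add _ _)]
          refine (eLpNorm_add_le (Lp.aestronglyMeasurable _) (Lp.aestronglyMeasurable _)
            le_top).trans_lt (ENNReal.add_lt_top.2 ⟨?_, ih.2⟩)
          rw [eLpNorm_congr_ae (Lp.coeFn_smul _ _), eLpNorm_const_smul]
          exact ENNReal.mul_lt_top enorm_lt_top (ha2 j)
      exact this _
    have hsum' : HasSum (fun j => c j • a' j) b' :=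
      hasSum_sum_of_ne_finset_zero fun j hj => by
        rw [ha4 j (by simpa using hj), smul_zero]
    have hsumd : HasSum (fun j => c j • (a j - a' j)) (b - b') := by
      simpa only [smul_sub] using hs.sub hsum'
    have hnorm := hE (b - b') _ z s (fun j => ‖c j‖₊ * (if j < n then ε else 1))
      (fun j => (ha j).1) (fun j => (ha j).2.1)
      (fun j => ((ha j).2.2.1.sub (ha1 j)).smul _)
      (fun j => by
        rw [eLpNorm_congr_ae (Lp.coeFn_smul _ _), eLpNorm_const_smul, ENNReal.coe_mul, mul_assoc]
        refine mul_le_mul_right ((ha3 j).trans (le_of_eq ?_)) _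
        split_ifs <;> simp) hsumd
    have htsum : ∑' j, ((‖c j‖₊ * (if j < n then ε else 1) : ℝ≥0) : ℝ≥0∞) ≤
        ε * S + ∑' j, ‖c (j + n)‖ₑ := by
      rw [hS, ← ENNReal.tsum_mul_left]
      calc _ ≤ ∑' j, (ε * ‖c j‖ₑ + if n ≤ j then ‖c j‖ₑ else 0) := by
            refine ENNReal.tsum_le_tsum fun j => ?_
            by_cases hj : j < n
            · simp only [hj, if_true, not_le.2 hj, if_false, add_zero]
              rw [ENNReal.coe_mul, mul_comm]; rfl
            · simp only [hj, if_false, not_lt.1 hj, if_true, mul_one]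
              exact le_add_self
        _ = ∑' j, ε * ‖c j‖ₑ + ∑' j, (if n ≤ j then ‖c j‖ₑ else 0) := ENNReal.tsum_add
        _ = _ := by
          congr 1
          exact tsum_ite_eq_tsum_add (fun j => ‖c j‖ₑ) n
    set w : Lp ℝ 1 μ := b' - (∫ y, b' y ∂μ) • φ with hw
    have hw1 : SupportedIn w (ball x r) := hb's.1.sub (hφ1.smul _)
    have hw2 : eLpNorm w ∞ μ < ∞ := by
      refine eLpNorm_sub_lt_top le_top hb's.2 ?_
      rw [eLpNorm_congr_ae (Lp.coeFn_smul _ _), eLpNorm_const_smul]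
      exact ENNReal.mul_lt_top enorm_lt_top hφ2
    have hw3 : ∫ y, w y ∂μ = 0 := by
      rw [hw, integral_sub_Lp, integral_smul_Lp, hφ3, mul_one, sub_self]
    have hwm : w ∈ hardySpace μ lam ρ p := hlam.mem_hardySpace_of_integral_eq_zero hρ hp hr hw1
      (hw1.eLpNorm_lt_top hlam le_top hw2) hw3
    have hDw := h w x r hwm hr hw1 hw2 hw3
    have heq : D ⟨b, hbm⟩ = D (⟨b, hbm⟩ - ⟨w, hwm⟩) := by rw [map_sub, hDw, sub_zero]
    have hbw : b - b' - (∫ y, (b - b' : Lp ℝ 1 μ) y ∂μ) • φ = b - w := by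
      rw [integral_sub_Lp, hint, hw, zero_sub, neg_smul]; abel
    rw [hbw] at hnorm
    have hfin : E * (ε * S + ∑' j, ‖c (j + n)‖ₑ) < ∞ := by
      refine ENNReal.mul_lt_top ENNReal.coe_lt_top (ENNReal.add_lt_top.2
        ⟨ENNReal.mul_lt_top ENNReal.coe_lt_top hc, ?_⟩)
      exact (ENNReal.tsum_comp_le_tsum_of_injective (add_left_injective n)
        (fun j => ‖c j‖ₑ)).trans_lt hc
    have h9 := ENNReal.toReal_mono hfin.ne (hnorm.trans (mul_le_mul_right htsum _))
    rw [heq]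
    refine (hD _).trans ?_
    rw [hardySeminorm_apply]
    exact (mul_le_mul_of_nonneg_right (le_abs_self M) ENNReal.toReal_nonneg).trans
      (mul_le_mul_of_nonneg_left h9 (abs_nonneg M))
  have hlim : Tendsto (fun n : ℕ => |M| * (E * (((n + 1 : ℝ≥0)⁻¹ : ℝ≥0) * S +
      ∑' j, ‖c (j + n)‖ₑ)).toReal) atTop (𝓝 0) := by
    have h1 := ENNReal.tendsto_sum_nat_add (fun j => ‖c j‖ₑ) hc.ne
    have h2 : Tendsto (fun n : ℕ => (((n + 1 : ℝ≥0)⁻¹ : ℝ≥0) : ℝ≥0∞) * S) atTop (𝓝 0) := by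
      have e1 : Tendsto (fun n : ℕ => (n + 1 : ℝ≥0)⁻¹) atTop (𝓝 0) := by
        simpa only [one_div] using tendsto_one_div_add_atTop_nhds_zero_nat (𝕜 := ℝ≥0)
      have := ENNReal.Tendsto.mul_const (b := S) (ENNReal.tendsto_coe.2 e1) (Or.inr hc.ne)
      simpa using this
    have h3 := ENNReal.Tendsto.const_mul (a := (E : ℝ≥0∞)) (h2.add h1) (Or.inr ENNReal.coe_ne_top)
    rw [add_zero, mul_zero] at h3
    have h4 := ((ENNReal.tendsto_toReal ENNReal.zero_ne_top).comp h3).const_mul |M|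
    simpa using h4
  have hz : |D ⟨b, hbm⟩| ≤ 0 :=
    ge_of_tendsto' hlim fun n => key n _ (by positivity)
  simpa using hz

/-! ### Representation of functionals -/

omit [MetricSpace X] [BorelSpace X] in
theorem memLp_indicator_of_restrict {S : Set X} (hS : MeasurableSet S) (hμS : μ S ≠ ∞)
    (F : Lp ℝ 2 (μ.restrict S)) {q : ℝ≥0∞} (hq : q ≤ 2) : MemLp (S.indicator F) q μ := by
  have : IsFiniteMeasure (μ.restrict S) :=
    ⟨by rw [Measure.restrict_apply_univ]; exact hμS.lt_top⟩
  exact (memLp_indicator_iff_restrict hS).2 ((Lp.memLp F).mono_exponent hq)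

/-- Extension by zero of an `L²` function on a set of finite measure. -/
noncomputable def extendByZero {S : Set X} (hS : MeasurableSet S) (hμS : μ S ≠ ∞) :
    Lp ℝ 2 (μ.restrict S) →ₗ[ℝ] Lp ℝ 1 μ where
  toFun F := (memLp_indicator_of_restrict hS hμS F one_le_two).toLp _
  map_add' F G := by
    refine Lp.ext ?_
    filter_upwards [(memLp_indicator_of_restrict hS hμS (F + G) one_le_two).coeFn_toLp,
      (memLp_indicator_of_restrict hS hμS F one_le_two).coeFn_toLp,
      (memLp_indicator_of_restrict hS hμS G one_le_two).coeFn_toLp,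
      Lp.coeFn_add ((memLp_indicator_of_restrict hS hμS F one_le_two).toLp _)
        ((memLp_indicator_of_restrict hS hμS G one_le_two).toLp _),
      (ae_restrict_iff' hS).1 (Lp.coeFn_add F G)] with y h1 h2 h3 h4 h5
    rw [h1, h4, Pi.add_apply, h2, h3]
    by_cases hy : y ∈ S
    · simp only [Set.indicator_of_mem hy]; exact h5 hy
    · simp [Set.indicator_of_notMem hy]
  map_smul' t F := by
    refine Lp.ext ?_
    filter_upwards [(memLp_indicator_of_restrict hS hμS (t • F) one_le_two).coeFn_toLp,
      (memLp_indicator_of_restrict hS hμS F one_le_two).coeFn_toLp,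
      Lp.coeFn_smul t ((memLp_indicator_of_restrict hS hμS F one_le_two).toLp _),
      (ae_restrict_iff' hS).1 (Lp.coeFn_smul t F)] with y h1 h2 h4 h5
    rw [h1, RingHom.id_apply, h4, Pi.smul_apply, h2]
    by_cases hy : y ∈ S
    · simp only [Set.indicator_of_mem hy]; exact h5 hy
    · simp [Set.indicator_of_notMem hy]

omit [MetricSpace X] [BorelSpace X] in
theorem coeFn_extendByZero {S : Set X} (hS : MeasurableSet S) (hμS : μ S ≠ ∞)
    (F : Lp ℝ 2 (μ.restrict S)) : extendByZero hS hμS F =ᵐ[μ] S.indicator F :=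
  (memLp_indicator_of_restrict hS hμS F one_le_two).coeFn_toLp

/-- On each bounded set a bounded functional is integration against a square integrable function,
up to a fixed correction of the integral. -/
theorem IsDominating.exists_local_representation [Nonempty X] (hlam : IsDominating μ lam) {ρ : ℝ}
    (hρ : 1 ≤ ρ) {p : ℝ≥0∞} (hp : 1 ≤ p) (hp2 : p ≤ 2) {L : hardySpace μ lam ρ p →ₗ[ℝ] ℝ} {M : ℝ}
    (hL : ∀ f, |L f| ≤ M * hardySeminorm hlam hρ hp f) {x : X} {r : ℝ} (hr : 0 < r) {φ : Lp ℝ 1 μ}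
    (hφ : SupportedIn φ (ball x r)) (hφq : eLpNorm φ p μ < ∞) (hφ1 : ∫ y, φ y ∂μ = 1)
    {S : Set X} (hS : MeasurableSet S) (hSb : S ⊆ ball x r) :
    ∃ G : Lp ℝ 2 (μ.restrict S), ∀ (F : Lp ℝ 1 μ), SupportedIn F S → eLpNorm F 2 μ < ∞ →
      ∀ hF : F - (∫ y, F y ∂μ) • φ ∈ hardySpace μ lam ρ p,
        L ⟨_, hF⟩ = ∫ y in S, F y * G y ∂μ := by
  have hμS : μ S ≠ ∞ := ((measure_mono hSb).trans_lt (hlam.measure_ball_lt_top _ _)).ne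
  have hfinS : IsFiniteMeasure (μ.restrict S) :=
    ⟨by rw [Measure.restrict_apply_univ]; exact hμS.lt_top⟩
  obtain ⟨E, hE⟩ := hlam.exists_hardyNorm_sub_le_eLpNorm hρ hp hr hφ hφq hφ1
  set e := extendByZero hS hμS with he
  have hes : ∀ F, SupportedIn (e F) (ball x r) := by
    intro F
    filter_upwards [coeFn_extendByZero hS hμS F] with y hy hyn
    rw [he, hy, Set.indicator_of_notMem fun h => hyn (hSb h)]
  -- The norm of the Hölder embedding of `L²(S)` into `L^p(S)`; this is where `p ≤ 2` is needed.
  set κ : ℝ≥0∞ := μ S ^ (1 / p.toReal - 1 / (2 : ℝ≥0∞).toReal) with hκ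
  have hκt : κ ≠ ∞ := by
    refine ENNReal.rpow_ne_top_of_nonneg ?_ hμS
    have : p.toReal ≤ (2 : ℝ≥0∞).toReal := ENNReal.toReal_mono ENNReal.ofNat_ne_top hp2
    have h0 : 0 < p.toReal := ENNReal.toReal_pos (one_pos.trans_le hp).ne'
      (hp2.trans_lt ENNReal.ofNat_lt_top).ne
    rw [sub_nonneg]
    exact one_div_le_one_div_of_le h0 this
  have hen : ∀ F, eLpNorm (e F) p μ ≤ ‖F‖ₑ * κ := by
    intro F
    rw [he, eLpNorm_congr_ae (coeFn_extendByZero hS hμS F), eLpNorm_indicator_eq_eLpNorm_restrict hS]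
    have := eLpNorm_le_eLpNorm_mul_rpow_measure_univ hp2 (Lp.aestronglyMeasurable F)
    rwa [Measure.restrict_apply_univ, ← Lp.enorm_def] at this
  have hent : ∀ F, eLpNorm (e F) p μ < ∞ := fun F =>
    (hen F).trans_lt (ENNReal.mul_lt_top enorm_lt_top hκt.lt_top)
  let T : Lp ℝ 2 (μ.restrict S) →ₗ[ℝ] Lp ℝ 1 μ :=
    { toFun := fun F => e F - (∫ y, e F y ∂μ) • φ
      map_add' := fun F G => by
        rw [map_add, integral_add_Lp, add_smul]; abel
      map_smul' := fun t F => by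
        rw [map_smul, integral_smul_Lp, RingHom.id_apply, smul_sub, smul_smul] }
  have hTn : ∀ F, hardyNorm μ lam ρ p (T F) ≤ E * (‖F‖ₑ * κ) := fun F =>
    (hE (e F) (hes F) (hent F)).trans (mul_le_mul_right (hen F) _)
  have hTt : ∀ F : Lp ℝ 2 (μ.restrict S), E * (‖F‖ₑ * κ) < ∞ := fun F =>
    ENNReal.mul_lt_top ENNReal.coe_lt_top (ENNReal.mul_lt_top enorm_lt_top hκt.lt_top)
  let T' : Lp ℝ 2 (μ.restrict S) →ₗ[ℝ] hardySpace μ lam ρ p :=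
    T.codRestrict _ fun F => mem_hardySpace_iff.2 ((hTn F).trans_lt (hTt F))
  -- The functional is pulled back to the Hilbert space `L²(S)`, where the Riesz theorem represents
  -- it.
  let ℓ : Lp ℝ 2 (μ.restrict S) →L[ℝ] ℝ := (L ∘ₗ T').mkContinuous (|M| * (E * κ.toReal)) fun F => by
    refine (hL (T' F)).trans ?_
    have h1 := ENNReal.toReal_mono (hTt F).ne (hTn F)
    rw [ENNReal.toReal_mul, ENNReal.toReal_mul, toReal_enorm, ENNReal.coe_toReal] at h1
    calc M * hardySeminorm hlam hρ hp (T' F) ≤ |M| * hardySeminorm hlam hρ hp (T' F) :=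
          mul_le_mul_of_nonneg_right (le_abs_self M) (apply_nonneg _ _)
      _ ≤ |M| * (E * (‖F‖ * κ.toReal)) := mul_le_mul_of_nonneg_left h1 (abs_nonneg M)
      _ = _ := by ring
  refine ⟨(InnerProductSpace.toDual ℝ _).symm ℓ, fun F hFS hF2 hF => ?_⟩
  have hFm : MemLp F 2 (μ.restrict S) :=
    MemLp.restrict S ⟨Lp.aestronglyMeasurable F, hF2⟩
  have h1 := InnerProductSpace.toDual_symm_apply (𝕜 := ℝ) (y := ℓ) (x := hFm.toLp F)
  have h2 : e (hFm.toLp F) = F := by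
    refine Lp.ext ?_
    filter_upwards [coeFn_extendByZero hS hμS (hFm.toLp F),
      (ae_restrict_iff' hS).1 hFm.coeFn_toLp, hFS] with y e1 e2 e3
    rw [he, e1]
    by_cases hy : y ∈ S
    · rw [Set.indicator_of_mem hy, e2 hy]
    · rw [Set.indicator_of_notMem hy, e3 hy]
  have h3 : ℓ (hFm.toLp F) = L ⟨_, hF⟩ := by
    have : T' (hFm.toLp F) = ⟨_, hF⟩ := by
      refine Subtype.ext ?_
      change e (hFm.toLp F) - (∫ y, e (hFm.toLp F) y ∂μ) • φ = _
      rw [h2]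
    change L (T' (hFm.toLp F)) = _
    rw [this]
  rw [← h3, ← h1, L2.inner_def]
  refine integral_congr_ae ?_
  filter_upwards [hFm.coeFn_toLp] with y hy
  rw [hy]
  simp

end NonHom

namespace NonHom

open Filter Topology

variable {X : Type*} [MetricSpace X] [MeasurableSpace X] {μ : Measure X} {lam : X → ℝ → ℝ}

omit [MetricSpace X] in
theorem integrableOn_mul_of_eLpNorm_top {f : Lp ℝ 1 μ} (hf : eLpNorm f ∞ μ < ∞) {g : X → ℝ}
    {s : Set X} (hg : IntegrableOn g s μ) : IntegrableOn (fun y => f y * g y) s μ := by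
  refine hg.bdd_mul (c := (eLpNorm f ∞ μ).toReal) (Lp.aestronglyMeasurable f).restrict ?_
  refine ae_restrict_of_ae ?_
  filter_upwards [enorm_ae_le_eLpNormEssSup f μ] with y hy
  rw [eLpNorm_exponent_top] at hf ⊢
  rw [← toReal_enorm]
  exact ENNReal.toReal_mono hf.ne hy

omit [MetricSpace X] in
theorem SupportedIn.integrable_mul {f : Lp ℝ 1 μ} {s : Set X} (hs : MeasurableSet s)
    (hfs : SupportedIn f s) {g : X → ℝ} (h : IntegrableOn (fun y => f y * g y) s μ) :
    Integrable (fun y => f y * g y) μ := by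
  rw [← integrable_indicator_iff hs] at h
  refine h.congr ?_
  filter_upwards [hfs] with y hy
  by_cases hys : y ∈ s
  · rw [Set.indicator_of_mem hys]
  · rw [Set.indicator_of_notMem hys, hy hys, zero_mul]

variable [BorelSpace X]

/-- A bounded functional is given, on bounded functions of bounded support, by integration against
a locally integrable function. -/
theorem IsDominating.exists_representation [Nonempty X] (hlam : IsDominating μ lam) {ρ : ℝ}
    (hρ : 1 ≤ ρ) {p : ℝ≥0∞} (hp : 1 ≤ p) (hp2 : p ≤ 2) {L : hardySpace μ lam ρ p →ₗ[ℝ] ℝ} {M : ℝ}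
    (hL : ∀ f, |L f| ≤ M * hardySeminorm hlam hρ hp f) :
    ∃ g : X → ℝ, (∀ x r, IntegrableOn g (ball x r) μ) ∧
      ∀ (f : Lp ℝ 1 μ) x r (hf : f ∈ hardySpace μ lam ρ p), SupportedIn f (ball x r) →
        eLpNorm f ∞ μ < ∞ → ∫ y, f y ∂μ = 0 → L ⟨f, hf⟩ = ∫ y, f y * g y ∂μ := by
  have x₀ : X := Classical.arbitrary X
  by_cases hμ : ∀ r, μ (ball x₀ r) = 0
  · refine ⟨0, fun x r => integrableOn_zero, fun f x r hf hs _ _ => ?_⟩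
    have h0 : f = 0 := (hs.mono (ball_subset_ball' (y := x₀) le_rfl)).eq_zero (hμ _)
    subst h0
    simp only [Pi.zero_apply, mul_zero, integral_zero]
    exact map_zero L
  push Not at hμ
  obtain ⟨R, hR⟩ := hμ
  have hR0 : 0 < R := by
    by_contra h
    exact hR (by rw [ball_eq_empty.2 (not_lt.1 h), measure_empty])
  obtain ⟨φ, hφ1, hφ2, hφ3⟩ := hlam.exists_normalized x₀ R hR
  -- Disjoint bounded shells on which the local representatives are glued. The same `φ` is used for
  -- every shell, so that the corrections cancel for a function of integral zero.
  let A : ℕ → Set X := fun n => {y | ⌊dist y x₀⌋₊ = n}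
  have hAm : ∀ n, MeasurableSet (A n) := fun n =>
    (Nat.measurable_floor.comp (continuous_id.dist continuous_const).measurable) (measurableSet_singleton n)
  have hAb : ∀ n, A n ⊆ ball x₀ (R + n + 1) := by
    intro n y hy
    have := Nat.lt_floor_add_one (dist y x₀)
    rw [show _ = n from hy] at this
    rw [mem_ball]; linarith
  have hQ : ∀ n : ℕ, 0 < R + n + 1 := fun n => by positivity
  have hφQ : ∀ n : ℕ, SupportedIn φ (ball x₀ (R + n + 1)) := fun n =>
    hφ1.mono (ball_subset_ball (by linarith [n.cast_nonneg (α := ℝ)]))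
  have hφp := hφ1.eLpNorm_lt_top hlam (le_top : p ≤ ∞) hφ2
  choose G hG using fun n => hlam.exists_local_representation hρ hp hp2 hL (hQ n) (hφQ n)
    hφp hφ3 (hAm n) (hAb n)
  let g : X → ℝ := fun y => G ⌊dist y x₀⌋₊ y
  have hgA : ∀ n, ∀ y ∈ A n, g y = G n y := fun n y hy => by
    change G ⌊dist y x₀⌋₊ y = _
    rw [show _ = n from hy]
  have hgi : ∀ n, IntegrableOn g (A n) μ := by
    intro n
    have : IsFiniteMeasure (μ.restrict (A n)) :=
      ⟨by rw [Measure.restrict_apply_univ]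
          exact (measure_mono (hAb n)).trans_lt (hlam.measure_ball_lt_top _ _)⟩
    have h1 : IntegrableOn (G n) (A n) μ := (Lp.memLp (G n)).integrable one_le_two
    exact h1.congr_fun (fun y hy => (hgA n y hy).symm) (hAm n)
  have hball : ∀ x r, ∃ N : ℕ, ball x r ⊆ ⋃ n ∈ Finset.range N, A n := by
    intro x r
    obtain ⟨N, hN⟩ := exists_nat_gt (r + dist x x₀)
    refine ⟨N, fun y hy => ?_⟩
    have h1 : dist y x₀ < N := by
      have := dist_triangle y x x₀
      rw [mem_ball] at hy
      linarith
    simp only [Set.mem_iUnion, Finset.mem_range]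
    exact ⟨⌊dist y x₀⌋₊, (Nat.floor_lt dist_nonneg).2 h1, rfl⟩
  refine ⟨g, fun x r => ?_, fun f x r hf hs hb hi => ?_⟩
  · obtain ⟨N, hN⟩ := hball x r
    exact ((integrableOn_finset_iUnion (s := Finset.range N)).2 fun n _ => hgi n).mono_set hN
  obtain ⟨N, hN⟩ := hball x r
  have hm : ∀ n, MemLp ((A n).indicator f) 1 μ := fun n => (Lp.memLp f).indicator (hAm n)
  let F : ℕ → Lp ℝ 1 μ := fun n => (hm n).toLp _
  have hF : ∀ n, F n =ᵐ[μ] (A n).indicator f := fun n => (hm n).coeFn_toLp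
  have hFs : ∀ n, SupportedIn (F n) (A n) := fun n => by
    filter_upwards [hF n] with y hy hyn
    rw [hy, Set.indicator_of_notMem hyn]
  have hFQ : ∀ n : ℕ, SupportedIn (F n) (ball x₀ (R + n + 1)) := fun n => (hFs n).mono (hAb n)
  have hFt : ∀ n, eLpNorm (F n) ∞ μ < ∞ := fun n => by
    rw [eLpNorm_congr_ae (hF n)]
    exact (eLpNorm_indicator_le _).trans_lt hb
  have hFmem : ∀ n, F n - (∫ y, F n y ∂μ) • φ ∈ hardySpace μ lam ρ p := fun n => by
    obtain ⟨E, hE⟩ := hlam.exists_hardyNorm_sub_le_eLpNorm hρ hp (hQ n) (hφQ n) hφp hφ3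
    have hfin := (hFQ n).eLpNorm_lt_top hlam (le_top : p ≤ ∞) (hFt n)
    exact mem_hardySpace_iff.2 ((hE _ (hFQ n) hfin).trans_lt
      (ENNReal.mul_lt_top ENNReal.coe_lt_top hfin))
  have hsum : ∑ n ∈ Finset.range N, F n = f := by
    refine Lp.ext ?_
    have hall : ∀ᵐ y ∂μ, ∀ n, F n y = (A n).indicator f y := ae_all_iff.2 hF
    have hcoe := Lp.coeFn_finsetSum (Finset.range N) F
    filter_upwards [hall, hcoe, hs] with y h1 h2 h3
    rw [h2, Finset.sum_apply]
    simp only [h1]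
    by_cases hy : ⌊dist y x₀⌋₊ < N
    · rw [Finset.sum_eq_single_of_mem _ (Finset.mem_range.2 hy)]
      · exact Set.indicator_of_mem (s := A ⌊dist y x₀⌋₊) rfl _
      · exact fun n _ hn => Set.indicator_of_notMem (s := A n) (fun h => hn h.symm) _
    · rw [h3 fun hyb => hy ?_]
      · refine Finset.sum_eq_zero fun n hn => Set.indicator_of_notMem (s := A n) (fun h => hy ?_) _
        rw [show _ = n from h]; exact Finset.mem_range.1 hn
      · have := hN hyb
        simp only [Set.mem_iUnion, Finset.mem_range] at this
        obtain ⟨n, hn, h⟩ := this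
        rw [show _ = n from h]; exact hn
  have hsumI : ∑ n ∈ Finset.range N, ∫ y, F n y ∂μ = 0 := by
    rw [← hi, ← hsum, ← integral_finsetSum _ fun n _ => L1.integrable_coeFn (F n)]
    refine integral_congr_ae ?_
    filter_upwards [Lp.coeFn_finsetSum (Finset.range N) F] with y hy
    rw [hy, Finset.sum_apply]
  -- The corrections add up to the integral of `f` times `φ`, which is zero.
  have hfe : (⟨f, hf⟩ : hardySpace μ lam ρ p) = ∑ n ∈ Finset.range N, ⟨_, hFmem n⟩ := by
    refine Subtype.ext ?_
    rw [AddSubmonoidClass.coe_finsetSum, Finset.sum_sub_distrib, hsum, ← Finset.sum_smul, hsumI,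
      zero_smul, sub_zero]
  rw [hfe, map_sum]
  have hloc : ∀ n, L ⟨_, hFmem n⟩ = ∫ y in A n, f y * g y ∂μ := by
    intro n
    rw [hG n (F n) (hFs n) ((hFQ n).eLpNorm_lt_top hlam le_top (hFt n)) (hFmem n)]
    refine setIntegral_congr_ae (hAm n) ?_
    filter_upwards [hF n] with y h1 h2
    rw [h1, Set.indicator_of_mem h2, hgA n y h2]
  simp only [hloc]
  rw [← integral_biUnion_finset (Finset.range N) (fun n _ => hAm n)
    (fun m _ n _ hmn => Set.disjoint_left.2 fun y h1 h2 => hmn (h1.symm.trans h2))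
    fun n _ => integrableOn_mul_of_eLpNorm_top hb (hgi n)]
  refine setIntegral_eq_integral_of_ae_compl_eq_zero ?_
  filter_upwards [hs] with y h1 h2
  rw [h1 fun h => h2 (hN h), zero_mul]

end NonHom

namespace NonHom

open Filter Topology

variable {X : Type*} [MetricSpace X] [MeasurableSpace X] {μ : Measure X} {lam : X → ℝ → ℝ}

/-! ### The oscillation of a function from its action on bounded functions -/

/-- Integration against `g` is bounded by `Λ` in the norm of `H^{1,∞}_{at}(μ)`, on bounded functions
of bounded support. -/
def PairingBound (μ : Measure X) (lam : X → ℝ → ℝ) (ρ : ℝ) (g : X → ℝ) (Λ : ℝ≥0) : Prop :=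
  ∀ (f : Lp ℝ 1 μ) x r, 0 < r → SupportedIn f (ball x r) → eLpNorm f ∞ μ < ∞ → ∫ y, f y ∂μ = 0 →
    |∫ y, f y * g y ∂μ| ≤ Λ * (hardyNorm μ lam ρ ∞ f).toReal

theorem hardyNorm_add_le_of_atoms [Nonempty X] {ρ : ℝ} {q : ℝ≥0∞} (hq : q ≠ 0)
    {f₁ f₂ : Lp ℝ 1 μ} {x y : X} {r s : ℝ} (hr : 0 < r) (hs : 0 < s) (hsub : ball x r ⊆ ball y s)
    (h₁ : SupportedIn f₁ (ball x r)) (h₂ : SupportedIn f₂ (ball y s)) {t₁ t₂ : ℝ≥0}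
    (hf₁ : eLpNorm f₁ q μ ≤ t₁ * atomBound μ lam ρ q x r s)
    (hf₂ : eLpNorm f₂ q μ ≤ t₂ * atomBound μ lam ρ q y s s)
    (hint : ∫ w, (f₁ + f₂ : Lp ℝ 1 μ) w ∂μ = 0) :
    hardyNorm μ lam ρ q (f₁ + f₂) ≤ t₁ + t₂ := by
  have hsum : HasSum (fun j : ℕ => if j = 0 then f₁ else if j = 1 then f₂ else 0) (f₁ + f₂) := by
    have := hasSum_sum_of_ne_finset_zero (L := SummationFilter.unconditional ℕ) (s := Finset.range 2)
      (f := fun j : ℕ => if j = 0 then f₁ else if j = 1 then f₂ else 0) (fun j hj => by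
        have : 1 < j := by simpa using hj
        rw [if_neg (by omega), if_neg (by omega)])
    simpa [Finset.sum_range_succ] using this
  have key := hardyNorm_le_of_hasSum_atoms (lam := lam) (ρ := ρ) hq hs
    (z := fun j => if j = 0 then x else y)
    (s := fun j => if j = 0 then r else s)
    (fun j : ℕ => if j = 0 then t₁ else if j = 1 then t₂ else 0)
    (fun j => by split_ifs <;> assumption)
    (fun j => by split_ifs; exacts [hsub, subset_rfl])
    (fun j => by
      rcases eq_or_ne j 0 with h0 | h0
      · simpa only [h0, if_true] using h₁
      · rcases eq_or_ne j 1 with h1 | h1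
        · simpa only [h1, if_true, one_ne_zero, if_false] using h₂
        · simpa only [h0, h1, if_false] using supportedIn_zero _)
    (fun j => by
      rcases eq_or_ne j 0 with h0 | h0
      · simp only [h0, if_true]; exact hf₁
      · rcases eq_or_ne j 1 with h1 | h1
        · simp only [h1, if_true, one_ne_zero, if_false]; exact hf₂
        · simp only [h0, h1, if_false]
          rw [eLpNorm_congr_ae (Lp.coeFn_zero ℝ 1 μ)]; simp) hsum hint
  refine key.trans (le_of_eq ?_)
  rw [tsum_eq_sum (s := Finset.range 2) (fun j hj => by
    have : 1 < j := by simpa using hj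
    rw [if_neg (by omega), if_neg (by omega)]; rfl)]
  simp [Finset.sum_range_succ]

theorem coe_mul_atomBound_top {ρ : ℝ} {z : X} {s r : ℝ} (hμ : μ (ball z (ρ * s)) ≠ 0)
    (hfin : μ (ball z (ρ * s)) ≠ ∞) (hK : 0 < kCoeff μ lam z s r) {t : ℝ≥0} :
    (t : ℝ≥0∞) ≤ (t * (μ (ball z (ρ * s))).toNNReal * (kCoeff μ lam z s r).toNNReal : ℝ≥0) *
      atomBound μ lam ρ ∞ z s r := by
  have h1 : ((kCoeff μ lam z s r).toNNReal : ℝ≥0∞) = ENNReal.ofReal (kCoeff μ lam z s r) := rfl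
  rw [atomBound, ENNReal.inv_top, ENNReal.toReal_zero, zero_sub, ENNReal.rpow_neg_one,
    ENNReal.coe_mul, ENNReal.coe_mul, ENNReal.coe_toNNReal hfin, h1]
  refine le_of_eq ?_
  have h2 := ENNReal.mul_inv_cancel hμ hfin
  have h3 := ENNReal.mul_inv_cancel (ENNReal.ofReal_pos.2 hK).ne' ENNReal.ofReal_ne_top
  calc (t : ℝ≥0∞) = t * (μ (ball z (ρ * s)) * (μ (ball z (ρ * s)))⁻¹) *
        (ENNReal.ofReal (kCoeff μ lam z s r) * (ENNReal.ofReal (kCoeff μ lam z s r))⁻¹) := by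
          rw [h2, h3, mul_one, mul_one]
    _ = _ := by ring

variable [BorelSpace X]

/-- With `a` the average of `g` over the doubling ball `Q = B(y, s)` and `B = B(x, r)`, the test
function is sign(g - a) 1_B - c 1_Q, where `c` makes the integral zero. Both `f` and `(g - a) 1_Q`
have integral zero, so the pairing equals the integral of |g - a| over `B`. The first piece has
Hardy cost μ(ρB) K_{B,Q}; since `Q` is doubling, the second costs at most a constant times μ(ρB). -/
theorem IsDominating.exists_oscillation_le [Nonempty X] (hX : GeometricallyDoubling X)
    (hlam : IsDominating μ lam) {ρ : ℝ} (hρ : 1 ≤ ρ) (β : ℝ≥0) :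
    ∃ A : ℝ≥0, ∀ g (Λ : ℝ≥0), (∀ x r, IntegrableOn g (ball x r) μ) → PairingBound μ lam ρ g Λ →
      ∀ x y r s, 0 < r → 0 < s → ball x r ⊆ ball y s → DoublingBall μ ρ β y s →
        ∫⁻ w in ball x r, ‖g w - (μ.real (ball y s))⁻¹ * ∫ w in ball y s, g w ∂μ‖ₑ ∂μ ≤
          A * Λ * (kCoeff μ lam x r s).toNNReal * μ (ball x (ρ * r)) := by
  obtain ⟨D, hD1, hD⟩ := hlam.exists_kCoeff_mul_le 1
  refine ⟨1 + β * D.toNNReal, fun g Λ hg hΛ x y r s hr hs hsub hdb => ?_⟩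
  have := hX.secondCountable
  have hgm : AEStronglyMeasurable g μ := (locallyIntegrable_of_ball hg).aestronglyMeasurable
  have hfB := hlam.measure_ball_lt_top x r
  have hfQ := hlam.measure_ball_lt_top y s
  have hfρ := hlam.measure_ball_lt_top x (ρ * r)
  have hBρ : ball x r ⊆ ball x (ρ * r) := ball_subset_ball (by nlinarith)
  have hQρ : ball y s ⊆ ball y (ρ * s) := ball_subset_ball (by nlinarith)
  rcases eq_or_ne (μ (ball x (ρ * r))) 0 with h0 | h0
  · rw [Measure.restrict_eq_zero.2 (measure_mono_null hBρ h0)]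
    simp
  have hQpos : 0 < μ.real (ball y s) := ENNReal.toReal_pos hdb.2.1.ne' hfQ.ne
  set a := (μ.real (ball y s))⁻¹ * ∫ w in ball y s, g w ∂μ with ha
  have haQ : μ.real (ball y s) * a = ∫ w in ball y s, g w ∂μ := by
    rw [ha, mul_inv_cancel_left₀ hQpos.ne']
  let ψ : ℝ → ℝ := fun t => if 0 ≤ t then 1 else -1
  have hψm : Measurable ψ := Measurable.ite measurableSet_Ici measurable_const measurable_const
  have hψa : ∀ t, ψ t * t = |t| := fun t => by
    by_cases h : 0 ≤ t
    · simp [ψ, h, abs_of_nonneg h]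
    · simp [ψ, h, abs_of_neg (not_le.1 h)]
  have hψ1 : ∀ t, ‖ψ t‖ₑ ≤ 1 := fun t => by
    by_cases h : 0 ≤ t <;> simp [ψ, h]
  have hfinB : IsFiniteMeasure (μ.restrict (ball x r)) :=
    ⟨by rwa [Measure.restrict_apply_univ]⟩
  have hψg : AEStronglyMeasurable (fun w => ψ (g w - a)) μ :=
    (hψm.comp_aemeasurable (hgm.aemeasurable.sub_const a)).aestronglyMeasurable
  have hm : MemLp ((ball x r).indicator fun w => ψ (g w - a)) 1 μ := by
    refine (memLp_indicator_iff_restrict measurableSet_ball).2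
      (MemLp.of_bound hψg.restrict 1 (ae_of_all _ fun w => ?_))
    have := hψ1 (g w - a)
    rwa [← enorm_one (G := ℝ), enorm_le_iff_norm_le, norm_one] at this
  set f₁ : Lp ℝ 1 μ := hm.toLp _ with hf₁
  have hc₁ : f₁ =ᵐ[μ] (ball x r).indicator fun w => ψ (g w - a) := hm.coeFn_toLp
  set c : ℝ := (μ.real (ball y s))⁻¹ * ∫ w, f₁ w ∂μ with hc
  have hcQ : μ.real (ball y s) * c = ∫ w, f₁ w ∂μ := by
    rw [hc, mul_inv_cancel_left₀ hQpos.ne']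
  set f₂ : Lp ℝ 1 μ := indicatorConstLp 1 measurableSet_ball hfQ.ne (-c) with hf₂
  have hc₂ : f₂ =ᵐ[μ] (ball y s).indicator fun _ => -c := indicatorConstLp_coeFn
  have hs₁ : SupportedIn f₁ (ball x r) := by
    filter_upwards [hc₁] with w hw hwn
    rw [hw, Set.indicator_of_notMem hwn]
  have hs₂ : SupportedIn f₂ (ball y s) := by
    filter_upwards [hc₂] with w hw hwn
    rw [hw, Set.indicator_of_notMem hwn]
  have hn₁ : eLpNorm f₁ ∞ μ ≤ (1 : ℝ≥0) := by
    rw [eLpNorm_exponent_top]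
    refine eLpNormEssSup_le_of_ae_enorm_bound ?_
    filter_upwards [hc₁] with w hw
    rw [hw]
    refine (enorm_indicator_le_enorm_self _ _).trans ?_
    simpa using hψ1 (g w - a)
  have hn₂ : eLpNorm f₂ ∞ μ ≤ (‖c‖₊ : ℝ≥0) := by
    rw [eLpNorm_exponent_top]
    refine eLpNormEssSup_le_of_ae_enorm_bound ?_
    filter_upwards [hc₂] with w hw
    rw [hw]
    refine (enorm_indicator_le_enorm_self _ _).trans ?_
    rw [enorm_neg]; rfl
  have hi₂ : ∫ w, f₂ w ∂μ = -(μ.real (ball y s) * c) := by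
    rw [integral_congr_ae hc₂, integral_indicator measurableSet_ball, setIntegral_const, smul_eq_mul,
      mul_neg]
  have hi : ∫ w, (f₁ + f₂ : Lp ℝ 1 μ) w ∂μ = 0 := by
    rw [integral_add_Lp, hi₂, hcQ, add_neg_cancel]
  have hI₁ : |∫ w, f₁ w ∂μ| ≤ μ.real (ball x r) := by
    have h1 := enorm_integral_le_enorm f₁
    have h2 : ‖f₁‖ₑ ≤ μ (ball x r) := by
      rw [Lp.enorm_def, eLpNorm_congr_ae hc₁, eLpNorm_one_eq_lintegral_enorm, ← setLIntegral_one]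
      simp only [enorm_indicator_eq_indicator_enorm]
      rw [lintegral_indicator measurableSet_ball]
      exact lintegral_mono fun w => hψ1 _
    have h3 := ENNReal.toReal_mono hfB.ne (h1.trans h2)
    rwa [toReal_enorm] at h3
  have hKx : 0 < kCoeff μ lam x r s := one_pos.trans_le (hlam.one_le_kCoeff x hr s)
  have hKy : 0 < kCoeff μ lam y s s := one_pos.trans_le (hlam.one_le_kCoeff y hs s)
  have hKyD : kCoeff μ lam y s s ≤ D := by simpa using hD y s hs
  have hQ0 : μ (ball y (ρ * s)) ≠ 0 := fun h => hdb.2.1.ne' (measure_mono_null hQρ h)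
  have hnorm := hardyNorm_add_le_of_atoms ENNReal.top_ne_zero hr hs hsub hs₁ hs₂
    (hn₁.trans (coe_mul_atomBound_top h0 hfρ.ne hKx))
    (hn₂.trans (coe_mul_atomBound_top hQ0 (hlam.measure_ball_lt_top _ _).ne hKy)) hi
  have htop : eLpNorm (f₁ + f₂ : Lp ℝ 1 μ) ∞ μ < ∞ := by
    rw [eLpNorm_congr_ae (Lp.coeFn_add _ _)]
    exact (eLpNorm_add_le (Lp.aestronglyMeasurable _) (Lp.aestronglyMeasurable _) le_top).trans_lt
      (ENNReal.add_lt_top.2 ⟨hn₁.trans_lt ENNReal.coe_lt_top, hn₂.trans_lt ENNReal.coe_lt_top⟩)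
  have hpair := hΛ (f₁ + f₂) y s hs ((hs₁.mono hsub).add hs₂) htop hi
  have hgB : IntegrableOn (fun w => |g w - a|) (ball x r) μ :=
    ((hg x r).sub (integrableOn_const hfB.ne)).abs
  have hval : ∫ w, (f₁ + f₂ : Lp ℝ 1 μ) w * g w ∂μ = ∫ w in ball x r, |g w - a| ∂μ := by
    have e1 : (fun w => (f₁ + f₂ : Lp ℝ 1 μ) w * g w) =ᵐ[μ] fun w =>
        (ball x r).indicator (fun w => |g w - a|) w + a * f₁ w +
          (ball y s).indicator (fun w => -c * g w) w := by
      filter_upwards [hc₁, hc₂, Lp.coeFn_add f₁ f₂] with w h1 h2 h3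
      rw [h3, Pi.add_apply, h1, h2, add_mul]
      congr 1
      · by_cases hw : w ∈ ball x r
        · simp only [Set.indicator_of_mem hw]
          rw [← hψa]; ring
        · simp [Set.indicator_of_notMem hw]
      · by_cases hw : w ∈ ball y s
        · simp only [Set.indicator_of_mem hw]
        · simp [Set.indicator_of_notMem hw]
    have i1 : Integrable ((ball x r).indicator (fun w => |g w - a|)) μ :=
      (integrable_indicator_iff measurableSet_ball).2 hgB
    have i2 : Integrable (fun w => a * f₁ w) μ := (L1.integrable_coeFn f₁).const_mul a
    have i3 : Integrable ((ball y s).indicator (fun w => -c * g w)) μ :=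
      (integrable_indicator_iff measurableSet_ball).2 ((hg y s).const_mul _)
    rw [integral_congr_ae e1, integral_add (by exact i1.add i2) i3, integral_add i1 i2,
      integral_indicator measurableSet_ball, integral_indicator measurableSet_ball,
      integral_const_mul, integral_const_mul, ← haQ, ← hcQ]
    ring
  have hnn : 0 ≤ ∫ w in ball x r, |g w - a| ∂μ := integral_nonneg fun w => abs_nonneg _
  rw [hval, abs_of_nonneg hnn] at hpair
  set P : ℝ := μ.real (ball x (ρ * r)) with hP
  have hBP : μ.real (ball x r) ≤ P := ENNReal.toReal_mono hfρ.ne (measure_mono hBρ)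
  have hQβ : μ.real (ball y (ρ * s)) ≤ β * μ.real (ball y s) := by
    have := ENNReal.toReal_mono (ENNReal.mul_lt_top ENNReal.coe_lt_top hfQ).ne hdb.2.2
    rwa [ENNReal.toReal_mul, ENNReal.coe_toReal] at this
  have hcabs : μ.real (ball y s) * |c| ≤ P := by
    rw [← abs_of_pos hQpos, ← abs_mul, hcQ]
    exact hI₁.trans hBP
  have hnormR := ENNReal.toReal_mono (ENNReal.add_ne_top.2 ⟨ENNReal.coe_ne_top, ENNReal.coe_ne_top⟩) hnorm
  rw [ENNReal.toReal_add ENNReal.coe_ne_top ENNReal.coe_ne_top] at hnormR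
  simp only [ENNReal.coe_toReal, NNReal.coe_mul, one_mul, coe_nnnorm,
    Real.norm_eq_abs, Real.coe_toNNReal _ hKx.le, Real.coe_toNNReal _ hKy.le] at hnormR
  change _ ≤ P * _ + |c| * μ.real (ball y (ρ * s)) * _ at hnormR
  have hP0 : 0 ≤ P := ENNReal.toReal_nonneg
  have hK1 := hlam.one_le_kCoeff x hr s
  -- Doubling of `Q` replaces `μ(ρQ)` by `β μ(Q)`, and `μ(Q) |c|` is at most the measure of the
  -- inner ball.
  have e1 : |c| * μ.real (ball y (ρ * s)) * kCoeff μ lam y s s ≤ β * P * D := by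
    have : |c| * μ.real (ball y (ρ * s)) ≤ β * P := by
      calc |c| * μ.real (ball y (ρ * s)) ≤ |c| * (β * μ.real (ball y s)) :=
            mul_le_mul_of_nonneg_left hQβ (abs_nonneg c)
        _ = β * (μ.real (ball y s) * |c|) := by ring
        _ ≤ _ := mul_le_mul_of_nonneg_left hcabs β.2
    exact mul_le_mul this hKyD hKy.le (mul_nonneg β.2 hP0)
  have e2 : β * P * D ≤ β * P * D * kCoeff μ lam x r s :=
    le_mul_of_one_le_right (mul_nonneg (mul_nonneg β.2 hP0) (by linarith)) hK1
  have hfinal : ∫ w in ball x r, |g w - a| ∂μ ≤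
      (1 + β * D) * Λ * kCoeff μ lam x r s * P := by
    refine hpair.trans ?_
    calc Λ * (hardyNorm μ lam ρ ∞ (f₁ + f₂)).toReal
        ≤ Λ * (P * kCoeff μ lam x r s + β * P * D * kCoeff μ lam x r s) :=
          mul_le_mul_of_nonneg_left (by linarith) Λ.2
      _ = _ := by ring
  have hconv : ∫⁻ w in ball x r, ‖g w - a‖ₑ ∂μ =
      ENNReal.ofReal (∫ w in ball x r, |g w - a| ∂μ) := by
    exact (ofReal_integral_norm_eq_lintegral_enorm
      ((hg x r).sub (integrableOn_const (C := a) hfB.ne))).symm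
  rw [hconv]
  refine (ENNReal.ofReal_le_ofReal hfinal).trans (le_of_eq ?_)
  have h1 : μ (ball x (ρ * r)) = ENNReal.ofReal P := (ENNReal.ofReal_toReal hfρ.ne).symm
  rw [h1, ← ENNReal.ofReal_coe_nnreal (p := Λ), ENNReal.coe_add, ENNReal.coe_mul, ENNReal.coe_one,
    ← ENNReal.ofReal_coe_nnreal (p := β), ← ENNReal.ofReal_one]
  change _ = (_ + _ * ENNReal.ofReal D) * _ * ENNReal.ofReal (kCoeff μ lam x r s) * _
  have hD0 : 0 ≤ D := by linarith
  rw [← ENNReal.ofReal_mul β.coe_nonneg, ← ENNReal.ofReal_add zero_le_one (mul_nonneg β.coe_nonneg hD0),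
    ← ENNReal.ofReal_mul (by positivity), ← ENNReal.ofReal_mul (by positivity),
    ← ENNReal.ofReal_mul (by positivity)]

end NonHom

/-! ### RBMO coefficients from averages over doubling balls. -/

namespace NonHom

open Filter Topology

variable {X : Type*} [MetricSpace X] [MeasurableSpace X] {μ : Measure X} {lam : X → ℝ → ℝ}
  [BorelSpace X]

/-- Both averages are close to `g` in mean over the inner ball, by the oscillation bound applied to
the pairs (B, B) and (B, Q). Doubling of the inner ball allows division by its measure. -/
theorem IsDominating.exists_average_sub_le [Nonempty X] (hX : GeometricallyDoubling X)
    (hlam : IsDominating μ lam) {ρ : ℝ} (hρ : 1 ≤ ρ) (β : ℝ≥0) :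
    ∃ A : ℝ≥0, ∀ g (Λ : ℝ≥0), (∀ x r, IntegrableOn g (ball x r) μ) → PairingBound μ lam ρ g Λ →
      ∀ x y r s, ball x r ⊆ ball y s → DoublingBall μ ρ β x r → DoublingBall μ ρ β y s →
        |(μ.real (ball x r))⁻¹ * ∫ w in ball x r, g w ∂μ -
          (μ.real (ball y s))⁻¹ * ∫ w in ball y s, g w ∂μ| ≤ A * Λ * kCoeff μ lam x r s := by
  obtain ⟨A, hA⟩ := hlam.exists_oscillation_le hX hρ β
  obtain ⟨D, hD1, hD⟩ := hlam.exists_kCoeff_mul_le 1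
  refine ⟨A * β * (D.toNNReal + 1), fun g Λ hg hΛ x y r s hsub hx hy => ?_⟩
  have := hX.secondCountable
  have hgm : AEStronglyMeasurable g μ := (locallyIntegrable_of_ball hg).aestronglyMeasurable
  have h1 := hA g Λ hg hΛ x x r r hx.1 hx.1 subset_rfl hx
  have h2 := hA g Λ hg hΛ x y r s hx.1 hy.1 hsub hy
  set a := (μ.real (ball x r))⁻¹ * ∫ w in ball x r, g w ∂μ
  set b := (μ.real (ball y s))⁻¹ * ∫ w in ball y s, g w ∂μ
  have h3 := (enorm_sub_mul_le g hgm a b (ball x r)).trans (add_le_add h1 h2)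
  have hK := hlam.one_le_kCoeff x hx.1 s
  have hKr : kCoeff μ lam x r r ≤ D := by simpa using hD x r hx.1
  set k := (kCoeff μ lam x r s).toNNReal with hk
  have hk1 : (1 : ℝ≥0) ≤ k := Real.one_le_toNNReal.2 hK
  have h4 : ‖a - b‖ₑ * μ (ball x r) ≤ (A * β * (D.toNNReal + 1) * Λ * k : ℝ≥0) * μ (ball x r) := by
    refine h3.trans ?_
    have e1 : (A * Λ * (kCoeff μ lam x r r).toNNReal + A * Λ * k : ℝ≥0) ≤
        A * Λ * ((D.toNNReal + 1) * k) := by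
      rw [← mul_add]
      refine mul_le_mul_right ?_ _
      rw [add_mul, one_mul]
      exact add_le_add_left ((Real.toNNReal_le_toNNReal hKr).trans
        (le_mul_of_one_le_right zero_le hk1)) _
    calc _ = ((A * Λ * (kCoeff μ lam x r r).toNNReal + A * Λ * k : ℝ≥0) : ℝ≥0∞) *
          μ (ball x (ρ * r)) := by push_cast; ring
      _ ≤ ((A * Λ * ((D.toNNReal + 1) * k) : ℝ≥0) : ℝ≥0∞) * (β * μ (ball x r)) :=
          mul_le_mul' (ENNReal.coe_le_coe.2 e1) hx.2.2
      _ = _ := by push_cast; ring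
  have h5 := (ENNReal.mul_le_mul_iff_left hx.2.1.ne' (hlam.measure_ball_lt_top _ _).ne).1 h4
  have h6 := ENNReal.toReal_mono ENNReal.coe_ne_top h5
  rw [toReal_enorm, Real.norm_eq_abs] at h6
  refine h6.trans (le_of_eq ?_)
  rw [ENNReal.coe_toReal, NNReal.coe_mul, hk, Real.coe_toNNReal _ (by linarith)]
  push_cast
  ring

/-- A function that acts boundedly on bounded functions has bounded oscillation. -/
theorem IsDominating.exists_oscBound_of_pairingBound [Nonempty X] (hX : GeometricallyDoubling X)
    (hlam : IsDominating μ lam) {ρ : ℝ} (hρ : 1 < ρ) :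
    ∃ A : ℝ≥0, ∀ g (Λ : ℝ≥0), (∀ x r, IntegrableOn g (ball x r) μ) → PairingBound μ lam ρ g Λ →
      ∃ m, OscBound μ lam ρ g m (A * Λ) := by
  rcases eq_or_ne μ 0 with hμ | hμ
  · exact ⟨0, fun g Λ _ _ => ⟨0, fun x r hr => by simp [hμ], by simp⟩⟩
  obtain ⟨β, -, C, hC1, -, hdb, -⟩ := hlam.exists_doubling_constants hX ρ hρ
  replace hdb := hdb hμ
  obtain ⟨A₁, hA₁⟩ := hlam.exists_oscillation_le hX hρ.le β
  obtain ⟨A₂, hA₂⟩ := hlam.exists_average_sub_le hX hρ.le β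
  obtain ⟨D₁, hD₁, h₁⟩ := hlam.exists_kCoeff_mul_le 2
  obtain ⟨D₂, hD₂, h₂⟩ := hlam.exists_kCoeff_le_of_dist_le
  obtain ⟨D₃, hD₃, h₃⟩ := hlam.exists_kCoeff_le_of_subset
  set E : ℝ := 1 + D₂ * C + D₂ * (D₁ + C) + D₂ * (D₃ + C) + (D₁ + C) with hE
  -- `r'` and `s'` are radii of doubling enlargements, and `T` is that of a doubling ball about `y`
  -- which will contain both. Centres are exchanged only at radii at least `s`, which dominates
  -- `dist x y`; `D₃` covers the possibility that `r` exceeds `s`.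
  have hgeom : ∀ x y r s r' s' T, 0 < r → 0 < s → ball x r ⊆ ball y s → r ≤ r' → s ≤ s' →
      kCoeff μ lam x r r' ≤ C → kCoeff μ lam y s s' ≤ C →
      kCoeff μ lam y (2 * max r' s') T ≤ C →
      kCoeff μ lam x r' T ≤ E * kCoeff μ lam x r s ∧
        kCoeff μ lam y s' T ≤ E * kCoeff μ lam x r s := by
    intro x y r s r' s' T hr hs hsub hr' hs' hCx hCy hCT
    have hr'0 := hr.trans_le hr'
    have hs'0 := hs.trans_le hs'
    have hxy : dist x y ≤ s := (mem_ball.1 (hsub (mem_ball_self hr))).le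
    have hyx : dist y x ≤ s := by rwa [dist_comm]
    have hK := hlam.one_le_kCoeff x hr s
    have hE0 : 0 ≤ D₂ * C ∧ 0 ≤ D₂ * (D₁ + C) ∧ 0 ≤ D₂ * (D₃ + C) ∧ 0 ≤ D₁ + C := by
      refine ⟨?_, ?_, ?_, ?_⟩ <;> positivity
    obtain ⟨p1, p2, p3, p4⟩ := hE0
    have hfar : kCoeff μ lam y (max r' s') T ≤ D₁ + C :=
      (hlam.kCoeff_le_add y (lt_max_of_lt_left hr'0) (by positivity) T).trans
        (add_le_add (h₁ y _ (lt_max_of_lt_left hr'0)) hCT)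
    rcases le_total r' s' with hle | hle
    · rw [max_eq_right hle] at hfar
      refine ⟨?_, ?_⟩
      · have e1 := hlam.kCoeff_le_add x hr'0 hs'0 T
        have e2 := hlam.kCoeff_mono x hr hr' (le_refl s')
        have e3 := hlam.kCoeff_le_add x hr hs s'
        have e4 := (h₂ x y s s' hs hxy).trans (mul_le_mul_of_nonneg_left hCy (by linarith))
        have e5 := (h₂ x y s' T hs'0 (hxy.trans hs')).trans
          (mul_le_mul_of_nonneg_left hfar (by linarith))
        calc kCoeff μ lam x r' T ≤ 1 * kCoeff μ lam x r s + (D₂ * C + D₂ * (D₁ + C)) := by linarith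
          _ ≤ 1 * kCoeff μ lam x r s + (D₂ * C + D₂ * (D₁ + C)) * kCoeff μ lam x r s := by
              gcongr; exact le_mul_of_one_le_right (by linarith) hK
          _ = (1 + D₂ * C + D₂ * (D₁ + C)) * kCoeff μ lam x r s := by ring
          _ ≤ _ := mul_le_mul_of_nonneg_right (by linarith) (by linarith)
      · calc kCoeff μ lam y s' T ≤ D₁ + C := hfar
          _ ≤ E := by linarith
          _ ≤ _ := le_mul_of_one_le_right (by linarith) hK
    · rw [max_eq_left hle] at hfar
      refine ⟨?_, ?_⟩
      · have e5 := (h₂ x y r' T hr'0 (hxy.trans (hs'.trans hle))).trans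
          (mul_le_mul_of_nonneg_left hfar (by linarith))
        calc kCoeff μ lam x r' T ≤ E := by linarith
          _ ≤ _ := le_mul_of_one_le_right (by linarith) hK
      · have e1 := hlam.kCoeff_mono y hs hs' (le_refl T)
        have e2 := hlam.kCoeff_le_add y hs hr'0 T
        have e3 := hlam.kCoeff_le_add x hs hr r'
        have e4 := h₃ x y r s hr hs hsub
        have e5 := (h₂ y x s r' hs hyx).trans
          (mul_le_mul_of_nonneg_left (e3.trans (add_le_add e4 hCx)) (by linarith))
        calc kCoeff μ lam y s' T ≤ E := by linarith
          _ ≤ _ := le_mul_of_one_le_right (by linarith) hK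
  have hex : ∀ x r, ∃ t, 0 < r → r ≤ t ∧ DoublingBall μ ρ β x t ∧ kCoeff μ lam x r t ≤ C :=
    fun x r => by
      by_cases hr : 0 < r
      · obtain ⟨t, ht⟩ := hdb x r hr; exact ⟨t, fun _ => ht⟩
      · exact ⟨0, fun h => absurd h hr⟩
  -- The number attached to a ball is the average over a concentric doubling ball at bounded `K`.
  choose t ht using hex
  refine ⟨A₁ * C.toNNReal + 2 * A₂ * E.toNNReal, fun g Λ hg hΛ =>
    ⟨fun x r => (μ.real (ball x (t x r)))⁻¹ * ∫ w in ball x (t x r), g w ∂μ, ?_, ?_⟩⟩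
  · intro x r hr
    obtain ⟨h1, h2, h3⟩ := ht x r hr
    refine (hA₁ g Λ hg hΛ x x r (t x r) hr h2.1 (ball_subset_ball h1) h2).trans ?_
    refine mul_le_mul_left ?_ _
    have h4 : (kCoeff μ lam x r (t x r)).toNNReal ≤ C.toNNReal := Real.toNNReal_le_toNNReal h3
    have : A₁ * Λ * (kCoeff μ lam x r (t x r)).toNNReal ≤
        (A₁ * C.toNNReal + 2 * A₂ * E.toNNReal) * Λ := by
      calc A₁ * Λ * (kCoeff μ lam x r (t x r)).toNNReal ≤ A₁ * Λ * C.toNNReal :=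
            mul_le_mul_right h4 _
        _ = A₁ * C.toNNReal * Λ := by ring
        _ ≤ _ := mul_le_mul_left le_self_add _
    exact_mod_cast this
  · intro x y r s hr hs hsub
    obtain ⟨hx1, hx2, hx3⟩ := ht x r hr
    obtain ⟨hy1, hy2, hy3⟩ := ht y s hs
    set M := max (t x r) (t y s) with hM
    have hM0 : 0 < 2 * M := by have := lt_max_of_lt_left (c := t y s) hx2.1; linarith
    obtain ⟨hz1, hz2, hz3⟩ := ht y (2 * M) hM0
    set T := t y (2 * M)
    obtain ⟨hg1, hg2⟩ := hgeom x y r s _ _ T hr hs hsub hx1 hy1 hx3 hy3 hz3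
    have hxy := mem_ball.1 (hsub (mem_ball_self hr))
    have hMx := le_max_left (t x r) (t y s)
    have hMy := le_max_right (t x r) (t y s)
    have h1 := hA₂ g Λ hg hΛ x y _ T (ball_subset_ball' (by linarith)) hx2 hz2
    have h2 := hA₂ g Λ hg hΛ y y _ T (ball_subset_ball (by linarith [hy2.1])) hy2 hz2
    set mx := (μ.real (ball x (t x r)))⁻¹ * ∫ w in ball x (t x r), g w ∂μ
    set my := (μ.real (ball y (t y s)))⁻¹ * ∫ w in ball y (t y s), g w ∂μ
    set mz := (μ.real (ball y T))⁻¹ * ∫ w in ball y T, g w ∂μ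
    have h3 := abs_sub_le mx mz my
    rw [abs_sub_comm mz my] at h3
    have hK := hlam.one_le_kCoeff x hr s
    have hAΛ : (0 : ℝ) ≤ A₂ * Λ := by positivity
    have h4 := mul_le_mul_of_nonneg_left hg1 hAΛ
    have h5 := mul_le_mul_of_nonneg_left hg2 hAΛ
    have hE0 : 0 ≤ E := by positivity
    push_cast
    rw [Real.coe_toNNReal E hE0, Real.coe_toNNReal C (by linarith)]
    have h6 : (0 : ℝ) ≤ A₁ * C * Λ * kCoeff μ lam x r s := by positivity
    calc |mx - my| ≤ 2 * A₂ * E * Λ * kCoeff μ lam x r s := by linarith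
      _ ≤ _ := by linarith

end NonHom

/-! ### Bounded functionals are given by RBMO functions. -/

namespace NonHom

open Filter Topology

variable {X : Type*} [MetricSpace X] [MeasurableSpace X] {μ : Measure X} {lam : X → ℝ → ℝ}
  [BorelSpace X]

theorem IsDominating.abs_sub_apply_le [Nonempty X] (hlam : IsDominating μ lam) {ρ : ℝ} (hρ : 1 ≤ ρ)
    {p : ℝ≥0∞} (hp : 1 ≤ p) {L L' : hardySpace μ lam ρ p →ₗ[ℝ] ℝ} {M M' : ℝ}
    (hL : ∀ f, |L f| ≤ M * hardySeminorm hlam hρ hp f)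
    (hL' : ∀ f, |L' f| ≤ M' * hardySeminorm hlam hρ hp f) (f : hardySpace μ lam ρ p) :
    |(L - L') f| ≤ (M + M') * hardySeminorm hlam hρ hp f := by
  rw [LinearMap.sub_apply, add_mul]
  exact (abs_sub _ _).trans (add_le_add (hL f) (hL' f))

/-- There is at most one bounded functional given by integration against an RBMO function. -/
theorem IsIntegrationAgainst.unique [Nonempty X] (hX : GeometricallyDoubling X)
    (hlam : IsDominating μ lam) {σ ρ : ℝ} (hσ : 1 < σ) (hρ : 1 < ρ) {p : ℝ≥0∞} (hp : 1 < p)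
    (hp' : p < ∞) {g : X → ℝ} {m : X → ℝ → ℝ} {C : ℝ≥0}
    (hg : ∀ x r, IntegrableOn g (ball x r) μ) (hm : OscBound μ lam σ g m C)
    {L L' : hardySpace μ lam ρ p →ₗ[ℝ] ℝ} {M M' : ℝ}
    (hL : ∀ f, |L f| ≤ M * hardySeminorm hlam hρ.le hp.le f)
    (hL' : ∀ f, |L' f| ≤ M' * hardySeminorm hlam hρ.le hp.le f)
    (h : IsIntegrationAgainst g L) (h' : IsIntegrationAgainst g L') : L = L' := by
  obtain ⟨A, hA⟩ := hlam.exists_block_pairing hX σ ρ hσ hρ p hp hp'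
  refine sub_eq_zero.1 (hlam.eq_zero_of_blocks hρ.le hp.le (hlam.abs_sub_apply_le hρ.le hp.le hL hL')
    fun b c hb hc hbm => ?_)
  have hi := (hA g m C hg hm b c hb hc).1
  rw [LinearMap.sub_apply, h ⟨b, hbm⟩ hi, h' ⟨b, hbm⟩ hi, sub_self]

/-- Every bounded functional is given by integration against an RBMO function, whose oscillation
is controlled by the size of the functional on `H^{1,∞}_{at}(μ)`. -/
theorem IsDominating.exists_rbmo_representation [Nonempty X] (hX : GeometricallyDoubling X)
    (hlam : IsDominating μ lam) {σ ρ ρ₀ : ℝ} (hσ : 1 < σ) (hρ : 1 < ρ) (hρ₀ : ρ ≤ ρ₀) {p : ℝ≥0∞}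
    (hp : 1 < p) (hp2 : p ≤ 2) :
    ∃ A B : ℝ≥0, ∀ (L : hardySpace μ lam ρ p →ₗ[ℝ] ℝ) (M : ℝ),
      (∀ f, |L f| ≤ M * hardySeminorm hlam hρ.le hp.le f) →
      ∃ g : X → ℝ, (∀ x r, IntegrableOn g (ball x r) μ) ∧ IsIntegrationAgainst g L ∧
        ∀ Λ : ℝ≥0, (∀ f hf, f ∈ hardySpace μ lam ρ₀ ∞ →
            |L ⟨f, hf⟩| ≤ Λ * (hardyNorm μ lam ρ₀ ∞ f).toReal) →
          (∃ m, OscBound μ lam σ g m (A * Λ)) ∧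
          ∀ f, |L f| ≤ B * Λ * hardySeminorm hlam hρ.le hp.le f := by
  have hp' : p < ∞ := hp2.trans_lt ENNReal.ofNat_lt_top
  have hρ₀1 : 1 < ρ₀ := hρ.trans_le hρ₀
  obtain ⟨A₁, hA₁⟩ := hlam.exists_oscBound_of_pairingBound hX hρ₀1
  obtain ⟨A₂, hA₂⟩ := hlam.exists_oscBound_of_oscBound hX ρ₀ σ hρ₀1 hσ
  obtain ⟨A₃, hA₃⟩ := hlam.exists_functional hX σ ρ hσ hρ p hp hp'
  refine ⟨A₂ * A₁, A₃ * (A₂ * A₁), fun L M hL => ?_⟩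
  obtain ⟨g, hg, hLg⟩ := hlam.exists_representation hρ.le hp.le hp2 hL
  have key : ∀ Λ : ℝ≥0, (∀ f hf, f ∈ hardySpace μ lam ρ₀ ∞ →
      |L ⟨f, hf⟩| ≤ Λ * (hardyNorm μ lam ρ₀ ∞ f).toReal) →
      (∃ m, OscBound μ lam σ g m (A₂ * A₁ * Λ)) ∧
      (∀ f, |L f| ≤ A₃ * (A₂ * A₁) * Λ * hardySeminorm hlam hρ.le hp.le f) ∧
      IsIntegrationAgainst g L := by
    intro Λ hΛ
    have hpair : PairingBound μ lam ρ₀ g Λ := by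
      intro f x r hr hs hb hi
      have hfp := hlam.mem_hardySpace_of_integral_eq_zero hρ.le hp.le hr hs
        (hs.eLpNorm_lt_top hlam le_top hb) hi
      rw [← hLg f x r hfp hs hb hi]
      exact hΛ f hfp (hlam.mem_hardySpace_of_integral_eq_zero hρ₀1.le le_top hr hs hb hi)
    obtain ⟨m, hm⟩ := hA₁ g Λ hg hpair
    have hm' := hA₂ g m _ hm
    obtain ⟨L', hL', hI⟩ := hA₃ g m _ hg hm'
    -- `L` agrees on bounded functions with the functional that `g` defines, and both are bounded on
    -- the Hardy space, so density identifies them. Thus `L` inherits a bound in terms of `Λ` alone.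
    have hD := hlam.eq_zero_of_bounded hρ.le hp.le hp'.ne (hlam.abs_sub_apply_le _ _ hL hL')
      (fun f x r hf hr hs hb hi => by
        rw [LinearMap.sub_apply, hLg f x r hf hs hb hi, hI ⟨f, hf⟩
          (hs.integrable_mul measurableSet_ball (integrableOn_mul_of_eLpNorm_top hb (hg x r))),
          sub_self])
    rw [sub_eq_zero.1 hD]
    refine ⟨⟨m, by rwa [mul_assoc]⟩, fun f => (hL' f).trans (le_of_eq ?_), hI⟩
    push_cast; ring
  -- The given bound `M` supplies one admissible `Λ`, which is enough for integration against `g`;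
  -- since `g` does not depend on `Λ`, sharper values may be used afterwards.
  have hM : ∀ f hf, f ∈ hardySpace μ lam ρ₀ ∞ →
      |L ⟨f, hf⟩| ≤ ‖M‖₊ * (hardyNorm μ lam ρ₀ ∞ f).toReal := by
    intro f hf hf0
    refine (hL ⟨f, hf⟩).trans ?_
    have h1 := ENNReal.toReal_mono (mem_hardySpace_iff.1 hf0).ne
      (hardyNorm_mono hlam.measure_ball_lt_top le_top hp.le hρ₀ hρ.le f)
    rw [hardySeminorm_apply]
    exact mul_le_mul (le_abs_self M) h1 ENNReal.toReal_nonneg (abs_nonneg M)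
  exact ⟨g, hg, (key _ hM).2.2, fun Λ hΛ => ⟨(key Λ hΛ).1, by
    simpa only [NNReal.coe_mul] using (key Λ hΛ).2.1⟩⟩

end NonHom

namespace NonHom

open Filter Topology

/-! ### A duality criterion for approximation in a stronger norm -/

section HahnBanach

variable {U V : Type*} [AddCommGroup U] [Module ℝ U] [AddCommGroup V] [Module ℝ V]

theorem exists_linearMap_le_seminorm (N : Seminorm ℝ V) (v : V) :
    ∃ L : V →ₗ[ℝ] ℝ, L v = N v ∧ ∀ x, |L x| ≤ N x := by
  suffices h : ∃ L : V →ₗ[ℝ] ℝ, L v = N v ∧ ∀ x, L x ≤ N x by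
    obtain ⟨L, hv, hL⟩ := h
    refine ⟨L, hv, fun x => abs_le.2 ⟨?_, hL x⟩⟩
    have := hL (-x)
    rw [map_neg, map_neg_eq_map] at this
    linarith
  rcases eq_or_ne v 0 with rfl | hv
  · exact ⟨0, by simp, fun x => by simp⟩
  obtain ⟨L, h1, h2⟩ := exists_extension_of_le_sublinear
    (LinearPMap.mkSpanSingleton v (N v) hv) N
    (fun c hc x => by rw [map_smul_eq_mul, Real.norm_of_nonneg hc.le]) (map_add_le_add N)
    (by
      rintro ⟨x, hx⟩
      obtain ⟨c, rfl⟩ := Submodule.mem_span_singleton.1 hx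
      have h0 : LinearPMap.mkSpanSingleton v (N v) hv ⟨c • v, hx⟩ = c • N v :=
        LinearPMap.mkSpanSingleton'_apply _ _ _ c _
      rw [h0]
      simp only [map_smul_eq_mul, smul_eq_mul]
      exact mul_le_mul_of_nonneg_right (le_abs_self c) (apply_nonneg N v))
  refine ⟨L, ?_, h2⟩
  have := h1 ⟨v, Submodule.mem_span_singleton_self v⟩
  rw [this]
  exact LinearPMap.mkSpanSingleton_apply ℝ ℝ hv (N v)

/-- The infimal convolution of the image of a seminorm and a seminorm. -/
noncomputable def infConvolution (nU : Seminorm ℝ U) (nV : Seminorm ℝ V) (ι : U →ₗ[ℝ] V) :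
    Seminorm ℝ V :=
  have hbdd : ∀ x : V, BddBelow (Set.range fun u : U => nU u + nV (x - ι u)) := fun x =>
    ⟨0, by rintro _ ⟨u, rfl⟩; positivity⟩
  Seminorm.ofSMulLE (fun x => ⨅ u : U, nU u + nV (x - ι u))
    (le_antisymm (ciInf_le_of_le (hbdd 0) 0 (by simp)) (Real.iInf_nonneg fun u => by positivity))
    (fun x y => by
      rw [← sub_le_iff_le_add]
      refine le_ciInf fun u => ?_
      rw [sub_le_comm]
      refine le_ciInf fun w => ?_
      rw [sub_le_iff_le_add]
      refine (ciInf_le (hbdd _) (w + u)).trans ?_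
      have h1 := map_add_le_add nU w u
      have h2 := map_add_le_add nV (x - ι u) (y - ι w)
      have h3 : x + y - ι (w + u) = x - ι u + (y - ι w) := by rw [map_add]; abel
      rw [h3]
      linarith)
    (fun c x => by
      rw [Real.mul_iInf_of_nonneg (norm_nonneg c)]
      refine le_ciInf fun u => (ciInf_le (hbdd _) (c • u)).trans (le_of_eq ?_)
      rw [ι.map_smul, ← smul_sub, map_smul_eq_mul, map_smul_eq_mul, mul_add])

theorem infConvolution_apply (nU : Seminorm ℝ U) (nV : Seminorm ℝ V) (ι : U →ₗ[ℝ] V) (x : V) :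
    infConvolution nU nV ι x = ⨅ u : U, nU u + nV (x - ι u) := rfl

theorem infConvolution_le (nU : Seminorm ℝ U) (nV : Seminorm ℝ V) (ι : U →ₗ[ℝ] V) (x : V) (u : U) :
    infConvolution nU nV ι x ≤ nU u + nV (x - ι u) :=
  ciInf_le ⟨0, by rintro _ ⟨u, rfl⟩; positivity⟩ u

/-- Hahn-Banach gives a functional that attains the infimal convolution of `nU` and `K • nV` at `v`
and is dominated by it. It is then bounded by `nU` on `U`, so by hypothesis its value at `v` is at
most `C * nV v`, and a nearly optimal `u` is the approximation. -/
theorem exists_approx_of_dual_bound (nU : Seminorm ℝ U) (nV : Seminorm ℝ V) (ι : U →ₗ[ℝ] V) {C : ℝ}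
    (hC : 0 ≤ C)
    (h : ∀ L : V →ₗ[ℝ] ℝ, (∃ M : ℝ, ∀ v, |L v| ≤ M * nV v) → (∀ u, |L (ι u)| ≤ nU u) →
      ∀ v, |L v| ≤ C * nV v) (v : V) {ε : ℝ} (hε : 0 < ε) :
    ∃ u, nU u ≤ C * nV v + ε ∧ nV (v - ι u) ≤ ε := by
  have hD : 0 < C * nV v + ε := by positivity
  -- The weight that makes a total cost below `C * nV v + ε` force an error of at most `ε`.
  set K : ℝ≥0 := ⟨(C * nV v + ε) / ε, by positivity⟩ with hK
  obtain ⟨L, hLv, hL⟩ := exists_linearMap_le_seminorm (infConvolution nU (K • nV) ι) v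
  have hb := h L ⟨K, fun w => (hL w).trans ((infConvolution_le _ _ _ w 0).trans (by simp; rfl))⟩
    (fun u => (hL _).trans ((infConvolution_le _ _ _ _ u).trans (by simp))) v
  have hlt : infConvolution nU (K • nV) ι v < C * nV v + ε := by
    rw [← hLv]
    linarith [le_abs_self (L v)]
  rw [infConvolution_apply] at hlt
  obtain ⟨u, hu⟩ := exists_lt_of_ciInf_lt hlt
  have h1 : 0 ≤ (K • nV) (v - ι u) := apply_nonneg _ _
  have h2 : 0 ≤ nU u := apply_nonneg _ _
  refine ⟨u, by linarith, ?_⟩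
  have h3 : (C * nV v + ε) / ε * nV (v - ι u) ≤ C * nV v + ε := by
    have : (K • nV) (v - ι u) = (C * nV v + ε) / ε * nV (v - ι u) := rfl
    rw [← this]; linarith
  rw [div_mul_eq_mul_div, div_le_iff₀ hε] at h3
  exact le_of_mul_le_mul_left h3 hD

end HahnBanach

/-! ### Comparison of the Hardy norms for finite and infinite exponent. -/

variable {X : Type*} [MetricSpace X] [MeasurableSpace X] {μ : Measure X} {lam : X → ℝ → ℝ}
  [BorelSpace X]

/-- The Hardy spaces with small exponents are contained in those with exponent `∞`. -/
theorem IsDominating.exists_hardyNorm_top_le [Nonempty X] (hX : GeometricallyDoubling X)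
    (hlam : IsDominating μ lam) {ρ ρ₀ : ℝ} (hρ : 1 < ρ) (hρ₀ : ρ ≤ ρ₀) {p : ℝ≥0∞}
    (hp : 1 < p) (hp2 : p ≤ 2) :
    ∃ C : ℝ≥0, ∀ f, hardyNorm μ lam ρ₀ ∞ f ≤ C * hardyNorm μ lam ρ p f := by
  obtain ⟨_, B, hB⟩ := hlam.exists_rbmo_representation hX hρ hρ hρ₀ hp hp2
  have hρ₀1 : 1 ≤ ρ₀ := (hρ.trans_le hρ₀).le
  have hmono : hardySpace μ lam ρ₀ ∞ ≤ hardySpace μ lam ρ p := fun f hf =>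
    mem_hardySpace_iff.2 ((hardyNorm_mono hlam.measure_ball_lt_top le_top hp.le hρ₀ hρ.le f).trans_lt
      (mem_hardySpace_iff.1 hf))
  set ι := Submodule.inclusion hmono
  set nU := hardySeminorm hlam hρ₀1 (le_top : 1 ≤ (∞ : ℝ≥0∞)) with hnU
  set nV := hardySeminorm hlam hρ.le hp.le with hnV
  have happ := exists_approx_of_dual_bound nU nV ι B.coe_nonneg
    (fun L ⟨M, hM⟩ hLU v => by
      obtain ⟨g, -, -, hg⟩ := hB L M hM
      simpa using (hg 1 fun f hf hf0 => by
        rw [NNReal.coe_one, one_mul]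
        exact hLU ⟨f, hf0⟩).2 v)
  have key : ∀ (v : hardySpace μ lam ρ p) (ε : ℝ≥0), 0 < ε →
      hardyNorm μ lam ρ₀ ∞ (v : Lp ℝ 1 μ) ≤
        B * hardyNorm μ lam ρ p (v : Lp ℝ 1 μ) + (2 * B + 2) * ε := by
    intro v ε hε
    have hεn : ∀ n : ℕ, (0 : ℝ) < ε * (1 / 2) ^ n := fun n => by positivity
    choose T hT1 hT2 using fun (n : ℕ) (w : hardySpace μ lam ρ p) => happ w (hεn n)
    -- Successive approximation of remainders: `w n` is what is left after `n` steps, with errors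
    -- decreasing geometrically, so only the first approximant costs a multiple of the norm of `v`.
    -- The approximants sum to `v` in `L¹`, and countable subadditivity bounds the norm of the sum.
    obtain ⟨w, hw0, hws⟩ : ∃ w : ℕ → hardySpace μ lam ρ p,
        w 0 = v ∧ ∀ n, w (n + 1) = w n - ι (T n (w n)) :=
      ⟨fun n => Nat.rec v (fun n w => w - ι (T n w)) n, rfl, fun _ => rfl⟩
    let u : ℕ → hardySpace μ lam ρ₀ ∞ := fun n => T n (w n)
    have hwn : ∀ n, nV (w (n + 1)) ≤ ε * (1 / 2) ^ n := fun n => by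
      rw [hws]; exact hT2 n (w n)
    have hun : ∀ n, nU (u n) ≤ B * nV (w n) + ε * (1 / 2) ^ n := fun n => hT1 n (w n)
    have htoV : ∀ x : hardySpace μ lam ρ p,
        hardyNorm μ lam ρ p (x : Lp ℝ 1 μ) = ENNReal.ofReal (nV x) := fun x => by
      rw [hnV, hardySeminorm_apply, ENNReal.ofReal_toReal (mem_hardySpace_iff.1 x.2).ne]
    have htoU : ∀ x : hardySpace μ lam ρ₀ ∞,
        hardyNorm μ lam ρ₀ ∞ (x : Lp ℝ 1 μ) = ENNReal.ofReal (nU x) := fun x => by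
      rw [hnU, hardySeminorm_apply, ENNReal.ofReal_toReal (mem_hardySpace_iff.1 x.2).ne]
    have hgeom : ∑' n : ℕ, ENNReal.ofReal (ε * (1 / 2) ^ n) = 2 * ε := by
      rw [← ENNReal.ofReal_tsum_of_nonneg (fun n => (hεn n).le)
        (summable_geometric_two.mul_left _), tsum_mul_left, tsum_geometric_two,
        ENNReal.ofReal_mul ε.coe_nonneg, ENNReal.ofReal_coe_nnreal, ENNReal.ofReal_ofNat, mul_comm]
    have hsumU : ∑' n, hardyNorm μ lam ρ₀ ∞ (u n : Lp ℝ 1 μ) ≤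
        B * hardyNorm μ lam ρ p (v : Lp ℝ 1 μ) + (2 * B + 2) * ε := by
      have h1 : ∀ n, hardyNorm μ lam ρ₀ ∞ (u n : Lp ℝ 1 μ) ≤
          B * ENNReal.ofReal (nV (w n)) + ENNReal.ofReal (ε * (1 / 2) ^ n) := by
        intro n
        rw [htoU]
        refine (ENNReal.ofReal_le_ofReal (hun n)).trans (ENNReal.ofReal_add_le.trans (le_of_eq ?_))
        rw [ENNReal.ofReal_mul B.coe_nonneg, ENNReal.ofReal_coe_nnreal]
      refine (ENNReal.tsum_le_tsum h1).trans ?_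
      rw [ENNReal.tsum_add, hgeom, ENNReal.tsum_mul_left, tsum_eq_zero_add' ENNReal.summable, hw0,
        ← htoV]
      have h2 : ∑' n, ENNReal.ofReal (nV (w (n + 1))) ≤ 2 * ε :=
        hgeom ▸ ENNReal.tsum_le_tsum fun n => ENNReal.ofReal_le_ofReal (hwn n)
      calc _ ≤ B * (hardyNorm μ lam ρ p (v : Lp ℝ 1 μ) + 2 * ε) + 2 * ε := by gcongr
        _ = _ := by ring
    have hfin : B * hardyNorm μ lam ρ p (v : Lp ℝ 1 μ) + (2 * B + 2) * ε < ∞ := by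
      rw [htoV]
      exact ENNReal.add_lt_top.2 ⟨ENNReal.mul_lt_top ENNReal.coe_lt_top ENNReal.ofReal_lt_top,
        ENNReal.mul_lt_top (by finiteness) ENNReal.coe_lt_top⟩
    have hsummable : Summable fun n => (u n : Lp ℝ 1 μ) := by
      refine summable_of_tsum_enorm_lt_top (lt_of_le_of_lt (ENNReal.tsum_le_tsum fun n => ?_)
        (hsumU.trans_lt hfin))
      exact hlam.enorm_le_hardyNorm hρ₀1 le_top _
    have hpart : ∀ n, ∑ i ∈ Finset.range n, (u i : Lp ℝ 1 μ) = (v - w n : hardySpace μ lam ρ p) := by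
      intro n
      induction n with
      | zero => simp [hw0]
      | succ n ih =>
        rw [Finset.sum_range_succ, ih, hws]
        simp only [Submodule.coe_sub]
        rw [show ((ι (T n (w n)) : hardySpace μ lam ρ p) : Lp ℝ 1 μ) = u n from rfl]
        abel
    have hwlim : Tendsto (fun n => ((w n : hardySpace μ lam ρ p) : Lp ℝ 1 μ)) atTop (𝓝 0) := by
      rw [← tendsto_add_atTop_iff_nat 1]
      have hlim : Tendsto (fun n : ℕ => (ε : ℝ) * (1 / 2) ^ n) atTop (𝓝 0) := by
        simpa using (tendsto_pow_atTop_nhds_zero_of_lt_one (r := (1 / 2 : ℝ)) (by norm_num)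
          (by norm_num)).const_mul (ε : ℝ)
      refine squeeze_zero_norm (fun n => ?_) hlim
      have h1 := hlam.enorm_le_hardyNorm hρ.le hp.le (w (n + 1) : Lp ℝ 1 μ)
      rw [htoV] at h1
      have h2 := ENNReal.toReal_mono ENNReal.ofReal_ne_top h1
      rw [toReal_enorm, ENNReal.toReal_ofReal (apply_nonneg _ _)] at h2
      exact h2.trans (hwn n)
    have hhas : HasSum (fun n => (u n : Lp ℝ 1 μ)) v := by
      rw [hsummable.hasSum_iff_tendsto_nat]
      simp only [hpart]
      simpa using tendsto_const_nhds (x := (v : Lp ℝ 1 μ)).sub hwlim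
    exact (hlam.hardyNorm_le_tsum hρ₀1 le_top hhas).trans hsumU
  -- A nonzero constant makes the inequality hold outside the space too, where the right side must
  -- be infinite.
  refine ⟨B + 1, fun f => ?_⟩
  by_cases hf : f ∈ hardySpace μ lam ρ p
  · have hlim : Tendsto (fun n : ℕ => B * hardyNorm μ lam ρ p f +
        (2 * B + 2) * (((n + 1 : ℝ≥0)⁻¹ : ℝ≥0) : ℝ≥0∞)) atTop (𝓝 (B * hardyNorm μ lam ρ p f)) := by
      have e1 : Tendsto (fun n : ℕ => (n + 1 : ℝ≥0)⁻¹) atTop (𝓝 0) := by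
        simpa only [one_div] using tendsto_one_div_add_atTop_nhds_zero_nat (𝕜 := ℝ≥0)
      have e2 := ENNReal.Tendsto.const_mul (a := (2 * B + 2 : ℝ≥0∞)) (ENNReal.tendsto_coe.2 e1)
        (Or.inr (by finiteness))
      simpa using tendsto_const_nhds.add e2
    refine (ge_of_tendsto' hlim fun n => key ⟨f, hf⟩ _ (by positivity)).trans ?_
    gcongr
    exact_mod_cast le_self_add
  · have : hardyNorm μ lam ρ p f = ∞ := by
      by_contra h
      exact hf (mem_hardySpace_iff.2 (lt_top_iff_ne_top.2 h))
    rw [this, ENNReal.mul_top (by simp)]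
    exact le_top

end NonHom

namespace NonHom

open Filter Topology

variable {X : Type*} [MetricSpace X] [MeasurableSpace X] {μ : Measure X} {lam : X → ℝ → ℝ}

/-! ### The dual space -/

/-- A function of vanishing oscillation is constant. -/
theorem ae_eq_const_of_rbmoBound_zero [Nonempty X] {σ : ℝ} {g : X → ℝ}
    (hg : AEStronglyMeasurable g μ) (h : RBMOBound μ lam σ g 0) : ∃ c : ℝ, ∀ᵐ y ∂μ, g y = c := by
  obtain ⟨m, h1, h2⟩ := h
  have x₀ : X := Classical.arbitrary X
  have hpos : ∀ n : ℕ, (0 : ℝ) < n + 1 := fun n => by positivity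
  refine ⟨m x₀ 1, ?_⟩
  have hm : ∀ n : ℕ, m x₀ (n + 1) = m x₀ 1 := by
    intro n
    have := h2 x₀ x₀ 1 (n + 1) one_pos (hpos n)
      (ball_subset_ball (by linarith [n.cast_nonneg (α := ℝ)]))
    rw [NNReal.coe_zero, zero_mul, abs_nonpos_iff, sub_eq_zero] at this
    exact this.symm
  have hn : ∀ n : ℕ, ∀ᵐ y ∂μ.restrict (ball x₀ (n + 1)), g y = m x₀ 1 := by
    intro n
    have h3 := h1 x₀ (n + 1) (hpos n)
    rw [ENNReal.coe_zero, zero_mul, nonpos_iff_eq_zero, lintegral_eq_zero_iff'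
      (by exact (hg.restrict.sub aestronglyMeasurable_const).enorm)] at h3
    filter_upwards [h3] with y hy
    rw [Pi.zero_apply, enorm_eq_zero, sub_eq_zero, hm] at hy
    exact hy
  have hU : ⋃ n : ℕ, ball x₀ ((n : ℝ) + 1) = Set.univ := by
    refine Set.eq_univ_of_forall fun y => Set.mem_iUnion.2 ?_
    obtain ⟨n, hn⟩ := exists_nat_gt (dist y x₀)
    exact ⟨n, mem_ball.2 (by linarith)⟩
  have := (ae_restrict_iUnion_iff (fun n : ℕ => ball x₀ ((n : ℝ) + 1)) fun y => g y = m x₀ 1).2 hn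
  rwa [hU, Measure.restrict_univ] at this

variable [BorelSpace X]

theorem IsDominating.hardyDual_ext [Nonempty X] (hlam : IsDominating μ lam) {ρ : ℝ} (hρ : 1 ≤ ρ)
    {q : ℝ≥0∞} (hq : 1 ≤ q) {L L' : hardyDual μ lam ρ q}
    (h : ∀ b c (_ : IsAtomicBlock μ lam ρ q b c) (_ : ∑' j, ‖c j‖ₑ < ∞)
      (hb : b ∈ hardySpace μ lam ρ q), L.1 ⟨b, hb⟩ = L'.1 ⟨b, hb⟩) : L = L' := by
  refine Subtype.ext (sub_eq_zero.1 (hlam.eq_zero_of_blocks hρ hq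
    (hlam.abs_sub_apply_le hρ hq (hlam.abs_apply_le_dualNorm hρ hq L.2)
      (hlam.abs_apply_le_dualNorm hρ hq L'.2)) fun b c hb hc hbm => ?_))
  rw [LinearMap.sub_apply, h b c hb hc hbm, sub_self]

/-- The dual of the atomic Hardy space, for exponents at most `2`. -/
theorem IsDominating.dualIsRBMO [Nonempty X] (hX : GeometricallyDoubling X)
    (hlam : IsDominating μ lam) {σ ρ : ℝ} (hσ : 1 < σ) (hρ : 1 < ρ) {p : ℝ≥0∞}
    (hp : 1 < p) (hp2 : p ≤ 2) : DualIsRBMO μ lam ρ σ p := by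
  have hp' : p < ∞ := hp2.trans_lt ENNReal.ofNat_lt_top
  have hsc := hX.secondCountable
  obtain ⟨A, hA⟩ := hlam.exists_functional hX σ ρ hσ hρ p hp hp'
  obtain ⟨_, hP⟩ := hlam.exists_block_pairing hX σ ρ hσ hρ p hp hp'
  obtain ⟨A₁, hA₁⟩ := hlam.exists_oscBound_of_pairingBound hX hρ
  obtain ⟨A₂, hA₂⟩ := hlam.exists_oscBound_of_oscBound hX ρ σ hρ hσ
  obtain ⟨_, _, hrep⟩ := hlam.exists_rbmo_representation hX hσ hρ le_rfl hp hp2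
  have hbound : ∀ L : hardyDual μ lam ρ p, ∀ f,
      |L.1 f| ≤ (dualNorm L.1).toReal * hardySeminorm hlam hρ.le hp.le f := fun L =>
    hlam.abs_apply_le_dualNorm hρ.le hp.le L.2
  have hbound' : ∀ L : hardyDual μ lam ρ p, ∀ f hf, f ∈ hardySpace μ lam ρ ∞ →
      |L.1 ⟨f, hf⟩| ≤ (dualNorm L.1).toNNReal * (hardyNorm μ lam ρ ∞ f).toReal := by
    intro L f hf hf0
    refine (hbound L ⟨f, hf⟩).trans (mul_le_mul_of_nonneg_left ?_ ENNReal.toReal_nonneg)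
    rw [hardySeminorm_apply]
    exact ENNReal.toReal_mono (mem_hardySpace_iff.1 hf0).ne
      (hardyNorm_mono hlam.measure_ball_lt_top le_top hp.le le_rfl hρ.le f)
  have hfun : ∀ g : rbmo μ lam σ, ∀ C, RBMOBound μ lam σ g.1 C → ∃ L : hardyDual μ lam ρ p,
      IsIntegrationAgainst g.1 L.1 ∧ dualNorm L.1 ≤ (A * C : ℝ≥0) := by
    rintro g C ⟨m, hm⟩
    obtain ⟨L, hL, hI⟩ := hA g.1 m C g.2.1 hm
    have := hlam.dualNorm_le hρ.le hp.le (C := A * C) (by simpa using hL)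
    exact ⟨⟨L, this.trans_lt ENNReal.coe_lt_top⟩, hI, this⟩
  have huniq : ∀ (g : rbmo μ lam σ) (L L' : hardyDual μ lam ρ p), IsIntegrationAgainst g.1 L.1 →
      IsIntegrationAgainst g.1 L'.1 → L = L' := by
    intro g L L' h h'
    obtain ⟨C, m, hm⟩ := g.2.2
    exact Subtype.ext (h.unique hX hlam hσ hρ hp hp' g.2.1 hm (hbound L) (hbound L') h')
  have hblock : ∀ (g : rbmo μ lam σ) b c, IsAtomicBlock μ lam ρ p b c → ∑' j, ‖c j‖ₑ < ∞ →
      Integrable (fun y => b y * g.1 y) μ := by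
    intro g b c hb hc
    obtain ⟨C, m, hm⟩ := g.2.2
    exact (hP g.1 m C g.2.1 hm b c hb hc).1
  -- The choice of an admissible constant is immaterial. Linearity is checked on blocks, where the
  -- products with RBMO functions are integrable and which determine a bounded functional.
  choose F hF using fun g : rbmo μ lam σ => hfun g _ g.2.2.choose_spec
  replace hF := fun g => (hF g).1
  let Φ : rbmo μ lam σ →ₗ[ℝ] hardyDual μ lam ρ p :=
    { toFun := F
      map_add' := fun g h => by
        refine hlam.hardyDual_ext hρ.le hp.le fun b c hb hc hbm => ?_
        have h1 := hblock g b c hb hc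
        have h2 := hblock h b c hb hc
        have h3 := hblock (g + h) b c hb hc
        change (F (g + h)).1 _ = (F g).1 _ + (F h).1 _
        rw [hF (g + h) ⟨b, hbm⟩ h3, hF g ⟨b, hbm⟩ h1, hF h ⟨b, hbm⟩ h2, ← integral_add h1 h2]
        refine integral_congr_ae (ae_of_all _ fun y => ?_)
        exact mul_add _ _ _
      map_smul' := fun t g => by
        refine hlam.hardyDual_ext hρ.le hp.le fun b c hb hc hbm => ?_
        have h1 := hblock g b c hb hc
        have h3 := hblock (t • g) b c hb hc
        change (F (t • g)).1 _ = t * (F g).1 _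
        rw [hF (t • g) ⟨b, hbm⟩ h3, hF g ⟨b, hbm⟩ h1, ← integral_const_mul]
        refine integral_congr_ae (ae_of_all _ fun y => ?_)
        exact mul_left_comm _ _ _ }
  have hΦ : ∀ g, IsIntegrationAgainst g.1 (Φ g).1 := hF
  have hosc : ∀ g, RBMOBound μ lam σ g.1 (A₂ * A₁ * (dualNorm (Φ g).1).toNNReal) := by
    intro g
    have hpair : PairingBound μ lam ρ g.1 (dualNorm (Φ g).1).toNNReal := by
      intro f x r hr hs hb hi
      have hfp := hlam.mem_hardySpace_of_integral_eq_zero hρ.le hp.le hr hs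
        (hs.eLpNorm_lt_top hlam le_top hb) hi
      have := hbound' (Φ g) f hfp
        (hlam.mem_hardySpace_of_integral_eq_zero hρ.le le_top hr hs hb hi)
      rwa [hΦ g ⟨f, hfp⟩ (hs.integrable_mul measurableSet_ball
        (integrableOn_mul_of_eLpNorm_top hb (g.2.1 x r)))] at this
    obtain ⟨m, hm⟩ := hA₁ g.1 _ g.2.1 hpair
    exact ⟨m, by rw [mul_assoc]; exact hA₂ g.1 m _ hm⟩
  refine ⟨Φ, fun g L => ⟨fun h => huniq g L _ h (hΦ g), fun h => h ▸ hΦ g⟩, fun L => ?_,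
    fun g => ⟨fun h => ?_, ?_⟩, A + 1 + A₂ * A₁, fun g => ⟨?_, ?_⟩⟩
  · obtain ⟨g, hg, hI, hosc'⟩ := hrep L.1 _ (hbound L)
    obtain ⟨m, hm⟩ := (hosc' _ (hbound' L)).1
    exact ⟨⟨g, hg, _, m, hm⟩, huniq ⟨g, hg, _, m, hm⟩ _ _ (hΦ _) hI⟩
  · have h0 := hosc g
    have h1 : dualNorm (Φ g).1 = 0 := by
      rw [h]; simp [dualNorm]
    rw [h1, ENNReal.toNNReal_zero, mul_zero] at h0
    exact ae_eq_const_of_rbmoBound_zero (locallyIntegrable_of_ball g.2.1).aestronglyMeasurable h0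
  · rintro ⟨c, hc⟩
    refine hlam.hardyDual_ext hρ.le hp.le fun b d hb hd hbm => ?_
    have h1 := hΦ g ⟨b, hbm⟩ (hblock g b d hb hd)
    obtain ⟨x, r, -, -, hint, -⟩ := hb
    rw [h1]
    change _ = (0 : ℝ)
    have h2 : (fun y => b y * g.1 y) =ᵐ[μ] fun y => b y * c := by
      filter_upwards [hc] with y hy
      rw [hy]
    rw [integral_congr_ae h2, integral_mul_const, hint, zero_mul]
  · have h0 : (A + 1 : ℝ≥0∞) ≠ 0 := by simp
    -- Each admissible `C` yields a functional that uniqueness identifies with `Φ g`. Division by `A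
    -- + 1`, which is never zero, allows passing to the infimum over `C`.
    have h1 : dualNorm (Φ g).1 / (A + 1) ≤ rbmoNorm μ lam σ g.1 := by
      refine le_iInf₂ fun C hC => ENNReal.div_le_of_le_mul ?_
      obtain ⟨L, hL, hn⟩ := hfun g C hC
      rw [huniq g _ _ (hΦ g) hL]
      refine hn.trans ?_
      rw [ENNReal.coe_mul, mul_comm]
      gcongr
      exact le_self_add
    rw [ENNReal.div_le_iff h0 (by finiteness), mul_comm] at h1
    refine h1.trans ?_
    gcongr
    exact_mod_cast le_self_add
  · refine (iInf₂_le _ (hosc g)).trans ?_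
    rw [ENNReal.coe_mul, ENNReal.coe_toNNReal (Φ g).2.ne]
    gcongr
    exact_mod_cast le_add_self

/-! ### Transfer of the duality to all exponents and parameters. -/

theorem IsDominating.dualNorm_comp_ofEq_le [Nonempty X] (hlam : IsDominating μ lam) {ρ₁ ρ₂ : ℝ}
    (hρ₁ : 1 ≤ ρ₁) (hρ₂ : 1 ≤ ρ₂) {q₁ q₂ : ℝ≥0∞} (hq₁ : 1 ≤ q₁) (hq₂ : 1 ≤ q₂)
    (h : hardySpace μ lam ρ₂ q₂ = hardySpace μ lam ρ₁ q₁) {C : ℝ≥0}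
    (hC : ∀ f ∈ hardySpace μ lam ρ₂ q₂, hardyNorm μ lam ρ₁ q₁ f ≤ C * hardyNorm μ lam ρ₂ q₂ f)
    {L : hardySpace μ lam ρ₁ q₁ →ₗ[ℝ] ℝ} (hL : dualNorm L < ∞) :
    dualNorm ((LinearEquiv.ofEq _ _ h).dualMap L) ≤ C * dualNorm L := by
  have key := hlam.dualNorm_le hρ₂ hq₂ (L := (LinearEquiv.ofEq _ _ h).dualMap L)
    (C := C * (dualNorm L).toNNReal) (fun f => by
      refine (hlam.abs_apply_le_dualNorm hρ₁ hq₁ hL (LinearEquiv.ofEq _ _ h f)).trans ?_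
      have h1 := ENNReal.toReal_mono (ENNReal.mul_lt_top ENNReal.coe_lt_top
        (mem_hardySpace_iff.1 f.2)).ne (hC f.1 f.2)
      rw [ENNReal.toReal_mul, ENNReal.coe_toReal] at h1
      rw [hardySeminorm_apply, hardySeminorm_apply]
      calc _ ≤ (dualNorm L).toReal * (C * (hardyNorm μ lam ρ₂ q₂ f.1).toReal) :=
            mul_le_mul_of_nonneg_left h1 ENNReal.toReal_nonneg
        _ = _ := by push_cast; ring)
  rwa [ENNReal.coe_mul, ENNReal.coe_toNNReal hL.ne] at key

/-- The description of the dual depends only on the space and on its norm up to equivalence. -/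
theorem DualIsRBMO.congr [Nonempty X] (hlam : IsDominating μ lam) {ρ₁ ρ₂ σ : ℝ}
    (hρ₁ : 1 ≤ ρ₁) (hρ₂ : 1 ≤ ρ₂) {q₁ q₂ : ℝ≥0∞} (hq₁ : 1 ≤ q₁) (hq₂ : 1 ≤ q₂)
    {C D : ℝ≥0} (hC : ∀ f, hardyNorm μ lam ρ₁ q₁ f ≤ C * hardyNorm μ lam ρ₂ q₂ f)
    (hD : ∀ f, hardyNorm μ lam ρ₂ q₂ f ≤ D * hardyNorm μ lam ρ₁ q₁ f)
    (hdual : DualIsRBMO μ lam ρ₁ σ q₁) : DualIsRBMO μ lam ρ₂ σ q₂ := by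
  have h : hardySpace μ lam ρ₂ q₂ = hardySpace μ lam ρ₁ q₁ := by
    ext f
    rw [mem_hardySpace_iff, mem_hardySpace_iff]
    exact ⟨fun hf => (hC f).trans_lt (ENNReal.mul_lt_top ENNReal.coe_lt_top hf),
      fun hf => (hD f).trans_lt (ENNReal.mul_lt_top ENNReal.coe_lt_top hf)⟩
  set e := LinearEquiv.ofEq _ _ h with he
  have hb₁ : ∀ L : hardySpace μ lam ρ₁ q₁ →ₗ[ℝ] ℝ, dualNorm L < ∞ →
      dualNorm (e.dualMap L) ≤ C * dualNorm L := fun L hL =>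
    hlam.dualNorm_comp_ofEq_le hρ₁ hρ₂ hq₁ hq₂ h (fun f _ => hC f) hL
  have hb₂ : ∀ L : hardySpace μ lam ρ₂ q₂ →ₗ[ℝ] ℝ, dualNorm L < ∞ →
      dualNorm (e.symm.dualMap L) ≤ D * dualNorm L := fun L hL =>
    hlam.dualNorm_comp_ofEq_le hρ₂ hρ₁ hq₂ hq₁ h.symm (fun f _ => hD f) hL
  have hmap : (hardyDual μ lam ρ₁ q₁).map (e.dualMap : _ →ₗ[ℝ] _) = hardyDual μ lam ρ₂ q₂ := by
    ext L
    constructor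
    · rintro ⟨L', hL', rfl⟩
      exact (hb₁ L' hL').trans_lt (ENNReal.mul_lt_top ENNReal.coe_lt_top hL')
    · intro hL
      exact ⟨e.symm.dualMap L, (hb₂ L hL).trans_lt (ENNReal.mul_lt_top ENNReal.coe_lt_top hL), rfl⟩
  let Ψ := e.dualMap.ofSubmodules _ _ hmap
  obtain ⟨Φ, h1, h2, h3, E, h4⟩ := hdual
  refine ⟨Ψ.toLinearMap ∘ₗ Φ, fun g L => ?_, Ψ.surjective.comp h2, fun g => ?_,
    C * E + E * D, fun g => ⟨?_, ?_⟩⟩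
  · have h5 : IsIntegrationAgainst g.1 L.1 ↔ IsIntegrationAgainst g.1 (Ψ.symm L).1 :=
      ⟨fun H f hf => H (e.symm f) hf, fun H f hf => H (e f) hf⟩
    rw [h5, h1]
    exact Ψ.symm_apply_eq
  · rw [← h3]
    exact Ψ.map_eq_zero_iff
  · refine (hb₁ (Φ g).1 (Φ g).2).trans ?_
    calc C * dualNorm (Φ g).1 ≤ C * (E * rbmoNorm μ lam σ g.1) := by gcongr; exact (h4 g).1
      _ = (C * E : ℝ≥0) * rbmoNorm μ lam σ g.1 := by push_cast; ring
      _ ≤ _ := by gcongr; exact le_self_add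
  · refine (h4 g).2.trans ?_
    have h5 := hb₂ (Ψ (Φ g)).1 (Ψ (Φ g)).2
    calc E * dualNorm (Φ g).1 ≤ E * (D * dualNorm (Ψ (Φ g)).1) := by gcongr; exact h5
      _ = (E * D : ℝ≥0) * dualNorm (Ψ (Φ g)).1 := by push_cast; ring
      _ ≤ _ := mul_le_mul_left (ENNReal.coe_le_coe.2 le_add_self) _

/-- All the atomic Hardy norms are equivalent. -/
theorem IsDominating.exists_hardyNorm_le [Nonempty X] (hX : GeometricallyDoubling X)
    (hlam : IsDominating μ lam) {ρ₁ ρ₂ : ℝ} (hρ₁ : 1 < ρ₁) (hρ₂ : 1 < ρ₂) {q₁ q₂ : ℝ≥0∞}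
    (hq₁ : 1 < q₁) (hq₂ : 1 < q₂) :
    ∃ C : ℝ≥0, ∀ f, hardyNorm μ lam ρ₁ q₁ f ≤ C * hardyNorm μ lam ρ₂ q₂ f := by
  -- The exponent is lowered to at most 2, where functionals can be represented through `L²`; the
  -- parameter is raised to the larger one, so that elementary monotonicity gives the rest.
  have h2 : 1 < min q₂ 2 := lt_min hq₂ ENNReal.one_lt_two
  obtain ⟨C, hC⟩ := hlam.exists_hardyNorm_top_le hX hρ₂ (le_max_right ρ₁ ρ₂) h2 (min_le_right _ _)
  refine ⟨C, fun f => ?_⟩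
  calc hardyNorm μ lam ρ₁ q₁ f ≤ hardyNorm μ lam (max ρ₁ ρ₂) ∞ f :=
        hardyNorm_mono hlam.measure_ball_lt_top le_top hq₁.le (le_max_left _ _) hρ₁.le f
    _ ≤ C * hardyNorm μ lam ρ₂ (min q₂ 2) f := hC f
    _ ≤ C * hardyNorm μ lam ρ₂ q₂ f := by
        gcongr
        exact hardyNorm_mono hlam.measure_ball_lt_top (min_le_left _ _) h2.le le_rfl hρ₂.le f

/-- The dual of every atomic Hardy space is RBMO. -/
theorem IsDominating.dualIsRBMO_of_one_lt [Nonempty X] (hX : GeometricallyDoubling X)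
    (hlam : IsDominating μ lam) {σ ρ : ℝ} (hσ : 1 < σ) (hρ : 1 < ρ) {q : ℝ≥0∞} (hq : 1 < q) :
    DualIsRBMO μ lam ρ σ q := by
  obtain ⟨C, hC⟩ := hlam.exists_hardyNorm_le hX hρ hρ ENNReal.one_lt_two hq
  obtain ⟨D, hD⟩ := hlam.exists_hardyNorm_le hX hρ hρ hq ENNReal.one_lt_two
  exact (hlam.dualIsRBMO hX hσ hρ ENNReal.one_lt_two le_rfl).congr hlam hρ.le hρ.le one_le_two hq.le
    hC hD

end NonHom

theorem mainTheorem2 {X : Type*} [MetricSpace X] [Nonempty X] [MeasurableSpace X] [BorelSpace X]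
    (hX : NonHom.GeometricallyDoubling X)
    (μ : MeasureTheory.Measure X) (lam : X → ℝ → ℝ) (hlam : NonHom.IsDominating μ lam)
    (ρ ρ' σ : ℝ) (hρ : 1 < ρ) (hρ' : 1 < ρ') (hσ : 1 < σ)
    (p : ℝ≥0∞) (hp : 1 < p) (hp' : p < ∞) :
    (NonHom.hardySpace μ lam ρ p = NonHom.hardySpace μ lam ρ' ∞ ∧
      ∃ C : ℝ≥0, ∀ f ∈ NonHom.hardySpace μ lam ρ p,
        NonHom.hardyNorm μ lam ρ p f ≤ C * NonHom.hardyNorm μ lam ρ' ∞ f ∧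
        NonHom.hardyNorm μ lam ρ' ∞ f ≤ C * NonHom.hardyNorm μ lam ρ p f) ∧
    NonHom.DualIsRBMO μ lam ρ σ p ∧
    NonHom.DualIsRBMO μ lam ρ' σ ∞ := by
  have h1 : 1 < (∞ : ℝ≥0∞) := ENNReal.one_lt_top
  obtain ⟨C, hC⟩ := hlam.exists_hardyNorm_le hX hρ hρ' hp h1
  obtain ⟨D, hD⟩ := hlam.exists_hardyNorm_le hX hρ' hρ h1 hp
  refine ⟨⟨?_, C + D, fun f _ => ⟨(hC f).trans ?_, (hD f).trans ?_⟩⟩,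
    hlam.dualIsRBMO_of_one_lt hX hσ hρ hp, hlam.dualIsRBMO_of_one_lt hX hσ hρ' h1⟩
  · ext f
    rw [NonHom.mem_hardySpace_iff, NonHom.mem_hardySpace_iff]
    exact ⟨fun hf => (hD f).trans_lt (ENNReal.mul_lt_top ENNReal.coe_lt_top hf),
      fun hf => (hC f).trans_lt (ENNReal.mul_lt_top ENNReal.coe_lt_top hf)⟩
  · exact mul_le_mul_left (ENNReal.coe_le_coe.2 le_self_add) _
  · exact mul_le_mul_left (ENNReal.coe_le_coe.2 le_add_self) _
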